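/- Let $n\ge 1$, let $M^n$ be a closed (compact, connected, without boundary) smooth manifold, and let $x:M^n\to\mathbb{S}^{n+1}\subset\mathbb{R}^{n+2}$ be a smooth minimal immersion. Give $M$ the induced metric $\mathbf g$, with Ricci tensor $\mathrm{Ric}$, scalar curvature $R$ and volume $\mathrm{Vol}(M)$, and let $S$ be the squared length of the second fundamental form of $M$ in $\mathbb{S}^{n+1}$. For $a\in\mathbb{S}^{n+1}$ put $\varphi_a(p)=\langle x(p),a\rangle$, and let $a^{\mathrm T}$ be the tangential component of $a$ along $M$. Call $M$ totally geodesic if its second fundamental form in $\mathbb{S}^{n+1}$ vanishes identically, CSC if $R$ is constant, and Integral-Einstein (IE) if $\int_M(\mathrm{Ric}-\frac Rn\mathbf g)(a^{\mathrm T},a^{\mathrm T})=0$ for every $a\in\mathbb{S}^{n+1}$. Then $$0\le\inf_{a\in\mathbb{S}^{n+1}}\frac{\int_M\varphi_a^2}{\mathrm{Vol}(M)}\le\frac1{n+2}\le\sup_{a\in\mathbb{S}^{n+1}}\frac{\int_M\varphi_a^2}{\mathrm{Vol}(M)}\le\frac1{n+1}.$$ (i) Equality holds in the first inequality if and only if $M$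 is totally geodesic, and equality holds in the last inequality if and only if $M$ is totally geodesic. (ii) Suppose in addition that $M$ is CSC. Then equality holds in the second inequality if and only if $M$ is IE and not totally geodesic, and the same is true of the third inequality. Moreover $S>0$ everywhere if and only if $M$ is not totally geodesic, and in this case $$\frac1{2n}\le\inf_{a\in\mathbb{S}^{n+1}}\frac{\int_M\varphi_a^2}{\mathrm{Vol}(M)},$$ where equality holds if and only if $M$ is the minimal Clifford torus $S^1(\sqrt{\tfrac1n})\times S^{n-1}(\sqrt{\tfrac{n-1}n})\subset\mathbb{R}^2\times\mathbb{R}^n$, in the sense that $x(M)$ is the image of this torus under a linear isometry of $\mathbb{R}^{n+2}$. -/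

import Mathlib

open scoped Manifold ContDiff
open MeasureTheory

noncomputable section

namespace MinimalHypersurface

/-! Local Riemannian geometry of a parametrized submanifold `f : ℝⁿ → ℝᴺ`, in coordinates. -/

/-- The `i`-th partial derivative of a map on `ℝⁿ`. -/
def pd {n : ℕ} {F : Type*} [NormedAddCommGroup F] [NormedSpace ℝ F] (i : Fin n)
    (u : EuclideanSpace ℝ (Fin n) → F) (y : EuclideanSpace ℝ (Fin n)) : F :=
  fderiv ℝ u y (EuclideanSpace.single i 1)

/-- The coefficients `g_ij = ⟨∂_i f, ∂_j f⟩` of the metric induced by `f`. -/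
def gram {n N : ℕ} (f : EuclideanSpace ℝ (Fin n) → EuclideanSpace ℝ (Fin N))
    (y : EuclideanSpace ℝ (Fin n)) : Matrix (Fin n) (Fin n) ℝ :=
  Matrix.of fun i j => inner ℝ (pd i f y) (pd j f y)

/-- The Christoffel symbols `Γ^k_ij = ½ ∑_l g^kl (∂_i g_jl + ∂_j g_il - ∂_l g_ij)` of the
Levi-Civita connection of the induced metric. -/
def christoffel {n N : ℕ} (f : EuclideanSpace ℝ (Fin n) → EuclideanSpace ℝ (Fin N))
    (k i j : Fin n) (y : EuclideanSpace ℝ (Fin n)) : ℝ :=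
  (1 / 2) * ∑ l, (gram f y)⁻¹ k l *
    (pd i (fun z => gram f z j l) y + pd j (fun z => gram f z i l) y
      - pd l (fun z => gram f z i j) y)

/-- The Ricci curvature of the induced metric,
`Ric_jk = ∑_i (∂_i Γ^i_jk - ∂_j Γ^i_ik) + ∑_i ∑_l (Γ^i_il Γ^l_jk - Γ^i_jl Γ^l_ik)`. -/
def ricci {n N : ℕ} (f : EuclideanSpace ℝ (Fin n) → EuclideanSpace ℝ (Fin N))
    (j k : Fin n) (y : EuclideanSpace ℝ (Fin n)) : ℝ :=
  ∑ i, (pd i (christoffel f i j k) y - pd j (christoffel f i i k) y)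
    + ∑ i, ∑ l, (christoffel f i i l y * christoffel f l j k y
      - christoffel f i j l y * christoffel f l i k y)

/-- The scalar curvature `∑ g^jk Ric_jk` of the induced metric. -/
def scalar {n N : ℕ} (f : EuclideanSpace ℝ (Fin n) → EuclideanSpace ℝ (Fin N))
    (y : EuclideanSpace ℝ (Fin n)) : ℝ :=
  ∑ j, ∑ k, (gram f y)⁻¹ j k * ricci f j k y

/-- The coordinates `∑_j g^ij ⟨∂_j f, a⟩` of the tangential component of the vector `a`. -/
def tangentCoord {n N : ℕ} (f : EuclideanSpace ℝ (Fin n) → EuclideanSpace ℝ (Fin N))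
    (a : EuclideanSpace ℝ (Fin N)) (y : EuclideanSpace ℝ (Fin n)) (i : Fin n) : ℝ :=
  ∑ j, (gram f y)⁻¹ i j * inner ℝ (pd j f y) a

/-- The value of `(Ric - (R/n) g)(aᵀ, aᵀ)`. -/
def tracelessRicci {n N : ℕ} (f : EuclideanSpace ℝ (Fin n) → EuclideanSpace ℝ (Fin N))
    (a : EuclideanSpace ℝ (Fin N)) (y : EuclideanSpace ℝ (Fin n)) : ℝ :=
  ∑ i, ∑ j, (ricci f i j y - scalar f y / n * gram f y i j) *
    tangentCoord f a y i * tangentCoord f a y j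

/-- For `f` with values in the unit sphere, the coefficient `B_ij` of the (vector-valued) second
fundamental form in the sphere: the component of `∂_i ∂_j f` that is orthogonal to the tangent
space and to the position vector. For a hypersurface of the sphere with local unit normal `ν`
and shape operator `A` this is `⟨A ∂_i, ∂_j⟩ ν`. -/
def secondFF {n N : ℕ} (f : EuclideanSpace ℝ (Fin n) → EuclideanSpace ℝ (Fin N))
    (i j : Fin n) (y : EuclideanSpace ℝ (Fin n)) : EuclideanSpace ℝ (Fin N) :=
  ((Submodule.span ℝ (insert (f y) (Set.range fun k => pd k f y)))ᗮ).starProjection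
    (pd i (pd j f) y)

/-! Immersions `x : M → ℝᴺ` of a manifold `M` of dimension `n`. Quantities at `p : M` are computed
in the preferred chart around `p`; they do not depend on the chart. -/

section Manifold

variable {n N : ℕ} {M : Type*} [TopologicalSpace M] [ChartedSpace (EuclideanSpace ℝ (Fin n)) M]

/-- The local parametrization given by the preferred chart around `p`. -/
def param (x : M → EuclideanSpace ℝ (Fin N)) (p : M) :
    EuclideanSpace ℝ (Fin n) → EuclideanSpace ℝ (Fin N) :=
  x ∘ (chartAt (EuclideanSpace ℝ (Fin n)) p).symm

/-- The coordinates of `p` in the preferred chart around `p`. -/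
def coord (p : M) : EuclideanSpace ℝ (Fin n) := chartAt (EuclideanSpace ℝ (Fin n)) p p

/-- The measure `√(det g) dy` of the preferred chart around `p`, transported to `M`. -/
def chartMeasure [MeasurableSpace M] (x : M → EuclideanSpace ℝ (Fin N)) (p : M) : Measure M :=
  (((volume : Measure (EuclideanSpace ℝ (Fin n))).restrict
      (chartAt (EuclideanSpace ℝ (Fin n)) p).target).withDensity
    fun y => ENNReal.ofReal (Real.sqrt (gram (param x p) y).det)).map
      (chartAt (EuclideanSpace ℝ (Fin n)) p).symm

/-- A smooth partition of unity subordinate to the preferred charts. -/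
def chartPartition (n : ℕ) (M : Type*) [TopologicalSpace M]
    [ChartedSpace (EuclideanSpace ℝ (Fin n)) M] [IsManifold (𝓡 n) ∞ M] [T2Space M]
    [SigmaCompactSpace M] : SmoothPartitionOfUnity M (𝓡 n) M Set.univ :=
  (SmoothPartitionOfUnity.exists_isSubordinate_chartAt_source (𝓡 n) M).choose

/-- The Riemannian volume measure of the metric on `M` induced by `x`, assembled from the chart
measures by a partition of unity. -/
def vol [IsManifold (𝓡 n) ∞ M] [T2Space M] [SigmaCompactSpace M] [MeasurableSpace M]
    (x : M → EuclideanSpace ℝ (Fin N)) : Measure M :=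
  Measure.sum fun p : M =>
    (chartMeasure (n := n) x p).withDensity fun q => ENNReal.ofReal (chartPartition n M p q)

/-- The quotient `∫_M φ_a² / Vol(M)` for the height function `φ_a = ⟨x, a⟩`. -/
def heightMean [IsManifold (𝓡 n) ∞ M] [T2Space M] [SigmaCompactSpace M] [MeasurableSpace M]
    (x : M → EuclideanSpace ℝ (Fin N)) (a : EuclideanSpace ℝ (Fin N)) : ℝ :=
  (∫ p, (inner ℝ (x p) a) ^ 2 ∂(vol (n := n) x)) / (vol (n := n) x).real Set.univ

/-- Immersions into the unit sphere, regarded as maps to the ambient Euclidean space. -/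
structure IsSphericalImmersion (x : M → EuclideanSpace ℝ (Fin N)) : Prop where
  smooth : ContMDiff (𝓡 n) 𝓘(ℝ, EuclideanSpace ℝ (Fin N)) ∞ x
  norm_eq_one : ∀ p, ‖x p‖ = 1
  immersive : ∀ p, Function.Injective (mfderiv (𝓡 n) 𝓘(ℝ, EuclideanSpace ℝ (Fin N)) x p)

/-- Vanishing mean curvature in the sphere: the trace `∑ g^ij B_ij` of the second fundamental
form is zero everywhere. -/
def IsMinimal (x : M → EuclideanSpace ℝ (Fin N)) : Prop :=
  ∀ p : M, ∑ i : Fin n, ∑ j : Fin n, (gram (param x p) (coord p))⁻¹ i j •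
    secondFF (param x p) i j (coord p) = 0

/-- Vanishing of the second fundamental form in the sphere. -/
def IsTotallyGeodesic (x : M → EuclideanSpace ℝ (Fin N)) : Prop :=
  ∀ (p : M) (i j : Fin n), secondFF (param x p) i j (coord p) = 0

/-- The squared length `S = ∑ g^ik g^jl ⟨B_ij, B_kl⟩` of the second fundamental form. -/
def sqNormSFF (x : M → EuclideanSpace ℝ (Fin N)) (p : M) : ℝ :=
  ∑ i : Fin n, ∑ j : Fin n, ∑ k : Fin n, ∑ l : Fin n,
    (gram (param x p) (coord p))⁻¹ i k * (gram (param x p) (coord p))⁻¹ j l *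
      inner ℝ (secondFF (param x p) i j (coord p)) (secondFF (param x p) k l (coord p))

/-- Constant (intrinsic) scalar curvature. -/
def IsCSC (x : M → EuclideanSpace ℝ (Fin N)) : Prop :=
  ∃ c : ℝ, ∀ p : M, scalar (n := n) (param x p) (coord p) = c

/-- Integral-Einstein: `∫_M (Ric - (R/n) g)(aᵀ, aᵀ) = 0` for every unit vector `a`. -/
def IsIntegralEinstein [IsManifold (𝓡 n) ∞ M] [T2Space M] [SigmaCompactSpace M]
    [MeasurableSpace M] (x : M → EuclideanSpace ℝ (Fin N)) : Prop :=
  ∀ a : EuclideanSpace ℝ (Fin N), ‖a‖ = 1 →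
    ∫ p, tracelessRicci (n := n) (param x p) a (coord p) ∂(vol (n := n) x) = 0

end Manifold

/-- The minimal Clifford torus `S¹(√(1/n)) × S^(n-1)(√((n-1)/n))` in `ℝ² × ℝⁿ = ℝ^(n+2)`. -/
def cliffordTorus (n : ℕ) : Set (EuclideanSpace ℝ (Fin (n + 2))) :=
  {z | z 0 ^ 2 + z 1 ^ 2 = 1 / (n : ℝ) ∧
    ∑ i : Fin n, z i.succ.succ ^ 2 = ((n : ℝ) - 1) / (n : ℝ)}

/-- The immersed hypersurface is the minimal Clifford torus, up to an isometry of the sphere. -/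
def IsClifford {n : ℕ} {M : Type*} (x : M → EuclideanSpace ℝ (Fin (n + 2))) : Prop :=
  ∃ Φ : EuclideanSpace ℝ (Fin (n + 2)) ≃ₗᵢ[ℝ] EuclideanSpace ℝ (Fin (n + 2)),
    Set.range x = Φ '' cliffordTorus n

end MinimalHypersurface

end

/-!
The first derivatives of the height functions `φ = ⟨x, a⟩` and of `ψ = ⟨ν, a⟩`, for a local unit
normal `ν`, enter only through the bracket `carre`, which is invariant under changes of parameters:
it gives the inner product of gradients, the divergence of a tangent field and the trace of the
second fundamental form. As `ν` is only local, the manifold carries `ψ² = |a|² - φ² - |aᵀ|²`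
(`normalSq`) in place of `ψ`, and `|∇ψ|²` is `(S/n) |aᵀ|²` minus the traceless Ricci curvature in
the direction `aᵀ` (`normalEnergy`), by the Gauss equation. Pointwise identities are proved in
coordinates with `g = 1` and normal second derivatives of `x` at one point (`IsAdapted`); a
quadratic change of parameters provides such coordinates.

For a minimal hypersurface `div ∇(φ²/2) = |aᵀ|² - n φ²` and `div ∇(ψ²/2) = |∇ψ|² - S ψ²`. With the
divergence theorem (`integral_Gam_eq_zero`) these give `∫ ψ² = Vol - (n + 1) ∫ φ²`, hence the upper
bound `1 / (n + 1)`, and, when `S` is constant, `∫ |∇ψ|² = S ∫ ψ²`. The mean of `φ²` is a quadratic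
form in `a` of trace one on a space of dimension `n + 2` (`sum_heightMean`), so that its extreme
values lie on either side of `1 / (n + 2)`, and one of them equals `1 / (n + 2)` exactly if the
form is constant on the sphere. For constant `S > 0` this is the Integral-Einstein condition.

The value `0` is attained exactly if `φ` vanishes for some `a`; then `ψ² = 1`, and the identity for
`ψ²` forces `S = 0`. The value `1 / (n + 1)` is attained exactly if `ψ` vanishes for some `a`. In
that case the Codazzi equation gives `⟨∇S, aᵀ⟩ = 2 φ S`, so `m = S φ` satisfies
`⟨∇m, aᵀ⟩ = S (1 + φ²)`: at an extremum of `m` one has `S = 0`, hence `m = 0`, and therefore `S = 0`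
everywhere (`isTotallyGeodesic_of_normalSq_eq_zero`). Conversely the Gauss map of a totally geodesic
hypersurface is constant up to sign, which provides both kinds of `a`.

For constant `S > 0` the lower bound `1 / (2 n)` follows from `n |A v|² ≤ (n - 1) S |v|²` for a
traceless symmetric `A` (`traceless_le`), integrated with `v = aᵀ`. Equality forces the shape
operator, for a suitable local unit normal, to have a simple eigenvalue and one of multiplicity
`n - 1`, which is expressed by `A² = α A + β` with constants `α`, `β` (`QuadRel`,
`exists_isQuadraticAt`). Then `A` is parallel, and the derivative of the quadratic form
`torusForm` in `b` is `2 (β - 1)` times a product of derivatives that is not symmetric; equality of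
the mixed second derivatives gives `β = 1` (`beta_eq_one`), that is `S = n`, and the form is locally
constant. Up to sign it is the same at all points, and at the point `x q` it vanishes for `b = x q`;
hence the form of one fixed point vanishes on the image of `x` (`torusForm_eq_zero`). Its zero set
on the sphere is a Clifford torus (`exists_plane`), which is connected, while the image of `x` is
compact, and open in the torus by the inverse function theorem (`range_eq_torusOver`).
-/

noncomputable section

namespace MinimalHypersurface

/-- Euclidean `n`-space. -/
abbrev E (n : ℕ) := EuclideanSpace ℝ (Fin n)

section PartialDerivatives

variable {n N : ℕ} {F : Type*} [NormedAddCommGroup F] [NormedSpace ℝ F]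
  {F' : Type*} [NormedAddCommGroup F'] [NormedSpace ℝ F']
  {H : Type*} [NormedAddCommGroup H] [InnerProductSpace ℝ H]
  {U : Set (E n)} {y : E n}

lemma differentiableAt_of_contDiffOn {u : E n → F} (hu : ContDiffOn ℝ ∞ u U)
    (hU : IsOpen U) (hy : y ∈ U) : DifferentiableAt ℝ u y :=
  (hu.contDiffAt (hU.mem_nhds hy)).differentiableAt (by simp)

lemma contDiffOn_pd {u : E n → F} (hu : ContDiffOn ℝ ∞ u U) (hU : IsOpen U) (i : Fin n) :
    ContDiffOn ℝ ∞ (pd i u) U :=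
  (hu.fderiv_of_isOpen hU (by simp)).clm_apply contDiffOn_const

lemma pd_congr {u v : E n → F} (h : u =ᶠ[nhds y] v) (i : Fin n) : pd i u y = pd i v y := by
  simp only [pd, h.fderiv_eq]

lemma pd_congr_of_isOpen {u v : E n → F} (hU : IsOpen U) (hy : y ∈ U) (h : Set.EqOn u v U)
    (i : Fin n) : pd i u y = pd i v y :=
  pd_congr (h.eventuallyEq_of_mem (hU.mem_nhds hy)) i

@[simp] lemma pd_const (c : F) (i : Fin n) : pd i (fun _ : E n => c) y = 0 := by
  simp [pd]

lemma pd_add {u v : E n → F} (hu : DifferentiableAt ℝ u y) (hv : DifferentiableAt ℝ v y)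
    (i : Fin n) : pd i (fun z => u z + v z) y = pd i u y + pd i v y := by
  simp [pd, fderiv_fun_add hu hv]

lemma pd_sub {u v : E n → F} (hu : DifferentiableAt ℝ u y) (hv : DifferentiableAt ℝ v y)
    (i : Fin n) : pd i (fun z => u z - v z) y = pd i u y - pd i v y := by
  simp [pd, fderiv_fun_sub hu hv]

lemma pd_neg {u : E n → F} (i : Fin n) : pd i (fun z => - u z) y = - pd i u y := by
  simp [pd, fderiv_fun_neg]

lemma pd_smul {c : E n → ℝ} {u : E n → F} (hc : DifferentiableAt ℝ c y)
    (hu : DifferentiableAt ℝ u y) (i : Fin n) :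
    pd i (fun z => c z • u z) y = pd i c y • u y + c y • pd i u y := by
  simp [pd, fderiv_fun_smul hc hu, add_comm]

lemma pd_mul {c u : E n → ℝ} (hc : DifferentiableAt ℝ c y)
    (hu : DifferentiableAt ℝ u y) (i : Fin n) :
    pd i (fun z => c z * u z) y = pd i c y * u y + c y * pd i u y :=
  pd_smul hc hu i

lemma pd_const_mul {u : E n → ℝ} (c : ℝ)
    (hu : DifferentiableAt ℝ u y) (i : Fin n) :
    pd i (fun z => c * u z) y = c * pd i u y := by
  simp [pd_mul (differentiableAt_const c) hu]

lemma pd_sum {ι : Type*} {s : Finset ι} {u : ι → E n → F}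
    (hu : ∀ k ∈ s, DifferentiableAt ℝ (u k) y) (i : Fin n) :
    pd i (fun z => ∑ k ∈ s, u k z) y = ∑ k ∈ s, pd i (u k) y := by
  simp only [pd, fderiv_fun_sum hu, sum_apply]

lemma pd_inner {u v : E n → H} (hu : DifferentiableAt ℝ u y) (hv : DifferentiableAt ℝ v y)
    (i : Fin n) : pd i (fun z => inner ℝ (u z) (v z)) y
      = inner ℝ (pd i u y) (v y) + inner ℝ (u y) (pd i v y) := by
  simp [pd, fderiv_inner_apply ℝ hu hv, add_comm]

lemma pd_inner_const {u : E n → H} (hu : DifferentiableAt ℝ u y) (a : H)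
    (i : Fin n) : pd i (fun z => inner ℝ (u z) a) y = inner ℝ (pd i u y) a := by
  simp [pd_inner hu (differentiableAt_const a)]

lemma pd_clm {u : E n → F} (hu : DifferentiableAt ℝ u y) (L : F →L[ℝ] F')
    (i : Fin n) : pd i (fun z => L (u z)) y = L (pd i u y) := by
  have := (L.hasFDerivAt.comp y hu.hasFDerivAt).fderiv
  simp only [pd]
  rw [show (fun z => L (u z)) = L ∘ u from rfl, this]; rfl

lemma pd_comm {u : E n → F} (hu : ContDiffOn ℝ ∞ u U) (hU : IsOpen U) (hy : y ∈ U)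
    (i j : Fin n) : pd i (pd j u) y = pd j (pd i u) y := by
  have hu' := hu.contDiffAt (hU.mem_nhds hy)
  have hd : DifferentiableAt ℝ (fderiv ℝ u) y :=
    differentiableAt_of_contDiffOn (hu.fderiv_of_isOpen hU (m := ∞) (by simp)) hU hy
  have hs : IsSymmSndFDerivAt ℝ u y := hu'.isSymmSndFDerivAt (by
    simpa using (WithTop.coe_le_coe.2 (le_top : (2 : ℕ∞) ≤ ⊤)))
  have key : ∀ i j : Fin n, pd i (pd j u) y
      = fderiv ℝ (fderiv ℝ u) y (EuclideanSpace.single i 1) (EuclideanSpace.single j 1) := by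
    intro i j
    have := (hd.hasFDerivAt.clm_apply
      (hasFDerivAt_const (EuclideanSpace.single j (1 : ℝ)) y)).fderiv
    simp only [pd]
    rw [show (pd j u) = fun z => fderiv ℝ u z (EuclideanSpace.single j 1) from rfl, this]
    simp
  rw [key, key, hs]

/-- The derivative is determined by the partial derivatives. -/
lemma fderiv_apply_eq_sum_pd {u : E n → F} (v : E n) :
    fderiv ℝ u y v = ∑ i, v i • pd i u y := by
  conv_lhs => rw [← (EuclideanSpace.basisFun (Fin n) ℝ).sum_repr v]
  simp [pd, map_sum]

lemma fderiv_eq_zero_of_pd {u : E n → F} (h : ∀ i, pd i u y = 0) : fderiv ℝ u y = 0 := by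
  ext v; simp [fderiv_apply_eq_sum_pd, h]

lemma pd_comp {m : ℕ} {u : E n → F} {τ : E m → E n} {z : E m}
    (hu : DifferentiableAt ℝ u (τ z)) (hτ : DifferentiableAt ℝ τ z) (i : Fin m) :
    pd i (u ∘ τ) z = ∑ k, (pd i τ z) k • pd k u (τ z) := by
  simp only [pd, fderiv_comp z hu hτ]
  exact fderiv_apply_eq_sum_pd _

end PartialDerivatives

/-! ### The bracket of first derivatives -/
section Carre

variable {n N : ℕ} {F : Type*} [NormedAddCommGroup F] [InnerProductSpace ℝ F]

/-- The bracket `∑ g^ij ⟨∂_i u, ∂_j v⟩` of two maps on the parameter domain of `f`; for scalar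
functions it is the inner product of the gradients, and for `v = f` the divergence of `u`. -/
def carre (f : E n → E N) (u v : E n → F) (y : E n) : ℝ :=
  ∑ i, ∑ j, (gram f y)⁻¹ i j * inner ℝ (pd i u y) (pd j v y)

/-- The Jacobian matrix `J k i = ∂_i τ^k`. -/
def jacobian (τ : E n → E n) (z : E n) : Matrix (Fin n) (Fin n) ℝ :=
  Matrix.of fun k i => pd i τ z k

/-- The matrix `⟨∂_i u, ∂_j v⟩`. -/
def mixedGram (u v : E n → F) (y : E n) : Matrix (Fin n) (Fin n) ℝ :=
  Matrix.of fun i j => inner ℝ (pd i u y) (pd j v y)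

lemma carre_eq_trace (f : E n → E N) (u v : E n → F) (y : E n) :
    carre f u v y = ((gram f y)⁻¹ * mixedGram v u y).trace := by
  simp [carre, Matrix.trace, Matrix.mul_apply, mixedGram, real_inner_comm]

lemma mixedGram_comp {u v : E n → F} {τ : E n → E n} {z : E n}
    (hu : DifferentiableAt ℝ u (τ z)) (hv : DifferentiableAt ℝ v (τ z))
    (hτ : DifferentiableAt ℝ τ z) :
    mixedGram (u ∘ τ) (v ∘ τ) z
      = (jacobian τ z).transpose * mixedGram u v (τ z) * jacobian τ z := by
  ext i j
  simp only [mixedGram, Matrix.of_apply, pd_comp hu hτ, pd_comp hv hτ, Matrix.mul_apply,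
    Matrix.transpose_apply, jacobian, sum_inner, inner_sum, inner_smul_left, inner_smul_right,
    Finset.sum_mul]
  simp only [RCLike.conj_to_real]
  refine Finset.sum_congr rfl fun k _ => ?_
  rw [Finset.mul_sum]
  refine Finset.sum_congr rfl fun l _ => ?_
  ring

lemma gram_comp {f : E n → E N} {τ : E n → E n} {z : E n}
    (hf : DifferentiableAt ℝ f (τ z)) (hτ : DifferentiableAt ℝ τ z) :
    gram (f ∘ τ) z = (jacobian τ z).transpose * gram f (τ z) * jacobian τ z :=
  mixedGram_comp hf hf hτ

lemma trace_conj_inv {G M J : Matrix (Fin n) (Fin n) ℝ} (hJ : IsUnit J.det) :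
    ((J.transpose * G * J)⁻¹ * (J.transpose * M * J)).trace = (G⁻¹ * M).trace := by
  have hJt : IsUnit J.transpose.det := by rwa [Matrix.det_transpose]
  rw [Matrix.mul_inv_rev, Matrix.mul_inv_rev]
  rw [show J⁻¹ * (G⁻¹ * J.transpose⁻¹) * (J.transpose * M * J)
    = J⁻¹ * (G⁻¹ * (J.transpose⁻¹ * J.transpose) * M * J) by simp only [Matrix.mul_assoc]]
  rw [Matrix.nonsing_inv_mul _ hJt, Matrix.trace_mul_comm, Matrix.mul_assoc,
    Matrix.mul_nonsing_inv _ hJ]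
  simp

/-- The bracket does not depend on the parametrization. -/
lemma carre_comp {f : E n → E N} {u v : E n → F} {τ : E n → E n} {z : E n}
    (hf : DifferentiableAt ℝ f (τ z)) (hu : DifferentiableAt ℝ u (τ z))
    (hv : DifferentiableAt ℝ v (τ z)) (hτ : DifferentiableAt ℝ τ z)
    (hJ : IsUnit (jacobian τ z).det) :
    carre (f ∘ τ) (u ∘ τ) (v ∘ τ) z = carre f u v (τ z) := by
  rw [carre_eq_trace, carre_eq_trace, gram_comp hf hτ, mixedGram_comp hv hu hτ,
    trace_conj_inv hJ]

lemma carre_congr {f f' : E n → E N} {u u' v v' : E n → F} {y : E n}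
    (hf : f =ᶠ[nhds y] f') (hu : u =ᶠ[nhds y] u') (hv : v =ᶠ[nhds y] v') :
    carre f u v y = carre f' u' v' y := by
  simp only [carre, gram, pd_congr hf, pd_congr hu, pd_congr hv]

lemma gram_symm (f : E n → E N) (y : E n) (i j : Fin n) : gram f y i j = gram f y j i := by
  simp [gram, real_inner_comm]

lemma gram_isSymm (f : E n → E N) (y : E n) : (gram f y).IsSymm := by
  ext i j; simp [gram, real_inner_comm]

lemma gram_inv_symm (f : E n → E N) (y : E n) (i j : Fin n) :
    (gram f y)⁻¹ i j = (gram f y)⁻¹ j i := by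
  have : ((gram f y)⁻¹).transpose = (gram f y)⁻¹ := by
    rw [Matrix.transpose_nonsing_inv, (gram_isSymm f y).eq]
  conv_lhs => rw [← this]
  rfl

lemma contDiffOn_gram {f : E n → E N} {U : Set (E n)} (hf : ContDiffOn ℝ ∞ f U) (hU : IsOpen U)
    (i j : Fin n) : ContDiffOn ℝ ∞ (fun y => gram f y i j) U :=
  (contDiffOn_pd hf hU i).inner ℝ (contDiffOn_pd hf hU j)

lemma contDiffOn_det {f : E n → Matrix (Fin n) (Fin n) ℝ} {U : Set (E n)}
    (hf : ∀ i j, ContDiffOn ℝ ∞ (fun y => f y i j) U) :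
    ContDiffOn ℝ ∞ (fun y => (f y).det) U := by
  simp only [Matrix.det_apply']
  refine ContDiffOn.sum fun σ _ => ?_
  exact contDiffOn_const.mul (contDiffOn_prod fun i _ => hf _ _)

lemma contDiffOn_inv_entry {f : E n → Matrix (Fin n) (Fin n) ℝ} {U : Set (E n)}
    (hf : ∀ i j, ContDiffOn ℝ ∞ (fun y => f y i j) U) (hd : ∀ y ∈ U, IsUnit (f y).det)
    (i j : Fin n) : ContDiffOn ℝ ∞ (fun y => (f y)⁻¹ i j) U := by
  simp only [Matrix.inv_def, Ring.inverse_eq_inv', Matrix.smul_apply, Matrix.adjugate_apply]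
  refine ContDiffOn.smul (ContDiffOn.inv (contDiffOn_det hf) fun y hy => (hd y hy).ne_zero) ?_
  refine contDiffOn_det fun k l => ?_
  by_cases hk : k = j
  · subst hk; simpa using contDiffOn_const
  · simpa [Matrix.updateRow_ne hk] using hf k l

lemma contDiffOn_carre {f : E n → E N} {u v : E n → F} {U : Set (E n)} (hU : IsOpen U)
    (hf : ContDiffOn ℝ ∞ f U) (hd : ∀ y ∈ U, IsUnit (gram f y).det)
    (hu : ContDiffOn ℝ ∞ u U) (hv : ContDiffOn ℝ ∞ v U) :
    ContDiffOn ℝ ∞ (carre f u v) U := by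
  refine ContDiffOn.sum fun i _ => ContDiffOn.sum fun j _ => ?_
  exact (contDiffOn_inv_entry (contDiffOn_gram hf hU) hd i j).mul
    ((contDiffOn_pd hu hU i).inner ℝ (contDiffOn_pd hv hU j))

end Carre

/-! ### Local geometry of a minimal hypersurface of the sphere -/

/-- A parametrized hypersurface `f` of the unit sphere, on an open set `U`, together with a unit
normal field `ν`. -/
structure IsFramed {n : ℕ} (f ν : E n → E (n + 2)) (U : Set (E n)) : Prop where
  isOpen : IsOpen U
  smooth : ContDiffOn ℝ ∞ f U
  smooth_normal : ContDiffOn ℝ ∞ ν U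
  det : ∀ y ∈ U, IsUnit (gram f y).det
  inner_self : ∀ y ∈ U, inner ℝ (f y) (f y) = (1 : ℝ)
  normal_self : ∀ y ∈ U, inner ℝ (ν y) (ν y) = (1 : ℝ)
  inner_normal : ∀ y ∈ U, inner ℝ (f y) (ν y) = (0 : ℝ)
  pd_normal : ∀ y ∈ U, ∀ i, inner ℝ (pd i f y) (ν y) = (0 : ℝ)

/-- A parametrized hypersurface of the unit sphere with unit normal field that is minimal:
`∑ g^ij ⟨∂_i ν, ∂_j f⟩ = 0`. -/
structure IsLocalHypersurface {n : ℕ} (f ν : E n → E (n + 2)) (U : Set (E n)) : Prop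
    extends IsFramed f ν U where
  minimal : ∀ y ∈ U, carre f ν f y = 0

/-- The coefficients `h_ij = -⟨∂_i ν, ∂_j f⟩` of the scalar second fundamental form. -/
def sff {n N : ℕ} (f ν : E n → E N) (i j : Fin n) (y : E n) : ℝ :=
  - inner ℝ (pd i ν y) (pd j f y)

section GramInverse

variable {n N : ℕ} {f : E n → E N} {y : E n}

lemma gram_inv_mul (hd : IsUnit (gram f y).det) (i k : Fin n) :
    ∑ j, (gram f y)⁻¹ i j * gram f y j k = if i = k then 1 else 0 := by
  have := congrFun (congrFun (Matrix.nonsing_inv_mul _ hd) i) k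
  rwa [Matrix.mul_apply, Matrix.one_apply] at this

lemma gram_mul_inv (hd : IsUnit (gram f y).det) (i k : Fin n) :
    ∑ j, gram f y i j * (gram f y)⁻¹ j k = if i = k then 1 else 0 := by
  have := congrFun (congrFun (Matrix.mul_nonsing_inv _ hd) i) k
  rwa [Matrix.mul_apply, Matrix.one_apply] at this

/-- The tangent vector with prescribed inner products `v_i` with the coordinate fields. -/
def raise (f : E n → E N) (y : E n) (v : Fin n → ℝ) : E N :=
  ∑ i, ∑ j, ((gram f y)⁻¹ i j * v i) • pd j f y

lemma inner_pd_raise (hd : IsUnit (gram f y).det) (v : Fin n → ℝ) (k : Fin n) :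
    inner ℝ (pd k f y) (raise f y v) = v k := by
  simp only [raise, inner_sum, inner_smul_right]
  have h : ∀ i, ∑ j, (gram f y)⁻¹ i j * v i * inner ℝ (pd k f y) (pd j f y)
      = v i * if i = k then 1 else 0 := by
    intro i
    rw [← gram_inv_mul hd i k, Finset.mul_sum]
    refine Finset.sum_congr rfl fun j _ => ?_
    rw [gram_symm f y j k]
    simp only [gram, Matrix.of_apply]; ring
  simp [h]

lemma inner_raise (v : Fin n → ℝ) (c : E N) :
    inner ℝ (raise f y v) c = ∑ i, ∑ j, (gram f y)⁻¹ i j * (v i * inner ℝ (pd j f y) c) := by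
  simp [raise, sum_inner, inner_smul_left, mul_assoc]

end GramInverse

namespace IsFramed

variable {n : ℕ} {f ν : E n → E (n + 2)} {U : Set (E n)} {y : E n}

lemma mono (h : IsFramed f ν U) {V : Set (E n)} (hV : IsOpen V) (hVU : V ⊆ U) :
    IsFramed f ν V where
  isOpen := hV
  smooth := h.smooth.mono hVU
  smooth_normal := h.smooth_normal.mono hVU
  det y hy := h.det y (hVU hy)
  inner_self y hy := h.inner_self y (hVU hy)
  normal_self y hy := h.normal_self y (hVU hy)
  inner_normal y hy := h.inner_normal y (hVU hy)
  pd_normal y hy := h.pd_normal y (hVU hy)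

lemma diff (h : IsFramed f ν U) (hy : y ∈ U) : DifferentiableAt ℝ f y :=
  differentiableAt_of_contDiffOn h.smooth h.isOpen hy

lemma diff_normal (h : IsFramed f ν U) (hy : y ∈ U) : DifferentiableAt ℝ ν y :=
  differentiableAt_of_contDiffOn h.smooth_normal h.isOpen hy

lemma diff_pd (h : IsFramed f ν U) (hy : y ∈ U) (i : Fin n) :
    DifferentiableAt ℝ (pd i f) y :=
  differentiableAt_of_contDiffOn (contDiffOn_pd h.smooth h.isOpen i) h.isOpen hy

lemma diff_pd_normal (h : IsFramed f ν U) (hy : y ∈ U) (i : Fin n) :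
    DifferentiableAt ℝ (pd i ν) y :=
  differentiableAt_of_contDiffOn (contDiffOn_pd h.smooth_normal h.isOpen i) h.isOpen hy

lemma pd_inner_self (h : IsFramed f ν U) (hy : y ∈ U) (i : Fin n) :
    inner ℝ (pd i f y) (f y) = (0 : ℝ) := by
  have := pd_congr_of_isOpen h.isOpen hy (fun z hz => h.inner_self z hz) i
  rw [pd_inner (h.diff hy) (h.diff hy), pd_const, real_inner_comm (f y)] at this
  rw [real_inner_comm]; linarith

lemma pd_normal_self (h : IsFramed f ν U) (hy : y ∈ U) (i : Fin n) :
    inner ℝ (pd i ν y) (ν y) = (0 : ℝ) := by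
  have := pd_congr_of_isOpen h.isOpen hy (fun z hz => h.normal_self z hz) i
  rw [pd_inner (h.diff_normal hy) (h.diff_normal hy), pd_const,
    real_inner_comm (ν y)] at this
  rw [real_inner_comm]; linarith

lemma pd_normal_inner (h : IsFramed f ν U) (hy : y ∈ U) (i : Fin n) :
    inner ℝ (pd i ν y) (f y) = (0 : ℝ) := by
  have := pd_congr_of_isOpen h.isOpen hy (fun z hz => h.inner_normal z hz) i
  rw [pd_inner (h.diff hy) (h.diff_normal hy), pd_const, h.pd_normal y hy i] at this
  rw [real_inner_comm]; linarith

lemma inner_pd_pd_normal (h : IsFramed f ν U) (hy : y ∈ U) (i j : Fin n) :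
    inner ℝ (pd i (pd j f) y) (ν y) = sff f ν i j y := by
  have := pd_congr_of_isOpen h.isOpen hy (fun z hz => h.pd_normal z hz j) i
  rw [pd_inner (h.diff_pd hy j) (h.diff_normal hy), pd_const] at this
  rw [sff, real_inner_comm (pd j f y)]; linarith

lemma inner_pd_pd_self (h : IsFramed f ν U) (hy : y ∈ U) (i j : Fin n) :
    inner ℝ (pd i (pd j f) y) (f y) = - gram f y i j := by
  have := pd_congr_of_isOpen h.isOpen hy (fun z hz => h.pd_inner_self hz j) i
  rw [pd_inner (h.diff_pd hy j) (h.diff hy), pd_const] at this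
  rw [gram_symm]; simp only [gram, Matrix.of_apply]; linarith

lemma sff_symm (h : IsFramed f ν U) (hy : y ∈ U) (i j : Fin n) :
    sff f ν i j y = sff f ν j i y := by
  rw [← h.inner_pd_pd_normal hy, ← h.inner_pd_pd_normal hy, pd_comm h.smooth h.isOpen hy]

/-- The position vector, the unit normal and the coordinate fields span the ambient space. -/
lemma expand (h : IsFramed f ν U) (hy : y ∈ U) (b : E (n + 2)) :
    b = inner ℝ (f y) b • f y + inner ℝ (ν y) b • ν y
      + raise f y fun i => inner ℝ (pd i f y) b := by
  let T : E (n + 2) →ₗ[ℝ] (ℝ × ℝ × (Fin n → ℝ)) :=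
    (innerₛₗ ℝ (f y)).prod ((innerₛₗ ℝ (ν y)).prod (LinearMap.pi fun i => innerₛₗ ℝ (pd i f y)))
  have hT : ∀ (s t : ℝ) (v : Fin n → ℝ), T (s • f y + t • ν y + raise f y v) = (s, t, v) := by
    intro s t v
    have h1 : inner ℝ (f y) (raise f y v) = (0 : ℝ) := by
      rw [real_inner_comm, inner_raise]; simp [h.pd_inner_self hy]
    have h2 : inner ℝ (ν y) (raise f y v) = (0 : ℝ) := by
      rw [real_inner_comm, inner_raise]; simp [h.pd_normal y hy]
    refine Prod.ext ?_ (Prod.ext ?_ (funext fun k => ?_))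
    · change inner ℝ (f y) _ = s
      rw [inner_add_right, inner_add_right, inner_smul_right, inner_smul_right, h.inner_self y hy,
        h.inner_normal y hy, h1]; ring
    · change inner ℝ (ν y) _ = t
      rw [inner_add_right, inner_add_right, inner_smul_right, inner_smul_right,
        h.normal_self y hy, real_inner_comm, h.inner_normal y hy, h2]; ring
    · change inner ℝ (pd k f y) _ = v k
      rw [inner_add_right, inner_add_right, inner_smul_right, inner_smul_right,
        h.pd_inner_self hy, h.pd_normal y hy, inner_pd_raise (h.det y hy)]; ring
  have hsurj : Function.Surjective T := fun ⟨s, t, v⟩ => ⟨_, hT s t v⟩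
  have hfin : Module.finrank ℝ (E (n + 2)) = Module.finrank ℝ (ℝ × ℝ × (Fin n → ℝ)) := by
    simp [Module.finrank_prod]; omega
  have hinj := (LinearMap.injective_iff_surjective_of_finrank_eq_finrank hfin).2 hsurj
  apply hinj
  rw [hT]; rfl

/-- Parseval's identity for the moving frame. -/
lemma parseval (h : IsFramed f ν U) (hy : y ∈ U) (b c : E (n + 2)) :
    inner ℝ b c = inner ℝ (f y) b * inner ℝ (f y) c + inner ℝ (ν y) b * inner ℝ (ν y) c
      + ∑ i, ∑ j, (gram f y)⁻¹ i j * (inner ℝ (pd i f y) b * inner ℝ (pd j f y) c) := by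
  conv_lhs => rw [h.expand hy b]
  rw [inner_add_left, inner_add_left, inner_smul_left, inner_smul_left, inner_raise]
  simp

/-- The gradients of the height functions are the tangential components. -/
lemma carre_height (h : IsFramed f ν U) (hy : y ∈ U) (a b : E (n + 2)) :
    carre f (fun z => inner ℝ (f z) a) (fun z => inner ℝ (f z) b) y
      = inner ℝ a b - inner ℝ (f y) a * inner ℝ (f y) b - inner ℝ (ν y) a * inner ℝ (ν y) b := by
  rw [h.parseval hy a b, carre]
  simp only [pd_inner_const (h.diff hy)]
  have : ∀ s t : ℝ, inner ℝ s t = s * t := fun s t => by simp [mul_comm]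
  simp only [this]; ring

/-- The Weingarten formula. -/
lemma weingarten (h : IsFramed f ν U) (hy : y ∈ U) (k : Fin n) :
    pd k ν y = - raise f y fun i => sff f ν k i y := by
  rw [h.expand hy (pd k ν y), real_inner_comm, h.pd_normal_inner hy, real_inner_comm,
    h.pd_normal_self hy]
  simp only [raise, ← Finset.sum_neg_distrib, ← neg_smul, sff, zero_smul, zero_add, mul_neg,
    neg_neg]
  simp only [real_inner_comm]

lemma inner_pd_normal_pd_normal (h : IsFramed f ν U) (hy : y ∈ U) (k l : Fin n) :
    inner ℝ (pd k ν y) (pd l ν y)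
      = ∑ i, ∑ j, (gram f y)⁻¹ i j * (sff f ν k i y * sff f ν l j y) := by
  rw [h.parseval hy, real_inner_comm, h.pd_normal_inner hy, real_inner_comm (pd k ν y) (ν y),
    h.pd_normal_self hy]
  simp only [sff, zero_mul, zero_add, real_inner_comm, neg_mul_neg]

lemma pd_gram (h : IsFramed f ν U) (hy : y ∈ U) (k i j : Fin n) :
    pd k (fun z => gram f z i j) y
      = inner ℝ (pd k (pd i f) y) (pd j f y) + inner ℝ (pd i f y) (pd k (pd j f) y) :=
  pd_inner (h.diff_pd hy i) (h.diff_pd hy j) k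

lemma christoffel_eq (h : IsFramed f ν U) (hy : y ∈ U) (k i j : Fin n) :
    christoffel f k i j y
      = ∑ l, (gram f y)⁻¹ k l * inner ℝ (pd i (pd j f) y) (pd l f y) := by
  rw [christoffel, Finset.mul_sum]
  refine Finset.sum_congr rfl fun l _ => ?_
  rw [h.pd_gram hy, h.pd_gram hy, h.pd_gram hy, pd_comm h.smooth h.isOpen hy j i,
    pd_comm h.smooth h.isOpen hy l i, pd_comm h.smooth h.isOpen hy l j,
    real_inner_comm (pd i (pd l f) y) (pd j f y)]
  ring

lemma contDiffOn_gram_inv (h : IsFramed f ν U) (i j : Fin n) :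
    ContDiffOn ℝ ∞ (fun y => (gram f y)⁻¹ i j) U :=
  contDiffOn_inv_entry (contDiffOn_gram h.smooth h.isOpen) h.det i j

lemma contDiffOn_christoffel (h : IsFramed f ν U) (k i j : Fin n) :
    ContDiffOn ℝ ∞ (christoffel f k i j) U := by
  refine ContDiffOn.congr ?_ fun y hy => h.christoffel_eq hy k i j
  refine ContDiffOn.sum fun l _ => (h.contDiffOn_gram_inv k l).mul ?_
  exact (contDiffOn_pd (contDiffOn_pd h.smooth h.isOpen j) h.isOpen i).inner ℝ
    (contDiffOn_pd h.smooth h.isOpen l)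

lemma contDiffOn_sff (h : IsFramed f ν U) (i j : Fin n) :
    ContDiffOn ℝ ∞ (sff f ν i j) U :=
  ((contDiffOn_pd h.smooth_normal h.isOpen i).inner ℝ (contDiffOn_pd h.smooth h.isOpen j)).neg

/-- The Gauss formula. -/
lemma gauss_formula (h : IsFramed f ν U) (hy : y ∈ U) (i j : Fin n) :
    pd i (pd j f) y = ∑ l, christoffel f l i j y • pd l f y + sff f ν i j y • ν y
      + (- gram f y i j) • f y := by
  conv_lhs => rw [h.expand hy (pd i (pd j f) y)]
  rw [real_inner_comm, h.inner_pd_pd_self hy, real_inner_comm, h.inner_pd_pd_normal hy, raise,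
    Finset.sum_comm]
  have : ∑ l, christoffel f l i j y • pd l f y
      = ∑ l, ∑ k, ((gram f y)⁻¹ k l * inner ℝ (pd k f y) (pd i (pd j f) y)) • pd l f y := by
    refine Finset.sum_congr rfl fun l _ => ?_
    rw [h.christoffel_eq hy, Finset.sum_smul]
    refine Finset.sum_congr rfl fun k _ => ?_
    rw [gram_inv_symm, real_inner_comm]
  rw [this]; abel

lemma inner_pd_pd_pd (h : IsFramed f ν U) (hy : y ∈ U) (i j m : Fin n) :
    inner ℝ (pd i (pd j f) y) (pd m f y) = ∑ r, christoffel f r i j y * gram f y r m := by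
  rw [h.gauss_formula hy, inner_add_left, inner_add_left, inner_smul_left, inner_smul_left,
    real_inner_comm (pd m f y) (ν y), h.pd_normal y hy, real_inner_comm (pd m f y) (f y),
    h.pd_inner_self hy]
  simp [sum_inner, inner_smul_left, gram]

/-- The tangential part of the third derivatives. -/
lemma inner_third (h : IsFramed f ν U) (hy : y ∈ U) (i j k m : Fin n) :
    inner ℝ (pd i (pd j (pd k f)) y) (pd m f y)
      = ∑ l, (pd i (christoffel f l j k) y
          + ∑ r, christoffel f r j k y * christoffel f l i r y) * gram f y l m
        - (sff f ν j k y * sff f ν i m y + gram f y j k * gram f y i m) := by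
  have hΓ : ∀ l, DifferentiableAt ℝ (christoffel f l j k) y := fun l =>
    differentiableAt_of_contDiffOn (h.contDiffOn_christoffel l j k) h.isOpen hy
  have hs : DifferentiableAt ℝ (sff f ν j k) y :=
    differentiableAt_of_contDiffOn (h.contDiffOn_sff j k) h.isOpen hy
  have hg : DifferentiableAt ℝ (fun z => - gram f z j k) y :=
    (differentiableAt_of_contDiffOn (contDiffOn_gram h.smooth h.isOpen j k) h.isOpen hy).neg
  rw [pd_congr_of_isOpen h.isOpen hy (fun z hz => h.gauss_formula hz j k) i]
  have h1 : ∀ l ∈ (Finset.univ : Finset (Fin n)),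
      DifferentiableAt ℝ (fun z => christoffel f l j k z • pd l f z) y :=
    fun l _ => (hΓ l).smul (h.diff_pd hy l)
  rw [pd_add ((DifferentiableAt.fun_sum h1).fun_add (hs.fun_smul (h.diff_normal hy)))
      (hg.fun_smul (h.diff hy)),
    pd_add (DifferentiableAt.fun_sum h1) (hs.fun_smul (h.diff_normal hy)), pd_sum h1,
    pd_smul hs (h.diff_normal hy), pd_smul hg (h.diff hy)]
  simp only [fun l => pd_smul (hΓ l) (h.diff_pd hy l) i, inner_add_left, inner_smul_left,
    sum_inner, h.inner_pd_pd_pd hy]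
  rw [real_inner_comm (pd m f y) (ν y), h.pd_normal y hy, real_inner_comm (pd m f y) (f y),
    h.pd_inner_self hy, show inner ℝ (pd i ν y) (pd m f y) = - sff f ν i m y by simp [sff]]
  have e1 : ∀ l, inner ℝ (pd l f y) (pd m f y) = gram f y l m := fun l => rfl
  simp only [e1, RCLike.conj_to_real, add_mul, Finset.sum_add_distrib, Finset.sum_mul,
    Finset.mul_sum]
  rw [Finset.sum_comm (f := fun x i_1 => christoffel f i_1 j k y * christoffel f x i i_1 y
    * gram f y x m)]
  simp only [mul_assoc]
  ring

lemma span_orthogonal (h : IsFramed f ν U) (hy : y ∈ U) (w : E (n + 2)) :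
    ((Submodule.span ℝ (insert (f y) (Set.range fun k => pd k f y)))ᗮ).starProjection w
      = inner ℝ (ν y) w • ν y := by
  set K := Submodule.span ℝ (insert (f y) (Set.range fun k => pd k f y)) with hK
  have hfK : f y ∈ K := Submodule.subset_span (Set.mem_insert _ _)
  have hpK : ∀ k, pd k f y ∈ K := fun k =>
    Submodule.subset_span (Set.mem_insert_of_mem _ ⟨k, rfl⟩)
  apply Submodule.eq_starProjection_of_mem_orthogonal
  · refine Submodule.smul_mem _ _ ?_
    rw [hK, Submodule.mem_orthogonal]
    intro u hu
    induction hu using Submodule.span_induction with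
    | mem u hu =>
      obtain rfl | ⟨k, rfl⟩ := hu
      · exact h.inner_normal y hy
      · exact h.pd_normal y hy k
    | zero => simp
    | add u v _ _ hu hv => rw [inner_add_left, hu, hv, add_zero]
    | smul c u _ hu => rw [inner_smul_left, hu, mul_zero]
  · apply Submodule.le_orthogonal_orthogonal
    have : w - inner ℝ (ν y) w • ν y = inner ℝ (f y) w • f y
        + raise f y fun i => inner ℝ (pd i f y) w := by
      conv_lhs => rw [h.expand hy w]
      have h1 : inner ℝ (ν y) (inner ℝ (f y) w • f y + inner ℝ (ν y) w • ν y
          + raise f y fun i => inner ℝ (pd i f y) w) = inner ℝ (ν y) w := by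
        rw [← h.expand hy w]
      rw [h1]; abel
    rw [this]
    exact K.add_mem (K.smul_mem _ hfK)
      (K.sum_mem fun i _ => K.sum_mem fun j _ => K.smul_mem _ (hpK j))

lemma secondFF_eq (h : IsFramed f ν U) (hy : y ∈ U) (i j : Fin n) :
    secondFF f i j y = sff f ν i j y • ν y := by
  rw [secondFF, h.span_orthogonal hy, real_inner_comm, h.inner_pd_pd_normal hy]

lemma _root_.MinimalHypersurface.carre_normal_self :
    carre f ν f y = - ∑ i, ∑ j, (gram f y)⁻¹ i j * sff f ν i j y := by
  simp [carre, sff]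

/-- The squared length of the second fundamental form. -/
lemma carre_normal_normal (h : IsFramed f ν U) (hy : y ∈ U) :
    carre f ν ν y = ∑ i, ∑ j, ∑ k, ∑ l, (gram f y)⁻¹ i k * (gram f y)⁻¹ j l *
      (sff f ν i j y * sff f ν k l y) := by
  simp only [carre, h.inner_pd_normal_pd_normal hy, Finset.mul_sum]
  refine Finset.sum_congr rfl fun i _ => ?_
  rw [Finset.sum_comm]
  refine Finset.sum_congr rfl fun j _ => ?_
  refine Finset.sum_congr rfl fun k _ => Finset.sum_congr rfl fun l _ => ?_
  ring

end IsFramed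

namespace IsLocalHypersurface

variable {n : ℕ} {f ν : E n → E (n + 2)} {U : Set (E n)} {y : E n}

/-- The Gauss equation, traced: `Ric = (n - 1) g - h g⁻¹ h`. -/
lemma ricci_eq (h : IsLocalHypersurface f ν U) (hy : y ∈ U) (j k : Fin n) :
    ricci f j k y = ((n : ℝ) - 1) * gram f y j k
      - inner ℝ (pd j ν y) (pd k ν y) := by
  have hshape : inner ℝ (pd j ν y) (pd k ν y)
      = ∑ i, ∑ m, (gram f y)⁻¹ i m * (sff f ν i k y * sff f ν j m y) := by
    rw [real_inner_comm, h.inner_pd_normal_pd_normal hy]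
    simp only [h.sff_symm hy k]
  rw [hshape]
  -- `Q l i` are the components of the Riemann tensor in terms of the Christoffel symbols, and `R i m`
  -- is what the Gauss equation makes of them after lowering an index.
  set Q : Fin n → Fin n → ℝ := fun l i => pd i (christoffel f l j k) y
    - pd j (christoffel f l i k) y + ∑ r, (christoffel f l i r y * christoffel f r j k y
      - christoffel f l j r y * christoffel f r i k y) with hQ
  set R : Fin n → Fin n → ℝ := fun i m => (sff f ν j k y * sff f ν i m y
    + gram f y j k * gram f y i m) - (sff f ν i k y * sff f ν j m y
    + gram f y i k * gram f y j m) with hR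
  have hQR : ∀ i m, ∑ l, Q l i * gram f y l m = R i m := by
    intro i m
    have e := h.inner_third hy i j k m
    -- equality of the third derivatives of `f` in two orders
    rw [pd_comm (contDiffOn_pd h.smooth h.isOpen k) h.isOpen hy i j, h.inner_third hy j i k m] at e
    have : ∑ l, Q l i * gram f y l m
        = ∑ l, (pd i (christoffel f l j k) y
          + ∑ r, christoffel f r j k y * christoffel f l i r y) * gram f y l m
          - ∑ l, (pd j (christoffel f l i k) y
          + ∑ r, christoffel f r i k y * christoffel f l j r y) * gram f y l m := by
      rw [← Finset.sum_sub_distrib]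
      refine Finset.sum_congr rfl fun l _ => ?_
      simp only [hQ, Finset.sum_sub_distrib, mul_comm (christoffel f l _ _ y)]
      ring
    rw [this, hR]; linarith
  have hQi : ∀ i, Q i i = ∑ m, R i m * (gram f y)⁻¹ m i := by
    intro i
    simp only [← hQR, Finset.sum_mul]
    rw [Finset.sum_comm]
    have : ∀ l, ∑ m, Q l i * gram f y l m * (gram f y)⁻¹ m i = Q l i * if l = i then 1 else 0 := by
      intro l
      rw [← gram_mul_inv (h.det y hy), Finset.mul_sum]
      simp only [mul_assoc]
    simp [this]
  have hric : ricci f j k y = ∑ i, Q i i := by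
    simp only [ricci, hQ, Finset.sum_add_distrib]
  have hmin : ∑ i, ∑ m, sff f ν i m y * (gram f y)⁻¹ m i = 0 := by
    have := h.minimal y hy
    rw [carre] at this
    simp only [sff, neg_mul, Finset.sum_neg_distrib, neg_eq_zero]
    rw [← this]
    refine Finset.sum_congr rfl fun i _ => Finset.sum_congr rfl fun m _ => ?_
    rw [gram_inv_symm, mul_comm]
  have htr : ∑ i, ∑ m, gram f y i m * (gram f y)⁻¹ m i = n := by
    simp [gram_mul_inv (h.det y hy)]
  have hg : ∑ i, ∑ m, gram f y i k * gram f y j m * (gram f y)⁻¹ m i = gram f y j k := by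
    have : ∀ i, ∑ m, gram f y i k * gram f y j m * (gram f y)⁻¹ m i
        = gram f y i k * if j = i then 1 else 0 := by
      intro i
      rw [← gram_mul_inv (h.det y hy), Finset.mul_sum]
      simp only [mul_assoc]
    simp [this]
  rw [hric]
  simp only [hQi, hR, sub_mul, add_mul, Finset.sum_sub_distrib, Finset.sum_add_distrib]
  rw [hg]
  have e1 : ∑ i, ∑ m, sff f ν j k y * sff f ν i m y * (gram f y)⁻¹ m i = 0 := by
    simp only [mul_assoc, ← Finset.mul_sum, hmin, mul_zero]
  have e2 : ∑ i, ∑ m, gram f y j k * gram f y i m * (gram f y)⁻¹ m i = gram f y j k * n := by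
    simp only [mul_assoc, ← Finset.mul_sum, htr]
  have e3 : ∑ i, ∑ m, sff f ν i k y * sff f ν j m y * (gram f y)⁻¹ m i
      = ∑ i, ∑ m, (gram f y)⁻¹ i m * (sff f ν i k y * sff f ν j m y) := by
    refine Finset.sum_congr rfl fun i _ => Finset.sum_congr rfl fun m _ => ?_
    rw [gram_inv_symm, mul_comm]
  rw [e1, e2, e3]; ring

lemma scalar_eq (h : IsLocalHypersurface f ν U) (hy : y ∈ U) :
    scalar f y = n * ((n : ℝ) - 1) - carre f ν ν y := by
  have e1 : ∑ j, ∑ k, (gram f y)⁻¹ j k * (((n : ℝ) - 1) * gram f y j k) = n * ((n : ℝ) - 1) := by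
    have : ∀ j, ∑ k, (gram f y)⁻¹ j k * (((n : ℝ) - 1) * gram f y j k) = (n : ℝ) - 1 := by
      intro j
      have e := gram_inv_mul (h.det y hy) j j
      rw [if_pos rfl] at e
      calc _ = ((n : ℝ) - 1) * ∑ k, (gram f y)⁻¹ j k * gram f y k j := by
            rw [Finset.mul_sum]
            refine Finset.sum_congr rfl fun k _ => ?_
            rw [gram_symm f y k j]; ring
        _ = _ := by rw [e, mul_one]
    simp only [this, Finset.sum_const, Finset.card_univ, Fintype.card_fin, nsmul_eq_mul]
  have e2 : ∀ j k, (gram f y)⁻¹ j k * (((n : ℝ) - 1) * gram f y j k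
      - inner ℝ (pd j ν y) (pd k ν y)) = (gram f y)⁻¹ j k * (((n : ℝ) - 1) * gram f y j k)
      - (gram f y)⁻¹ j k * inner ℝ (pd j ν y) (pd k ν y) := fun j k => mul_sub _ _ _
  simp only [scalar, h.ricci_eq hy, e2, Finset.sum_sub_distrib, e1]
  rfl

lemma pd_normal_eq_tangentCoord (h : IsLocalHypersurface f ν U) (hy : y ∈ U) (a : E (n + 2))
    (k : Fin n) :
    inner ℝ (pd k ν y) a = - ∑ i, sff f ν k i y * tangentCoord f a y i := by
  rw [h.weingarten hy, inner_neg_left, inner_raise]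
  simp only [tangentCoord, Finset.mul_sum]
  congr 1
  refine Finset.sum_congr rfl fun i _ => Finset.sum_congr rfl fun j _ => ?_
  ring

/-- The traceless Ricci curvature in the direction `aᵀ` is `(S/n) |aᵀ|² - |A aᵀ|²`. -/
lemma tracelessRicci_eq (h : IsLocalHypersurface f ν U) (hn : 1 ≤ n) (hy : y ∈ U)
    (a : E (n + 2)) :
    tracelessRicci f a y = carre f ν ν y / n *
        carre f (fun z => inner ℝ (f z) a) (fun z => inner ℝ (f z) a) y
      - carre f (fun z => inner ℝ (ν z) a) (fun z => inner ℝ (ν z) a) y := by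
  -- `ξ` are the contravariant components of `aᵀ`
  set ξ := tangentCoord f a y with hξ
  have hgξ : ∀ i, ∑ j, gram f y i j * ξ j = inner ℝ (pd i f y) a := by
    intro i
    simp only [hξ, tangentCoord, Finset.mul_sum]
    rw [Finset.sum_comm]
    have : ∀ k, ∑ j, gram f y i j * ((gram f y)⁻¹ j k * inner ℝ (pd k f y) a)
        = (if i = k then 1 else 0) * inner ℝ (pd k f y) a := fun k => by
      rw [← gram_mul_inv (h.det y hy), Finset.sum_mul]
      exact Finset.sum_congr rfl fun j _ => by ring
    simp [this]
  have hφ : ∑ i, ∑ j, gram f y i j * ξ i * ξ j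
      = carre f (fun z => inner ℝ (f z) a) (fun z => inner ℝ (f z) a) y := by
    have : ∀ i, ∑ j, gram f y i j * ξ i * ξ j = inner ℝ (pd i f y) a * ξ i := fun i => by
      rw [← hgξ, Finset.sum_mul]; exact Finset.sum_congr rfl fun j _ => by ring
    rw [Finset.sum_congr rfl fun i _ => this i]
    simp only [carre, pd_inner_const (h.diff hy), hξ, tangentCoord, Finset.mul_sum]
    refine Finset.sum_congr rfl fun i _ => Finset.sum_congr rfl fun j _ => ?_
    simp; ring
  have hψ : ∑ i, ∑ j, inner ℝ (pd i ν y) (pd j ν y) * ξ i * ξ j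
      = carre f (fun z => inner ℝ (ν z) a) (fun z => inner ℝ (ν z) a) y := by
    have e0 := h.pd_normal_eq_tangentCoord hy a
    simp only [carre, pd_inner_const (h.diff_normal hy), e0, h.inner_pd_normal_pd_normal hy]
    have e1 : ∀ k l, (gram f y)⁻¹ k l * inner ℝ (-∑ i, sff f ν k i y * tangentCoord f a y i)
        (-∑ i, sff f ν l i y * tangentCoord f a y i)
        = ∑ i, ∑ j, (gram f y)⁻¹ k l * (sff f ν i k y * sff f ν j l y) * ξ i * ξ j := by
      intro k l
      have : ∀ s t : ℝ, inner ℝ s t = s * t := fun s t => by simp [mul_comm]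
      rw [this, neg_mul_neg, Finset.sum_mul_sum, Finset.mul_sum]
      refine Finset.sum_congr rfl fun i _ => ?_
      rw [Finset.mul_sum]
      refine Finset.sum_congr rfl fun j _ => ?_
      rw [h.sff_symm hy k i, h.sff_symm hy l j]; ring
    simp only [e1, Finset.sum_mul]
    calc ∑ i, ∑ j, ∑ k, ∑ l, (gram f y)⁻¹ k l * (sff f ν i k y * sff f ν j l y) * ξ i * ξ j
        = ∑ i, ∑ k, ∑ j, ∑ l, (gram f y)⁻¹ k l * (sff f ν i k y * sff f ν j l y) * ξ i * ξ j :=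
          Finset.sum_congr rfl fun i _ => Finset.sum_comm
      _ = ∑ k, ∑ i, ∑ j, ∑ l, (gram f y)⁻¹ k l * (sff f ν i k y * sff f ν j l y) * ξ i * ξ j :=
          Finset.sum_comm
      _ = ∑ k, ∑ i, ∑ l, ∑ j, (gram f y)⁻¹ k l * (sff f ν i k y * sff f ν j l y) * ξ i * ξ j :=
          Finset.sum_congr rfl fun k _ => Finset.sum_congr rfl fun i _ => Finset.sum_comm
      _ = _ := Finset.sum_congr rfl fun k _ => Finset.sum_comm
  have hn0 : (n : ℝ) ≠ 0 := by positivity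
  simp only [tracelessRicci, h.ricci_eq hy, h.scalar_eq hy]
  have e2 : ∀ i j, (((n : ℝ) - 1) * gram f y i j - inner ℝ (pd i ν y) (pd j ν y)
      - (n * ((n : ℝ) - 1) - carre f ν ν y) / n * gram f y i j) * ξ i * ξ j
      = carre f ν ν y / n * (gram f y i j * ξ i * ξ j)
        - inner ℝ (pd i ν y) (pd j ν y) * ξ i * ξ j := by
    intro i j; field_simp; ring
  rw [Finset.sum_congr rfl fun i _ => Finset.sum_congr rfl fun j _ => e2 i j]
  simp only [Finset.sum_sub_distrib, ← Finset.mul_sum, hφ, hψ]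

end IsLocalHypersurface

/-! ### Change of parameters and adapted coordinates -/

section Reparam

variable {n : ℕ}

lemma isUnit_det_gram_comp {N : ℕ} {f : E n → E N} {τ : E n → E n} {z : E n}
    (hf : DifferentiableAt ℝ f (τ z)) (hτ : DifferentiableAt ℝ τ z)
    (hd : IsUnit (gram f (τ z)).det) (hJ : IsUnit (jacobian τ z).det) :
    IsUnit (gram (f ∘ τ) z).det := by
  rw [gram_comp hf hτ, Matrix.det_mul, Matrix.det_mul, Matrix.det_transpose]
  exact (hJ.mul hd).mul hJ

lemma pd_eq_zero_of_comp {F : Type*} [NormedAddCommGroup F] [NormedSpace ℝ F]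
    {w : E n → F} {τ : E n → E n} {z : E n}
    (hw : DifferentiableAt ℝ w (τ z)) (hτ : DifferentiableAt ℝ τ z)
    (hJ : IsUnit (jacobian τ z).det) (h : ∀ i, pd i (w ∘ τ) z = 0) (k : Fin n) :
    pd k w (τ z) = 0 := by
  have h1 : ∀ i, ∑ l, jacobian τ z l i • pd l w (τ z) = 0 := fun i => by
    rw [← h i, pd_comp hw hτ]; rfl
  have h2 : ∑ i, (jacobian τ z)⁻¹ i k • ∑ l, jacobian τ z l i • pd l w (τ z) = 0 := by
    simp [h1]
  simp only [Finset.smul_sum, smul_smul] at h2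
  rw [Finset.sum_comm] at h2
  have h3 : ∀ l, ∑ i, (jacobian τ z)⁻¹ i k * jacobian τ z l i = if l = k then 1 else 0 := by
    intro l
    have := congrFun (congrFun (Matrix.mul_nonsing_inv _ hJ) l) k
    rw [Matrix.mul_apply, Matrix.one_apply] at this
    rw [← this]
    exact Finset.sum_congr rfl fun i _ => mul_comm _ _
  simp only [← Finset.sum_smul, h3, ite_smul, one_smul, zero_smul] at h2
  simpa using h2

lemma IsFramed.comp {f ν : E n → E (n + 2)} {U V : Set (E n)} {τ : E n → E n}
    (h : IsFramed f ν U) (hV : IsOpen V) (hτ : ContDiffOn ℝ ∞ τ V)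
    (hm : Set.MapsTo τ V U) (hJ : ∀ z ∈ V, IsUnit (jacobian τ z).det) :
    IsFramed (f ∘ τ) (ν ∘ τ) V := by
  have hd : ∀ z ∈ V, DifferentiableAt ℝ τ z := fun z hz =>
    differentiableAt_of_contDiffOn hτ hV hz
  refine ⟨hV, h.smooth.comp hτ hm, h.smooth_normal.comp hτ hm, fun z hz => ?_,
    fun z hz => h.inner_self _ (hm hz), fun z hz => h.normal_self _ (hm hz),
    fun z hz => h.inner_normal _ (hm hz), fun z hz i => ?_⟩
  · exact isUnit_det_gram_comp (h.diff (hm hz)) (hd z hz) (h.det _ (hm hz)) (hJ z hz)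
  · rw [pd_comp (h.diff (hm hz)) (hd z hz), sum_inner]
    refine Finset.sum_eq_zero fun k _ => ?_
    rw [inner_smul_left, Function.comp_apply, h.pd_normal _ (hm hz)]; simp

lemma IsLocalHypersurface.comp {f ν : E n → E (n + 2)} {U V : Set (E n)} {τ : E n → E n}
    (h : IsLocalHypersurface f ν U) (hV : IsOpen V) (hτ : ContDiffOn ℝ ∞ τ V)
    (hm : Set.MapsTo τ V U) (hJ : ∀ z ∈ V, IsUnit (jacobian τ z).det) :
    IsLocalHypersurface (f ∘ τ) (ν ∘ τ) V where
  toIsFramed := h.toIsFramed.comp hV hτ hm hJ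
  minimal z hz := by
    rw [carre_comp (h.diff (hm hz)) (h.diff_normal (hm hz)) (h.diff (hm hz))
      (differentiableAt_of_contDiffOn hτ hV hz) (hJ z hz)]
    exact h.minimal _ (hm hz)

open scoped MatrixOrder Matrix.Norms.L2Operator in
/-- A Gram matrix is normalized by a change of basis. -/
lemma exists_normalize_gram {N : ℕ} {f : E n → E N} {y : E n} (hd : IsUnit (gram f y).det) :
    ∃ L : Matrix (Fin n) (Fin n) ℝ, IsUnit L.det ∧ L.transpose * gram f y * L = 1 := by
  have hpos : (gram f y).PosSemidef := by
    refine Matrix.PosSemidef.of_dotProduct_mulVec_nonneg ?_ fun v => ?_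
    · ext i j; simp [gram, real_inner_comm]
    · have : star v ⬝ᵥ (gram f y).mulVec v
          = inner ℝ (∑ i, v i • pd i f y) (∑ i, v i • pd i f y) := by
        simp only [dotProduct, Matrix.mulVec, sum_inner, inner_sum, inner_smul_left,
          inner_smul_right, gram, Matrix.of_apply, Finset.mul_sum]
        refine Finset.sum_congr rfl fun i _ => Finset.sum_congr rfl fun j _ => ?_
        simp only [Pi.star_apply, star_trivial, RCLike.conj_to_real]
        rw [real_inner_comm]; ring
      rw [this]; exact real_inner_self_nonneg
  obtain ⟨B, hB⟩ : ∃ B : Matrix (Fin n) (Fin n) ℝ, gram f y = B.transpose * B := by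
    obtain ⟨B, hB⟩ := CStarAlgebra.nonneg_iff_eq_star_mul_self.1 hpos.nonneg
    exact ⟨B, by rw [hB, Matrix.star_eq_conjTranspose, Matrix.conjTranspose_eq_transpose_of_trivial]⟩
  have hBd : IsUnit B.det := by
    rw [hB, Matrix.det_mul] at hd; exact isUnit_of_mul_isUnit_right hd
  refine ⟨B⁻¹, by rw [Matrix.det_nonsing_inv, Ring.inverse_eq_inv']
                  exact hBd.ne_zero.isUnit.inv, ?_⟩
  rw [hB, Matrix.transpose_nonsing_inv]
  have hBt : IsUnit B.transpose.det := by rwa [Matrix.det_transpose]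
  rw [← Matrix.mul_assoc, Matrix.nonsing_inv_mul _ hBt, Matrix.one_mul,
    Matrix.mul_nonsing_inv _ hBd]

/-- A quadratic change of coordinates with prescribed first and second derivatives at `0`. -/
def quadMap (y : E n) (L : Fin n → E n) (Q : Fin n → Fin n → E n) (z : E n) : E n :=
  y + ∑ i, z i • L i + ∑ i, ∑ j, (z i * z j) • Q i j

lemma contDiff_coord (i : Fin n) : ContDiff ℝ ∞ (fun z : E n => z i) :=
  (EuclideanSpace.proj i : E n →L[ℝ] ℝ).contDiff

lemma pd_coord (i j : Fin n) (z : E n) : pd i (fun z : E n => z j) z = if i = j then 1 else 0 := by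
  have := (EuclideanSpace.proj j : E n →L[ℝ] ℝ).fderiv (x := z)
  simp only [pd]
  rw [show (fun z : E n => z j) = (EuclideanSpace.proj j : E n →L[ℝ] ℝ) from rfl, this]
  simp [eq_comm]

lemma contDiff_quadMap (y : E n) (L : Fin n → E n) (Q : Fin n → Fin n → E n) :
    ContDiff ℝ ∞ (quadMap y L Q) := by
  unfold quadMap
  refine (contDiff_const.add (ContDiff.sum fun i _ => ?_)).add
    (ContDiff.sum fun i _ => ContDiff.sum fun j _ => ?_)
  · exact (contDiff_coord i).smul contDiff_const
  · exact ((contDiff_coord i).mul (contDiff_coord j)).smul contDiff_const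

lemma pd_quadMap (y : E n) (L : Fin n → E n) (Q : Fin n → Fin n → E n)
    (hQ : ∀ i j, Q i j = Q j i) (z : E n) (i : Fin n) :
    pd i (quadMap y L Q) z = L i + (2 : ℝ) • ∑ j, z j • Q i j := by
  have hc : ∀ i : Fin n, DifferentiableAt ℝ (fun z : E n => z i) z := fun i =>
    (contDiff_coord i).differentiable (by simp) z
  have h1 : ∀ j ∈ (Finset.univ : Finset (Fin n)),
    DifferentiableAt ℝ (fun z : E n => z j • L j) z := fun j _ =>
      (hc j).fun_smul (differentiableAt_const _)
  have h2 : ∀ j k, DifferentiableAt ℝ (fun z : E n => (z j * z k) • Q j k) z := fun j k =>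
      ((hc j).fun_mul (hc k)).fun_smul (differentiableAt_const _)
  have h3 : ∀ j ∈ (Finset.univ : Finset (Fin n)),
      DifferentiableAt ℝ (fun z : E n => ∑ k, (z j * z k) • Q j k) z := fun j _ =>
    DifferentiableAt.fun_sum fun k _ => h2 j k
  unfold quadMap
  rw [pd_add ((differentiableAt_const _).fun_add (DifferentiableAt.fun_sum h1))
      (DifferentiableAt.fun_sum h3),
    pd_add (differentiableAt_const _) (DifferentiableAt.fun_sum h1), pd_const, pd_sum h1,
    pd_sum h3]
  have e1 : ∀ j, pd i (fun z : E n => z j • L j) z = (if i = j then (1 : ℝ) else 0) • L j := by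
    intro j
    rw [pd_smul (hc j) (differentiableAt_const _), pd_coord]; simp
  have e2 : ∀ j, pd i (fun z : E n => ∑ k, (z j * z k) • Q j k) z
      = ∑ k, ((if i = j then (1 : ℝ) else 0) * z k + z j * if i = k then 1 else 0) • Q j k := by
    intro j
    rw [pd_sum fun k _ => h2 j k]
    refine Finset.sum_congr rfl fun k _ => ?_
    rw [pd_smul ((hc j).fun_mul (hc k)) (differentiableAt_const _), pd_mul (hc j) (hc k),
      pd_coord, pd_coord]; simp
  simp only [e1, e2, add_smul, Finset.sum_add_distrib, ite_smul, mul_ite, ite_mul, one_mul,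
    zero_mul, mul_one, mul_zero, zero_smul, one_smul, zero_add, two_smul]
  simp only [Finset.sum_ite_eq, Finset.mem_univ, if_true]
  rw [Finset.sum_comm]
  simp [hQ i]

lemma pd_quadMap_zero (y : E n) (L : Fin n → E n) (Q : Fin n → Fin n → E n)
    (hQ : ∀ i j, Q i j = Q j i) (i j : Fin n) :
    pd i (pd j (quadMap y L Q)) 0 = (2 : ℝ) • Q j i := by
  have hc : ∀ i : Fin n, DifferentiableAt ℝ (fun z : E n => z i) 0 := fun i =>
    (contDiff_coord i).differentiable (by simp) 0
  rw [show pd j (quadMap y L Q) = fun z => L j + (2 : ℝ) • ∑ k, z k • Q j k from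
    funext fun z => pd_quadMap y L Q hQ z j]
  have h1 : ∀ k ∈ (Finset.univ : Finset (Fin n)),
    DifferentiableAt ℝ (fun z : E n => z k • Q j k) 0 := fun k _ =>
      (hc k).fun_smul (differentiableAt_const _)
  rw [pd_add (differentiableAt_const _)
      ((differentiableAt_const _).fun_smul (DifferentiableAt.fun_sum h1)), pd_const,
    pd_smul (differentiableAt_const _) (DifferentiableAt.fun_sum h1), pd_sum h1, pd_const]
  have e1 : ∀ k, pd i (fun z : E n => z k • Q j k) 0 = (if i = k then (1 : ℝ) else 0) • Q j k := by
    intro k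
    rw [pd_smul (hc k) (differentiableAt_const _), pd_coord]; simp
  simp [e1]

/-- Second derivatives of a composition. -/
lemma pd_pd_comp {N : ℕ} {f : E n → E N} {U : Set (E n)} (hU : IsOpen U)
    (hf : ContDiffOn ℝ ∞ f U) {τ : E n → E n} (hτ : ContDiff ℝ ∞ τ) {z : E n} (hz : τ z ∈ U)
    (i j : Fin n) :
    pd i (pd j (f ∘ τ)) z = ∑ k, pd i (pd j τ) z k • pd k f (τ z)
      + ∑ k, ∑ l, (pd j τ z k * pd i τ z l) • pd l (pd k f) (τ z) := by
  have hV : IsOpen (τ ⁻¹' U) := hU.preimage hτ.continuous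
  have hd : ∀ z, DifferentiableAt ℝ τ z := hτ.differentiable (by simp)
  have e1 : Set.EqOn (pd j (f ∘ τ)) (fun z => ∑ k, pd j τ z k • pd k f (τ z)) (τ ⁻¹' U) :=
    fun w hw => pd_comp (differentiableAt_of_contDiffOn hf hU hw) (hd w) j
  have hc : DifferentiableAt ℝ (pd j τ) z :=
    differentiableAt_of_contDiffOn (contDiffOn_pd hτ.contDiffOn isOpen_univ j) isOpen_univ
      (Set.mem_univ z)
  have hck : ∀ k, DifferentiableAt ℝ (fun z => pd j τ z k) z := fun k =>
    (EuclideanSpace.proj k : E n →L[ℝ] ℝ).differentiableAt.comp z hc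
  have hfk : ∀ k, DifferentiableAt ℝ (pd k f) (τ z) := fun k =>
    differentiableAt_of_contDiffOn (contDiffOn_pd hf hU k) hU hz
  have hfc : ∀ k, DifferentiableAt ℝ (fun z => pd k f (τ z)) z := fun k => (hfk k).comp z (hd z)
  rw [pd_congr_of_isOpen hV hz e1, pd_sum fun k _ => (hck k).fun_smul (hfc k),
    ← Finset.sum_add_distrib]
  refine Finset.sum_congr rfl fun k _ => ?_
  rw [pd_smul (hck k) (hfc k)]
  congr 1
  · congr 1
    exact pd_clm hc (EuclideanSpace.proj k : E n →L[ℝ] ℝ) i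
  · rw [show (fun z => pd k f (τ z)) = pd k f ∘ τ from rfl, pd_comp (hfk k) (hd z),
      Finset.smul_sum]
    simp only [smul_smul]

/-- Around every point there are coordinates, centred at `0`, that are orthonormal there and in
which the second derivatives of `f` are normal to the hypersurface there. -/
lemma IsLocalHypersurface.exists_adapted {f ν : E n → E (n + 2)} {U : Set (E n)} {y : E n}
    (h : IsLocalHypersurface f ν U) (hy : y ∈ U) :
    ∃ (τ : E n → E n) (V : Set (E n)), τ 0 = y ∧ (0 : E n) ∈ V ∧ IsOpen V ∧ ContDiff ℝ ∞ τ ∧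
      Set.MapsTo τ V U ∧ (∀ z ∈ V, IsUnit (jacobian τ z).det) ∧
      IsLocalHypersurface (f ∘ τ) (ν ∘ τ) V ∧ gram (f ∘ τ) 0 = 1 ∧
      ∀ i j k, inner ℝ (pd i (pd j (f ∘ τ)) 0) (pd k (f ∘ τ) 0) = (0 : ℝ) := by
  -- the linear part normalizes the metric; the quadratic part `Q` cancels the tangential components
  -- `W` of the second derivatives
  obtain ⟨L, hL, hLG⟩ := exists_normalize_gram (h.det y hy)
  let W : Fin n → Fin n → E (n + 2) := fun i j =>
    ∑ k, ∑ l, (L k j * L l i) • pd l (pd k f) y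
  have hW : ∀ i j, W i j = W j i := by
    intro i j
    simp only [W]
    rw [Finset.sum_comm]
    refine Finset.sum_congr rfl fun k _ => Finset.sum_congr rfl fun l _ => ?_
    rw [pd_comm h.smooth h.isOpen hy, mul_comm]
  let Lv : Fin n → E n := fun i => WithLp.toLp 2 fun k => L k i
  let Q : Fin n → Fin n → E n := fun i j => WithLp.toLp 2 fun k =>
    -(1 / 2) * ∑ r, (gram f y)⁻¹ k r * inner ℝ (W i j) (pd r f y)
  have hQ : ∀ i j, Q i j = Q j i := fun i j => by simp only [Q, hW i j]
  set τ := quadMap y Lv Q with hτdef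
  have hτ : ContDiff ℝ ∞ τ := contDiff_quadMap y Lv Q
  have hd : ∀ z, DifferentiableAt ℝ τ z := hτ.differentiable (by simp)
  have hτ0 : τ 0 = y := by simp [hτdef, quadMap]
  have hp0 : ∀ i, pd i τ 0 = Lv i := fun i => by rw [hτdef, pd_quadMap y Lv Q hQ]; simp
  have hJ0 : jacobian τ 0 = L := by
    ext k i; simp [jacobian, hp0, Lv]
  have hJc : Continuous fun z => (jacobian τ z).det := by
    refine Continuous.matrix_det (continuous_matrix fun k i => ?_)
    have : Continuous (pd i τ) :=
      (contDiffOn_univ.1 (contDiffOn_pd hτ.contDiffOn isOpen_univ i)).continuous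
    exact (EuclideanSpace.proj k : E n →L[ℝ] ℝ).continuous.comp this
  set V := τ ⁻¹' U ∩ {z | (jacobian τ z).det ≠ 0} with hVdef
  have hV : IsOpen V :=
    (h.isOpen.preimage hτ.continuous).inter (isOpen_ne_fun hJc continuous_const)
  have h0V : (0 : E n) ∈ V := ⟨by simpa [hτ0] using hy, by
    simpa [hJ0] using hL.ne_zero⟩
  have hm : Set.MapsTo τ V U := fun z hz => hz.1
  have hJV : ∀ z ∈ V, IsUnit (jacobian τ z).det := fun z hz => isUnit_iff_ne_zero.2 hz.2
  have hfy : DifferentiableAt ℝ f (τ 0) := by rw [hτ0]; exact h.diff hy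
  refine ⟨τ, V, hτ0, h0V, hV, hτ, hm, hJV, h.comp hV hτ.contDiffOn hm hJV, ?_, fun i j k => ?_⟩
  · rw [gram_comp hfy (hd 0), hJ0, hτ0, hLG]
  · have key : ∀ m, inner ℝ (pd i (pd j (f ∘ τ)) 0) (pd m f y) = (0 : ℝ) := by
      intro m
      rw [pd_pd_comp h.isOpen h.smooth hτ (hm h0V)]
      rw [hτ0, hp0, hp0, pd_quadMap_zero y Lv Q hQ, inner_add_left]
      have e1 : inner ℝ (∑ k, ∑ l, ((Lv j) k * (Lv i) l) • pd l (pd k f) y) (pd m f y)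
          = inner ℝ (W i j) (pd m f y) := rfl
      have e2 : ∀ k, ((2 : ℝ) • Q j i) k
          = - ∑ r, (gram f y)⁻¹ k r * inner ℝ (W i j) (pd r f y) := by
        intro k
        simp only [Q, hW j i, PiLp.smul_apply, smul_eq_mul]; ring
      rw [e1, sum_inner]
      simp only [e2, inner_smul_left, RCLike.conj_to_real]
      have e3 : ∀ k, (-∑ r, (gram f y)⁻¹ k r * inner ℝ (W i j) (pd r f y))
          * inner ℝ (pd k f y) (pd m f y)
          = - ∑ r, inner ℝ (W i j) (pd r f y) * ((gram f y)⁻¹ r k * gram f y k m) := by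
        intro k
        rw [neg_mul, Finset.sum_mul]
        congr 1
        refine Finset.sum_congr rfl fun r _ => ?_
        rw [gram_inv_symm]; simp only [gram, Matrix.of_apply]; ring
      simp only [e3, Finset.sum_neg_distrib]
      rw [Finset.sum_comm]
      simp only [← Finset.mul_sum, gram_inv_mul (h.det y hy)]
      simp
    rw [pd_comp hfy (hd 0), inner_sum, hτ0]
    refine Finset.sum_eq_zero fun m _ => ?_
    rw [inner_smul_right, key, mul_zero]

end Reparam

/-! ### Pointwise identities in adapted coordinates -/

/-- A local hypersurface whose coordinates are adapted at `0`: orthonormal, with normal second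
derivatives. -/
structure IsAdapted {n : ℕ} (f ν : E n → E (n + 2)) (U : Set (E n)) : Prop
    extends IsLocalHypersurface f ν U where
  mem : (0 : E n) ∈ U
  gram_zero : gram f 0 = 1
  inner_second : ∀ i j k, inner ℝ (pd i (pd j f) 0) (pd k f 0) = (0 : ℝ)

/-- The gradient of `u`, as a vector of the ambient space. -/
def grad {n N : ℕ} (f : E n → E N) (u : E n → ℝ) (y : E n) : E N :=
  raise f y fun i => pd i u y

lemma inner_grad {n N : ℕ} {f : E n → E N} {y : E n} (hf : DifferentiableAt ℝ f y)
    (u : E n → ℝ) (c : E N) :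
    inner ℝ (grad f u y) c = carre f u (fun z => inner ℝ (f z) c) y := by
  simp only [grad, inner_raise, carre, pd_inner_const hf]
  simp [mul_comm]

namespace IsAdapted

variable {n : ℕ} {f ν : E n → E (n + 2)} {U : Set (E n)}
  {F : Type*} [NormedAddCommGroup F] [InnerProductSpace ℝ F]

lemma inner_pd (h : IsAdapted f ν U) (i j : Fin n) :
    inner ℝ (pd i f 0) (pd j f 0) = if i = j then (1 : ℝ) else 0 := by
  have := congrFun (congrFun h.gram_zero i) j
  rwa [Matrix.one_apply] at this

lemma raise_zero (h : IsAdapted f ν U) (v : Fin n → ℝ) : raise f 0 v = ∑ i, v i • pd i f 0 := by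
  simp [raise, h.gram_zero, Matrix.one_apply]

lemma carre_zero (h : IsAdapted f ν U) (u v : E n → F) :
    carre f u v 0 = ∑ i, inner ℝ (pd i u 0) (pd i v 0) := by
  simp [carre, h.gram_zero, Matrix.one_apply]

lemma second (h : IsAdapted f ν U) (i j : Fin n) :
    pd i (pd j f) 0 = sff f ν i j 0 • ν 0 - (if i = j then (1 : ℝ) else 0) • f 0 := by
  rw [h.expand h.mem (pd i (pd j f) 0), real_inner_comm, h.inner_pd_pd_self h.mem,
    real_inner_comm, h.inner_pd_pd_normal h.mem, h.raise_zero, h.gram_zero, Matrix.one_apply]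
  have : ∀ k, inner ℝ (pd k f 0) (pd i (pd j f) 0) = (0 : ℝ) := fun k => by
    rw [real_inner_comm, h.inner_second]
  simp only [this, zero_smul, Finset.sum_const_zero, neg_smul]
  abel

lemma pd_normal_zero (h : IsAdapted f ν U) (k : Fin n) :
    pd k ν 0 = - ∑ i, sff f ν k i 0 • pd i f 0 := by
  rw [h.weingarten h.mem, h.raise_zero]

lemma pd_gram_zero (h : IsAdapted f ν U) (k i j : Fin n) :
    pd k (fun z => gram f z i j) 0 = 0 := by
  rw [h.pd_gram h.mem, h.inner_second, real_inner_comm, h.inner_second, add_zero]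

lemma diff_gram_inv (h : IsAdapted f ν U) (i j : Fin n) :
    DifferentiableAt ℝ (fun z => (gram f z)⁻¹ i j) 0 :=
  differentiableAt_of_contDiffOn (h.contDiffOn_gram_inv i j) h.isOpen h.mem

lemma pd_gram_inv_zero (h : IsAdapted f ν U) (k i j : Fin n) :
    pd k (fun z => (gram f z)⁻¹ i j) 0 = 0 := by
  have e := pd_congr_of_isOpen h.isOpen h.mem
    (fun z hz => gram_inv_mul (h.det z hz) i j) k
  have hg : ∀ l, DifferentiableAt ℝ (fun z => gram f z l j) 0 := fun l =>
    differentiableAt_of_contDiffOn (contDiffOn_gram h.smooth h.isOpen l j) h.isOpen h.mem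
  rw [pd_sum fun l _ => (h.diff_gram_inv i l).fun_mul (hg l), pd_const] at e
  simp only [fun l => pd_mul (h.diff_gram_inv i l) (hg l) k, h.pd_gram_zero, h.gram_zero,
    Matrix.one_apply] at e
  simpa using e

lemma pd_sum_gram_inv {G : Type*} [NormedAddCommGroup G] [NormedSpace ℝ G]
    (h : IsAdapted f ν U) {W : Fin n → Fin n → E n → G}
    (hW : ∀ i j, DifferentiableAt ℝ (W i j) 0) (k : Fin n) :
    pd k (fun z => ∑ i, ∑ j, (gram f z)⁻¹ i j • W i j z) 0 = ∑ i, pd k (W i i) 0 := by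
  have h1 : ∀ i j, DifferentiableAt ℝ (fun z => (gram f z)⁻¹ i j • W i j z) 0 := fun i j =>
    (h.diff_gram_inv i j).fun_smul (hW i j)
  rw [pd_sum fun i _ => DifferentiableAt.fun_sum fun j _ => h1 i j]
  simp only [pd_sum fun j _ => h1 _ j, pd_smul (h.diff_gram_inv _ _) (hW _ _), h.pd_gram_inv_zero,
    h.gram_zero]
  simp [Matrix.one_apply]

lemma pd_carre_zero (h : IsAdapted f ν U) {u v : E n → F} (hu : ContDiffOn ℝ ∞ u U)
    (hv : ContDiffOn ℝ ∞ v U) (k : Fin n) :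
    pd k (carre f u v) 0 = ∑ i, (inner ℝ (pd k (pd i u) 0) (pd i v 0)
      + inner ℝ (pd i u 0) (pd k (pd i v) 0)) := by
  have h1 : ∀ i, DifferentiableAt ℝ (pd i u) 0 := fun i =>
    differentiableAt_of_contDiffOn (contDiffOn_pd hu h.isOpen i) h.isOpen h.mem
  have h2 : ∀ i, DifferentiableAt ℝ (pd i v) 0 := fun i =>
    differentiableAt_of_contDiffOn (contDiffOn_pd hv h.isOpen i) h.isOpen h.mem
  have := h.pd_sum_gram_inv (W := fun i j z => inner ℝ (pd i u z) (pd j v z))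
    (fun i j => (h1 i).inner ℝ (h2 j)) k
  simp only [smul_eq_mul, fun i => pd_inner (h1 i) (h2 i) k] at this
  exact this

lemma pd_raise_zero (h : IsAdapted f ν U) {v : Fin n → E n → ℝ}
    (hv : ∀ i, DifferentiableAt ℝ (v i) 0) (k : Fin n) :
    pd k (fun z => raise f z fun i => v i z) 0
      = ∑ i, (pd k (v i) 0 • pd i f 0 + v i 0 • pd k (pd i f) 0) := by
  have := h.pd_sum_gram_inv (W := fun i j z => v i z • pd j f z)
    (fun i j => (hv i).fun_smul (h.diff_pd h.mem j)) k
  simp only [smul_smul, fun i => pd_smul (hv i) (h.diff_pd h.mem i) k] at this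
  exact this

lemma diff_sff (h : IsAdapted f ν U) (i j : Fin n) : DifferentiableAt ℝ (sff f ν i j) 0 :=
  differentiableAt_of_contDiffOn (h.contDiffOn_sff i j) h.isOpen h.mem

lemma inner_pd_second_normal (h : IsAdapted f ν U) (i j k : Fin n) :
    inner ℝ (pd i ν 0) (pd k (pd j f) 0) = (0 : ℝ) := by
  rw [h.second, inner_sub_right, inner_smul_right, inner_smul_right, h.pd_normal_self h.mem,
    h.pd_normal_inner h.mem]; ring

lemma pd_sff_zero (h : IsAdapted f ν U) (k i j : Fin n) :
    pd k (sff f ν i j) 0 = - inner ℝ (pd k (pd i ν) 0) (pd j f 0) := by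
  unfold sff
  rw [pd_neg, pd_inner (h.diff_pd_normal h.mem i) (h.diff_pd h.mem j), h.inner_pd_second_normal,
    add_zero]

/-- The Codazzi equation. -/
lemma codazzi (h : IsAdapted f ν U) (k i j : Fin n) :
    pd k (sff f ν i j) 0 = pd i (sff f ν k j) 0 := by
  rw [h.pd_sff_zero, h.pd_sff_zero, pd_comm h.smooth_normal h.isOpen h.mem]

lemma pd_sff_symm (h : IsAdapted f ν U) (k i j : Fin n) :
    pd k (sff f ν i j) 0 = pd k (sff f ν j i) 0 :=
  pd_congr_of_isOpen h.isOpen h.mem (fun _ hz => h.sff_symm hz i j) k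

lemma trace_sff (h : IsAdapted f ν U) : ∑ i, sff f ν i i 0 = 0 := by
  have := h.minimal 0 h.mem
  rw [h.carre_zero] at this
  simp [sff, this]

/-- Minimality, differentiated. -/
lemma trace_pd_sff (h : IsAdapted f ν U) (k : Fin n) : ∑ i, pd k (sff f ν i i) 0 = 0 := by
  have := pd_congr_of_isOpen h.isOpen h.mem (fun z hz => h.minimal z hz) k
  rw [h.pd_carre_zero h.smooth_normal h.smooth, pd_const] at this
  simp only [h.inner_pd_second_normal, add_zero] at this
  simp [h.pd_sff_zero, this]

lemma second_normal (h : IsAdapted f ν U) (k i : Fin n) :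
    pd k (pd i ν) 0 = - ∑ j, (pd k (sff f ν i j) 0 • pd j f 0
      + sff f ν i j 0 • (sff f ν k j 0 • ν 0 - (if k = j then (1 : ℝ) else 0) • f 0)) := by
  rw [pd_congr_of_isOpen h.isOpen h.mem (fun z hz => h.weingarten hz i) k, pd_neg,
    h.pd_raise_zero (fun j => h.diff_sff i j)]
  simp only [h.second]

lemma carre_normal (h : IsAdapted f ν U) :
    carre f ν ν 0 = ∑ i, ∑ j, sff f ν i j 0 ^ 2 := by
  rw [h.carre_zero]
  refine Finset.sum_congr rfl fun i _ => ?_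
  rw [h.inner_pd_normal_pd_normal h.mem, h.gram_zero]
  simp [Matrix.one_apply, sq]

/-- The Laplacian of the position vector. -/
lemma laplacian_self (h : IsAdapted f ν U) : ∑ i, pd i (pd i f) 0 = (-(n : ℝ)) • f 0 := by
  simp only [h.second, Finset.sum_sub_distrib, ← Finset.sum_smul, h.trace_sff]
  simp

/-- The Laplacian of the unit normal. -/
lemma laplacian_normal (h : IsAdapted f ν U) :
    ∑ i, pd i (pd i ν) 0 = (-(carre f ν ν 0)) • ν 0 := by
  simp only [h.second_normal, Finset.sum_neg_distrib, Finset.sum_add_distrib]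
  have e1 : ∑ i, ∑ j, pd i (sff f ν i j) 0 • pd j f 0 = 0 := by
    rw [Finset.sum_comm]
    refine Finset.sum_eq_zero fun j _ => ?_
    rw [← Finset.sum_smul]
    have : ∀ i, pd i (sff f ν i j) 0 = pd j (sff f ν i i) 0 := fun i => by
      rw [h.pd_sff_symm, h.codazzi]
    simp only [this, h.trace_pd_sff, zero_smul]
  have e2 : ∑ i, ∑ j, sff f ν i j 0 • (sff f ν i j 0 • ν 0
      - (if i = j then (1 : ℝ) else 0) • f 0) = carre f ν ν 0 • ν 0 := by
    simp only [smul_sub, Finset.sum_sub_distrib, smul_smul, ← Finset.sum_smul, h.carre_normal,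
      sq]
    simp [h.trace_sff]
  rw [e1, e2, zero_add, neg_smul]

lemma laplacian_zero (h : IsAdapted f ν U) {u : E n → ℝ} (hu : ContDiffOn ℝ ∞ u U) :
    carre f (grad f u) f 0 = ∑ i, pd i (pd i u) 0 := by
  rw [h.carre_zero]
  refine Finset.sum_congr rfl fun i _ => ?_
  have hv : ∀ j, DifferentiableAt ℝ (pd j u) 0 := fun j =>
    differentiableAt_of_contDiffOn (contDiffOn_pd hu h.isOpen j) h.isOpen h.mem
  have e := h.pd_raise_zero hv i
  change pd i (grad f u) 0 = _ at e
  rw [e, sum_inner]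
  simp [inner_add_left, inner_smul_left, h.inner_pd, h.inner_second]

lemma laplacian_sq (h : IsAdapted f ν U) {u : E n → ℝ} (hu : ContDiffOn ℝ ∞ u U) :
    carre f (grad f fun z => u z ^ 2) f 0
      = 2 * carre f u u 0 + 2 * (u 0 * ∑ i, pd i (pd i u) 0) := by
  have hd : ∀ {z}, z ∈ U → DifferentiableAt ℝ u z := fun hz =>
    differentiableAt_of_contDiffOn hu h.isOpen hz
  have hdd : ∀ i, DifferentiableAt ℝ (pd i u) 0 := fun i =>
    differentiableAt_of_contDiffOn (contDiffOn_pd hu h.isOpen i) h.isOpen h.mem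
  rw [h.laplacian_zero (hu.pow 2), h.carre_zero, Finset.mul_sum, Finset.mul_sum, Finset.mul_sum,
    ← Finset.sum_add_distrib]
  refine Finset.sum_congr rfl fun i _ => ?_
  have e : Set.EqOn (pd i fun z => u z ^ 2) (fun z => 2 * (u z * pd i u z)) U := fun z hz => by
    simp only [sq]
    rw [pd_mul (hd hz) (hd hz)]; ring
  rw [pd_congr_of_isOpen h.isOpen h.mem e, pd_const_mul 2 ((hd h.mem).fun_mul (hdd i)),
    pd_mul (hd h.mem) (hdd i)]
  simp only [Inner.inner]
  ring_nf
  simp; ring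

lemma laplacian_inner (h : IsAdapted f ν U) {u : E n → E (n + 2)} (hu : ContDiffOn ℝ ∞ u U)
    (a : E (n + 2)) :
    ∑ i, pd i (pd i fun z => inner ℝ (u z) a) 0 = inner ℝ (∑ i, pd i (pd i u) 0) a := by
  rw [sum_inner]
  refine Finset.sum_congr rfl fun i _ => ?_
  rw [pd_congr_of_isOpen h.isOpen h.mem (fun z hz => pd_inner_const
    (differentiableAt_of_contDiffOn hu h.isOpen hz) a i) i]
  exact pd_inner_const
    (differentiableAt_of_contDiffOn (contDiffOn_pd hu h.isOpen i) h.isOpen h.mem) a i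

lemma pd_normal_inner_zero (h : IsAdapted f ν U) (a : E (n + 2)) (k : Fin n) :
    pd k (fun z => inner ℝ (ν z) a) 0 = - ∑ i, sff f ν k i 0 * inner ℝ (pd i f 0) a := by
  rw [pd_inner_const (h.diff_normal h.mem), h.pd_normal_zero, inner_neg_left, sum_inner]
  simp [inner_smul_left]

/-- If the normal is orthogonal to `a`, then `S` satisfies a transport equation along the
gradient of the height function. -/
lemma transport (h : IsAdapted f ν U) {a : E (n + 2)} (ha : ∀ y ∈ U, inner ℝ (ν y) a = (0 : ℝ)) :
    carre f (fun z => inner ℝ (f z) a) (carre f ν ν) 0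
      = 2 * inner ℝ (f 0) a * carre f ν ν 0 := by
  set v : Fin n → ℝ := fun i => inner ℝ (pd i f 0) a with hv
  -- differentiating `h(aᵀ, ∂_i) = 0`
  have key : ∀ k i, ∑ j, pd k (sff f ν i j) 0 * v j = sff f ν i k 0 * inner ℝ (f 0) a := by
    intro k i
    have e1 : Set.EqOn (fun z => inner ℝ (pd i ν z) a) (fun _ => (0 : ℝ)) U := fun z hz => by
      change inner ℝ (pd i ν z) a = 0
      rw [← pd_inner_const (h.diff_normal hz), pd_congr_of_isOpen h.isOpen hz ha, pd_const]
    have e2 := pd_congr_of_isOpen h.isOpen h.mem e1 k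
    rw [pd_const, pd_inner_const (h.diff_pd_normal h.mem i), h.second_normal, inner_neg_left,
      sum_inner] at e2
    simp only [inner_add_left, inner_smul_left, inner_sub_left, ha 0 h.mem,
      RCLike.conj_to_real, Finset.sum_add_distrib] at e2
    simp only [mul_zero, zero_sub, ite_mul, one_mul, zero_mul, mul_neg, mul_ite,
      Finset.sum_neg_distrib, Finset.sum_ite_eq, Finset.mem_univ, if_true] at e2
    linarith
  have hS : ∀ k, pd k (carre f ν ν) 0
      = 2 * ∑ i, ∑ j, pd k (sff f ν i j) 0 * sff f ν i j 0 := by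
    intro k
    rw [h.pd_carre_zero h.smooth_normal h.smooth_normal, Finset.mul_sum]
    refine Finset.sum_congr rfl fun i _ => ?_
    rw [real_inner_comm, ← two_mul]
    congr 1
    rw [h.pd_normal_zero, inner_neg_left, sum_inner, ← Finset.sum_neg_distrib]
    refine Finset.sum_congr rfl fun j _ => ?_
    rw [inner_smul_left, h.pd_sff_zero, real_inner_comm]; simp; ring
  rw [h.carre_zero]
  simp only [pd_inner_const (h.diff h.mem), hS, h.carre_normal]
  have e3 : ∀ k, inner ℝ (inner ℝ (pd k f 0) a) (2 * ∑ i, ∑ j, pd k (sff f ν i j) 0 * sff f ν i j 0)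
      = 2 * ∑ i, ∑ j, sff f ν i j 0 * (pd i (sff f ν j k) 0 * v k) := by
    intro k
    have : ∀ s t : ℝ, inner ℝ s t = t * s := fun s t => by simp
    rw [this, mul_assoc, Finset.sum_mul]
    congr 1
    refine Finset.sum_congr rfl fun i _ => ?_
    rw [Finset.sum_mul]
    refine Finset.sum_congr rfl fun j _ => ?_
    rw [h.codazzi k i j, h.pd_sff_symm i k j]; ring
  simp only [e3]
  rw [← Finset.mul_sum, mul_assoc]
  refine congrArg (fun t => 2 * t) ?_
  rw [Finset.sum_comm, Finset.mul_sum]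
  refine Finset.sum_congr rfl fun i _ => ?_
  rw [Finset.sum_comm, Finset.mul_sum]
  refine Finset.sum_congr rfl fun j _ => ?_
  rw [← Finset.mul_sum, key, h.sff_symm h.mem j i]; ring

end IsAdapted

/-! ### Symmetric matrices of trace zero -/

section Traceless

variable {n : ℕ} {H : Fin n → Fin n → ℝ}

/-- For a symmetric traceless `H` and a unit vector `v`, the traceless part of the compression of
`H` to the orthogonal complement of `v`, and its squared norm. -/
lemma sum_sq_compression (hn : 2 ≤ n) (hs : ∀ i j, H i j = H j i) (ht : ∑ i, H i i = 0)
    {v w : Fin n → ℝ} (hv : ∑ i, v i * v i = 1) (hw : ∀ i, w i = ∑ j, H i j * v j) {a : ℝ}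
    (ha : a = ∑ i, v i * w i) :
    ∑ i, ∑ j, (H i j - v i * w j - w i * v j + (a - a / (n - 1)) * (v i * v j)
      + a / (n - 1) * (if i = j then 1 else 0)) ^ 2
      = ∑ i, ∑ j, H i j ^ 2 - 2 * ∑ i, w i * w i + (a - a / (n - 1)) * a := by
  have hn1 : (n : ℝ) - 1 ≠ 0 := by
    have : (2 : ℝ) ≤ n := by exact_mod_cast hn
    linarith
  set c : ℝ := a / (n - 1) with hc
  set T : Fin n → Fin n → ℝ := fun i j => H i j - v i * w j - w i * v j + (a - c) * (v i * v j)
      + c * (if i = j then 1 else 0) with hT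
  have ha' : ∑ j, w j * v j = a := by rw [ha]; exact Finset.sum_congr rfl fun i _ => mul_comm _ _
  have hTs : ∀ i j, T i j = T j i := by
    intro i j
    simp only [hT, hs i j, eq_comm (a := i)]; ring
  -- `T` annihilates `v` and has trace zero, so that it is orthogonal to `T - H`
  have hTv : ∀ i, ∑ j, T i j * v j = 0 := by
    intro i
    have e : ∀ j, T i j * v j = H i j * v j - v i * (w j * v j) - w i * (v j * v j)
        + (a - c) * v i * (v j * v j) + c * (if i = j then v j else 0) := by
      intro j; simp only [hT]; split_ifs <;> ring
    simp only [e, Finset.sum_add_distrib, Finset.sum_sub_distrib, ← Finset.mul_sum, ← hw, hv, ha']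
    simp; ring
  have hTt : ∑ i, T i i = 0 := by
    have e : ∀ i, T i i = H i i - 2 * (w i * v i) + (a - c) * (v i * v i) + c := by
      intro i; simp only [hT, if_true]; ring
    simp only [e, Finset.sum_add_distrib, Finset.sum_sub_distrib, ← Finset.mul_sum, ht, hv, ha']
    simp [hc]; field_simp; ring
  have hTw : ∑ i, ∑ j, T i j * (v i * w j) = 0 := by
    rw [Finset.sum_comm]
    refine Finset.sum_eq_zero fun j _ => ?_
    have : ∑ i, T i j * (v i * w j) = w j * ∑ i, T j i * v i := by
      rw [Finset.mul_sum]
      refine Finset.sum_congr rfl fun i _ => ?_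
      rw [hTs]; ring
    rw [this, hTv, mul_zero]
  have hTw' : ∑ i, ∑ j, T i j * (w i * v j) = 0 := by
    refine Finset.sum_eq_zero fun i _ => ?_
    have : ∑ j, T i j * (w i * v j) = w i * ∑ j, T i j * v j := by
      rw [Finset.mul_sum]
      exact Finset.sum_congr rfl fun j _ => by ring
    rw [this, hTv, mul_zero]
  have hTvv : ∑ i, ∑ j, T i j * (v i * v j) = 0 := by
    refine Finset.sum_eq_zero fun i _ => ?_
    have : ∑ j, T i j * (v i * v j) = v i * ∑ j, T i j * v j := by
      rw [Finset.mul_sum]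
      exact Finset.sum_congr rfl fun j _ => by ring
    rw [this, hTv, mul_zero]
  have hTd : ∑ i, ∑ j, T i j * (if i = j then (1 : ℝ) else 0) = 0 := by
    simpa using hTt
  have hTH : ∑ i, ∑ j, T i j ^ 2 = ∑ i, ∑ j, T i j * H i j := by
    have e : ∀ i j, T i j ^ 2 = T i j * H i j - T i j * (v i * w j) - T i j * (w i * v j)
        + (a - c) * (T i j * (v i * v j)) + c * (T i j * (if i = j then (1 : ℝ) else 0)) := by
      intro i j
      rw [sq]
      conv_lhs => rw [show T i j * T i j = T i j * (H i j - v i * w j - w i * v j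
        + (a - c) * (v i * v j) + c * (if i = j then 1 else 0)) from rfl]
      ring
    simp only [e, Finset.sum_add_distrib, Finset.sum_sub_distrib, ← Finset.mul_sum, hTw, hTw',
      hTvv, hTd]
    ring
  rw [hTH]
  have e : ∀ i j, T i j * H i j = H i j ^ 2 - v i * (H i j * w j) - w i * (H i j * v j)
      + (a - c) * (v i * (H i j * v j)) + c * (if i = j then H i j else 0) := by
    intro i j; simp only [hT]; split_ifs <;> ring
  have hHw : ∑ i, ∑ j, v i * (H i j * w j) = ∑ i, w i * w i := by
    rw [Finset.sum_comm]
    refine Finset.sum_congr rfl fun j _ => ?_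
    rw [hw j, Finset.sum_mul]
    refine Finset.sum_congr rfl fun i _ => ?_
    rw [hs j i]
    ring
  have hHv : ∀ t : Fin n → ℝ, ∑ i, ∑ j, t i * (H i j * v j) = ∑ i, t i * w i := by
    intro t
    simp only [← Finset.mul_sum, ← hw]
  simp only [e, Finset.sum_add_distrib, Finset.sum_sub_distrib, ← Finset.mul_sum (a := a - c),
    ← Finset.mul_sum (a := c), hHw, hHv, ← ha]
  simp [ht]; ring

lemma sum_sq_sub_proj {v w : Fin n → ℝ} (hv : ∑ i, v i * v i = 1) {a : ℝ}
    (ha : a = ∑ i, v i * w i) : ∑ i, (w i - a * v i) ^ 2 = ∑ i, w i * w i - a ^ 2 := by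
  have e : ∀ i, (w i - a * v i) ^ 2 = w i * w i - 2 * a * (v i * w i) + a ^ 2 * (v i * v i) :=
    fun i => by ring
  simp only [e, Finset.sum_add_distrib, Finset.sum_sub_distrib, ← Finset.mul_sum, hv, ← ha]
  ring

lemma traceless_unit (hn : 2 ≤ n) (hs : ∀ i j, H i j = H j i) (ht : ∑ i, H i i = 0)
    {v w : Fin n → ℝ} (hv : ∑ i, v i * v i = 1) (hw : ∀ i, w i = ∑ j, H i j * v j) :
    n * ∑ i, w i * w i ≤ (n - 1) * ∑ i, ∑ j, H i j ^ 2 ∧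
    (3 ≤ n → n * ∑ i, w i * w i = (n - 1) * ∑ i, ∑ j, H i j ^ 2 →
      ∃ a : ℝ, ∀ i j, H i j = a / (n - 1) * (n * (v i * v j) - if i = j then 1 else 0)) := by
  have hn2 : (2 : ℝ) ≤ n := by exact_mod_cast hn
  have hn1 : (0 : ℝ) < (n : ℝ) - 1 := by linarith
  obtain ⟨a, ha⟩ : ∃ a, a = ∑ i, v i * w i := ⟨_, rfl⟩
  have h1 := sum_sq_compression hn hs ht hv hw ha
  have h2 := sum_sq_sub_proj hv ha
  set X := ∑ i, ∑ j, (H i j - v i * w j - w i * v j + (a - a / (n - 1)) * (v i * v j)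
      + a / (n - 1) * (if i = j then 1 else 0)) ^ 2 with hX
  set Y := ∑ i, (w i - a * v i) ^ 2 with hY
  have hX0 : 0 ≤ X := Finset.sum_nonneg fun i _ => Finset.sum_nonneg fun j _ => sq_nonneg _
  have hY0 : 0 ≤ Y := Finset.sum_nonneg fun i _ => sq_nonneg _
  have key : ((n : ℝ) - 1) * ∑ i, ∑ j, H i j ^ 2
      = (n - 1) * X + (n - 2) * Y + n * ∑ i, w i * w i := by
    have : (a - a / ((n : ℝ) - 1)) * a * (n - 1) = (n - 2) * a ^ 2 := by
      field_simp; ring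
    linear_combination (-((n : ℝ) - 1)) * h1 - ((n : ℝ) - 2) * h2 - this
  refine ⟨by nlinarith, fun hn3 heq => ⟨a, fun i j => ?_⟩⟩
  have hn3' : (3 : ℝ) ≤ n := by exact_mod_cast hn3
  have hXz : X = 0 := by nlinarith
  have hYz : Y = 0 := by nlinarith
  have hwv : ∀ i, w i = a * v i := fun i => by
    have := (Finset.sum_eq_zero_iff_of_nonneg (fun i _ => sq_nonneg _)).1 hYz i (Finset.mem_univ i)
    nlinarith [pow_eq_zero_iff (two_ne_zero) |>.1 this]
  have hij := (Finset.sum_eq_zero_iff_of_nonneg (fun j _ => sq_nonneg _)).1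
    ((Finset.sum_eq_zero_iff_of_nonneg (fun i _ => Finset.sum_nonneg fun j _ => sq_nonneg _)).1
      hXz i (Finset.mem_univ i)) j (Finset.mem_univ j)
  have := pow_eq_zero_iff (two_ne_zero) |>.1 hij
  rw [hwv, hwv] at this
  field_simp at this ⊢
  linear_combination this

lemma exists_unit_of_ne_zero {v : Fin n → ℝ} (hv : ∑ i, v i * v i ≠ 0) :
    ∃ r : ℝ, r * r * ∑ i, v i * v i = 1 := by
  have h0 : 0 ≤ ∑ i, v i * v i := Finset.sum_nonneg fun i _ => mul_self_nonneg _
  refine ⟨(Real.sqrt (∑ i, v i * v i))⁻¹, ?_⟩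
  rw [← mul_inv, Real.mul_self_sqrt h0, inv_mul_cancel₀ hv]

/-- A symmetric traceless matrix satisfies `n |H v|² ≤ (n - 1) |H|² |v|²`. -/
lemma traceless_le (hn : 1 ≤ n) (hs : ∀ i j, H i j = H j i) (ht : ∑ i, H i i = 0)
    {v w : Fin n → ℝ} (hw : ∀ i, w i = ∑ j, H i j * v j) :
    n * ∑ i, w i * w i ≤ (n - 1) * (∑ i, ∑ j, H i j ^ 2) * ∑ i, v i * v i := by
  obtain rfl | hn2 := hn.eq_or_lt
  · have : H 0 0 = 0 := by simpa using ht
    simp [hw, this]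
  by_cases hv : ∑ i, v i * v i = 0
  · have hv0 : ∀ i, v i = 0 := fun i => by
      have := (Finset.sum_eq_zero_iff_of_nonneg (fun i _ => mul_self_nonneg (v i))).1 hv i
        (Finset.mem_univ i)
      simpa using this
    simp [hw, hv0]
  obtain ⟨r, hr⟩ := exists_unit_of_ne_zero hv
  have e1 : ∑ i, (r * v i) * (r * v i) = 1 := by
    rw [← hr, Finset.mul_sum]; exact Finset.sum_congr rfl fun i _ => by ring
  have e2 : ∀ i, r * w i = ∑ j, H i j * (r * v j) := fun i => by
    rw [hw, Finset.mul_sum]; exact Finset.sum_congr rfl fun i _ => by ring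
  have := (traceless_unit hn2 hs ht e1 e2).1
  have e3 : ∑ i, (r * w i) * (r * w i) = r * r * ∑ i, w i * w i := by
    rw [Finset.mul_sum]; exact Finset.sum_congr rfl fun i _ => by ring
  rw [e3] at this
  have hq : 0 ≤ ∑ i, v i * v i := Finset.sum_nonneg fun i _ => mul_self_nonneg _
  calc n * ∑ i, w i * w i = (n * (r * r * ∑ i, w i * w i)) * ∑ i, v i * v i := by
        linear_combination (-(n * ∑ i, w i * w i)) * hr
    _ ≤ _ := mul_le_mul_of_nonneg_right this hq

/-- In the equality case, and for `n ≥ 3`, the matrix has one simple eigenvalue `a` and the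
eigenvalue `-a/(n-1)` on the orthogonal complement. -/
lemma traceless_eq (hn : 3 ≤ n) (hs : ∀ i j, H i j = H j i) (ht : ∑ i, H i i = 0)
    {v w : Fin n → ℝ} (hw : ∀ i, w i = ∑ j, H i j * v j) (hv : ∑ i, v i * v i ≠ 0)
    (heq : n * ∑ i, w i * w i = (n - 1) * (∑ i, ∑ j, H i j ^ 2) * ∑ i, v i * v i) :
    ∃ a : ℝ, ∑ i, ∑ j, H i j ^ 2 = n * a ^ 2 / (n - 1) ∧
      ∀ i j, ∑ m, H i m * H j m = a * (n - 2) / (n - 1) * H i j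
        + a ^ 2 / (n - 1) * if i = j then 1 else 0 := by
  -- `r` normalizes `v`
  obtain ⟨r, hr⟩ := exists_unit_of_ne_zero hv
  set e : Fin n → ℝ := fun i => r * v i with he
  have e1 : ∑ i, e i * e i = 1 := by
    rw [← hr, Finset.mul_sum]; exact Finset.sum_congr rfl fun i _ => by simp only [he]; ring
  have e2 : ∀ i, r * w i = ∑ j, H i j * e j := fun i => by
    rw [hw, Finset.mul_sum]; exact Finset.sum_congr rfl fun i _ => by simp only [he]; ring
  have e3 : ∑ i, (r * w i) * (r * w i) = r * r * ∑ i, w i * w i := by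
    rw [Finset.mul_sum]; exact Finset.sum_congr rfl fun i _ => by ring
  have heq' : n * ∑ i, (r * w i) * (r * w i) = (n - 1) * ∑ i, ∑ j, H i j ^ 2 := by
    rw [e3]
    linear_combination (r * r) * heq + ((n - 1) * ∑ i, ∑ j, H i j ^ 2) * hr
  obtain ⟨a, ha⟩ := (traceless_unit (by omega) hs ht e1 e2).2 hn heq'
  have hn3 : (3 : ℝ) ≤ n := by exact_mod_cast hn
  have hn1 : (n : ℝ) - 1 ≠ 0 := by linarith
  have hrel : ∀ i j, ∑ m, H i m * H j m = a * (n - 2) / (n - 1) * H i j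
        + a ^ 2 / (n - 1) * if i = j then 1 else 0 := by
    intro i j
    have e4 : ∀ m, H i m * H j m = (a / (n - 1)) ^ 2 * (n ^ 2 * (e i * e j) * (e m * e m)
        - n * (e i * (if j = m then e m else 0)) - n * (e j * (if i = m then e m else 0))
        + (if i = m then if j = m then 1 else 0 else 0)) := by
      intro m; rw [ha, ha]; split_ifs <;> ring
    simp only [e4, ← Finset.mul_sum, Finset.sum_add_distrib, Finset.sum_sub_distrib, e1]
    simp only [Finset.sum_ite_eq, Finset.mem_univ, if_true]
    rw [ha i j]
    simp only [eq_comm (a := j)]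
    split_ifs <;> field_simp <;> ring
  refine ⟨a, ?_, hrel⟩
  have : ∀ i, ∑ j, H i j ^ 2 = a * (n - 2) / (n - 1) * H i i + a ^ 2 / (n - 1) := by
    intro i
    have := hrel i i
    simp only [if_true, mul_one] at this
    rw [← this]; exact Finset.sum_congr rfl fun j _ => sq _
  simp only [this, Finset.sum_add_distrib, ← Finset.mul_sum, ht]
  simp; ring

end Traceless

/-! ### Two constant principal curvatures -/

/-- The shape operator `A` satisfies `A² = α A + β` at `y`. -/
def QuadRel {n N : ℕ} (f ν : E n → E N) (α β : ℝ) (y : E n) : Prop :=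
  ∀ i j, inner ℝ (pd i ν y) (pd j ν y) = α * sff f ν i j y + β * gram f y i j

/-- The quadratic form `b ↦ ⟨A bᵀ, bᵀ⟩ - 2 ⟨f, b⟩ ⟨ν, b⟩ + α ⟨ν, b⟩²`. On the Clifford torus it is
constant along the hypersurface. -/
def torusForm {n N : ℕ} (f ν : E n → E N) (α : ℝ) (b : E N) (y : E n) : ℝ :=
  - carre f (fun z => inner ℝ (ν z) b) (fun z => inner ℝ (f z) b) y
    - 2 * (inner ℝ (f y) b * inner ℝ (ν y) b) + α * (inner ℝ (ν y) b * inner ℝ (ν y) b)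

section

variable {n : ℕ} {f ν : E n → E (n + 2)} {U : Set (E n)} {α β : ℝ}

lemma contDiffOn_inner_const {N : ℕ} {u : E n → E N} (hu : ContDiffOn ℝ ∞ u U) (a : E N) :
    ContDiffOn ℝ ∞ (fun z => inner ℝ (u z) a) U :=
  hu.inner ℝ contDiffOn_const

lemma IsLocalHypersurface.contDiffOn_carre (h : IsLocalHypersurface f ν U)
    {F : Type*} [NormedAddCommGroup F] [InnerProductSpace ℝ F] {u v : E n → F}
    (hu : ContDiffOn ℝ ∞ u U) (hv : ContDiffOn ℝ ∞ v U) : ContDiffOn ℝ ∞ (carre f u v) U :=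
  MinimalHypersurface.contDiffOn_carre h.isOpen h.smooth h.det hu hv

lemma IsLocalHypersurface.contDiffOn_torusForm (h : IsLocalHypersurface f ν U) (α : ℝ)
    (b : E (n + 2)) : ContDiffOn ℝ ∞ (torusForm f ν α b) U := by
  have hf := contDiffOn_inner_const h.smooth b
  have hν := contDiffOn_inner_const h.smooth_normal b
  exact ((h.contDiffOn_carre hν hf).neg.sub (contDiffOn_const.mul (hf.mul hν))).add
    (contDiffOn_const.mul (hν.mul hν))

namespace IsAdapted

lemma sum_sff_mul (h : IsAdapted f ν U) (hr : QuadRel f ν α β 0) (i j : Fin n) :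
    ∑ m, sff f ν i m 0 * sff f ν j m 0
      = α * sff f ν i j 0 + β * if i = j then 1 else 0 := by
  have := hr i j
  rw [h.inner_pd_normal_pd_normal h.mem, h.gram_zero] at this
  simpa [Matrix.one_apply] using this

/-- If `A² = α A + β` with `β > 0`, then the second fundamental form is parallel: the Codazzi
equation makes `∇h` totally symmetric, and the derivative of the relation then gives
`(α² / 4 + β) ∇h = 0`. -/
lemma parallel (h : IsAdapted f ν U) (hr : ∀ y ∈ U, QuadRel f ν α β y) (hβ : 0 < β)
    (k i j : Fin n) : pd k (sff f ν i j) 0 = 0 := by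
  set D : Fin n → Fin n → Fin n → ℝ := fun k i j => pd k (sff f ν i j) 0 with hD
  have hD1 : ∀ k i j, D k i j = D i k j := fun k i j => h.codazzi k i j
  have hD2 : ∀ k i j, D k i j = D k j i := fun k i j => h.pd_sff_symm k i j
  -- the contraction of `∇h` with `h`
  set B : Fin n → Fin n → Fin n → ℝ := fun k i j => ∑ m, sff f ν j m 0 * D k i m with hB
  have hB1 : ∀ k i j, B k i j = B i k j := fun k i j => by simp only [hB, hD1 k i]
  have hin : ∀ k i j, inner ℝ (pd k (pd i ν) 0) (pd j ν 0) = B k i j := by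
    intro k i j
    rw [h.pd_normal_zero, inner_neg_right, inner_sum, ← Finset.sum_neg_distrib]
    refine Finset.sum_congr rfl fun m _ => ?_
    rw [inner_smul_right, hD]; simp only [h.pd_sff_zero]; ring
  -- the relation, differentiated
  have hrel : ∀ k i j, B k i j + B k j i = α * D k i j := by
    intro k i j
    have e := pd_congr_of_isOpen h.isOpen h.mem (fun z hz => hr z hz i j) k
    have hg : DifferentiableAt ℝ (fun z => gram f z i j) 0 :=
      differentiableAt_of_contDiffOn (contDiffOn_gram h.smooth h.isOpen i j) h.isOpen h.mem
    rw [pd_inner (h.diff_pd_normal h.mem i) (h.diff_pd_normal h.mem j),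
      pd_add ((h.diff_sff i j).const_mul α) (hg.const_mul β), pd_const_mul α (h.diff_sff i j),
      pd_const_mul β hg, h.pd_gram_zero, hin, real_inner_comm, hin] at e
    rw [e]; ring
  -- permuting the three indices determines `B` from its symmetrization
  have hhalf : ∀ k i j, ∑ m, sff f ν j m 0 * D k i m = α / 2 * D k i j := by
    intro k i j
    have e1 := hrel k i j
    have e2 := hrel i k j
    have e3 := hrel j i k
    rw [hD2 j i k, hD1 j k i, hD2 k j i] at e3
    rw [hD1 i k j, hB1 i k j] at e2
    rw [hB1 j i k, hB1 j k i] at e3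
    change B k i j = _
    linarith
  -- contract once more with `h` and use the relation for `h²`
  have hfin : (α ^ 2 / 4 + β) * D k i j = 0 := by
    have e1 : ∑ l, sff f ν j l 0 * ∑ m, sff f ν l m 0 * D k i m = α ^ 2 / 4 * D k i j := by
      simp only [hhalf]
      have : ∀ l, sff f ν j l 0 * (α / 2 * D k i l) = α / 2 * (sff f ν j l 0 * D k i l) :=
        fun l => by ring
      simp only [this, ← Finset.mul_sum, hhalf]; ring
    have e2 : ∑ l, sff f ν j l 0 * ∑ m, sff f ν l m 0 * D k i m
        = ∑ m, (∑ l, sff f ν j l 0 * sff f ν m l 0) * D k i m := by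
      simp only [Finset.mul_sum, Finset.sum_mul]
      rw [Finset.sum_comm]
      refine Finset.sum_congr rfl fun m _ => Finset.sum_congr rfl fun l _ => ?_
      rw [h.sff_symm h.mem l m]; ring
    rw [e1] at e2
    simp only [h.sum_sff_mul (hr 0 h.mem), add_mul, Finset.sum_add_distrib, mul_assoc,
      ← Finset.mul_sum, hhalf] at e2
    simp at e2
    linear_combination (-1 : ℝ) * e2
  have : 0 < α ^ 2 / 4 + β := by positivity
  exact (mul_eq_zero.1 hfin).resolve_left this.ne'

/-- As the second fundamental form is parallel, the derivative of the torus form contains no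
derivative of it. -/
lemma pd_torusForm (h : IsAdapted f ν U) (hr : ∀ y ∈ U, QuadRel f ν α β y) (hβ : 0 < β)
    (b : E (n + 2)) (k : Fin n) :
    pd k (torusForm f ν α b) 0 = 2 * (β - 1) * inner ℝ (ν 0) b * inner ℝ (pd k f 0) b := by
  have hf := contDiffOn_inner_const h.smooth b
  have hν := contDiffOn_inner_const h.smooth_normal b
  have df := differentiableAt_of_contDiffOn hf h.isOpen h.mem
  have dν := differentiableAt_of_contDiffOn hν h.isOpen h.mem
  have dc := differentiableAt_of_contDiffOn (h.contDiffOn_carre hν hf) h.isOpen h.mem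
  set v : Fin n → ℝ := fun i => inner ℝ (pd i f 0) b with hv
  set φ : ℝ := inner ℝ (f 0) b
  set ψ : ℝ := inner ℝ (ν 0) b
  set Hv : Fin n → ℝ := fun i => ∑ j, sff f ν i j 0 * v j with hHv
  have hpν : ∀ i, pd i (fun z => inner ℝ (ν z) b) 0 = - Hv i := fun i =>
    h.pd_normal_inner_zero b i
  have hpf : ∀ i, pd i (fun z => inner ℝ (f z) b) 0 = v i := fun i =>
    pd_inner_const (h.diff h.mem) b i
  have hppf : ∀ i, pd k (pd i fun z => inner ℝ (f z) b) 0
      = sff f ν k i 0 * ψ - (if k = i then 1 else 0) * φ := by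
    intro i
    rw [pd_congr_of_isOpen h.isOpen h.mem (fun z hz => pd_inner_const (h.diff hz) b i) k,
      pd_inner_const (h.diff_pd h.mem i), h.second, inner_sub_left, inner_smul_left,
      inner_smul_left]
    simp only [RCLike.conj_to_real]; rfl
  have hppν : ∀ i, pd k (pd i fun z => inner ℝ (ν z) b) 0
      = - ((α * sff f ν i k 0 + β * if i = k then 1 else 0) * ψ) + sff f ν i k 0 * φ := by
    intro i
    rw [pd_congr_of_isOpen h.isOpen h.mem (fun z hz => pd_inner_const (h.diff_normal hz) b i) k,
      pd_inner_const (h.diff_pd_normal h.mem i), h.second_normal, inner_neg_left, sum_inner,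
      ← h.sum_sff_mul (hr 0 h.mem)]
    simp only [h.parallel hr hβ, zero_smul, zero_add, inner_smul_left, inner_sub_left,
      RCLike.conj_to_real]
    rw [Finset.sum_mul]
    have : ∀ j, sff f ν i j 0 * (sff f ν k j 0 * inner ℝ (ν 0) b
        - (if k = j then 1 else 0) * inner ℝ (f 0) b)
        = sff f ν i j 0 * sff f ν k j 0 * ψ - (if k = j then sff f ν i j 0 * φ else 0) := by
      intro j; split_ifs <;> ring
    simp only [this, Finset.sum_sub_distrib, Finset.sum_ite_eq, Finset.mem_univ, if_true]
    ring
  have hHHv : ∑ i, sff f ν i k 0 * Hv i = α * Hv k + β * v k := by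
    simp only [hHv, Finset.mul_sum]
    rw [Finset.sum_comm]
    have : ∀ j, ∑ i, sff f ν i k 0 * (sff f ν i j 0 * v j)
        = α * (sff f ν k j 0 * v j) + β * (if k = j then v j else 0) := by
      intro j
      have e := h.sum_sff_mul (hr 0 h.mem) k j
      have : ∑ i, sff f ν i k 0 * (sff f ν i j 0 * v j)
          = (∑ m, sff f ν k m 0 * sff f ν j m 0) * v j := by
        rw [Finset.sum_mul]
        refine Finset.sum_congr rfl fun i _ => ?_
        rw [h.sff_symm h.mem i k, h.sff_symm h.mem i j]; ring
      rw [this, e]; split_ifs <;> ring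
    simp only [this, Finset.sum_add_distrib]
    rw [← Finset.mul_sum, ← Finset.mul_sum]
    simp
  have hcar : pd k (carre f (fun z => inner ℝ (ν z) b) (fun z => inner ℝ (f z) b)) 0
      = -2 * α * ψ * Hv k - 2 * β * ψ * v k + 2 * φ * Hv k := by
    rw [h.pd_carre_zero hν hf]
    simp only [hpν, hpf, hppν, hppf]
    have hi : ∀ s t : ℝ, inner ℝ s t = t * s := fun s t => by simp
    simp only [hi]
    have : ∀ i, v i * (-((α * sff f ν i k 0 + β * if i = k then 1 else 0) * ψ)
        + sff f ν i k 0 * φ) + (sff f ν k i 0 * ψ - (if k = i then 1 else 0) * φ) * -Hv i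
        = (φ - α * ψ) * (sff f ν k i 0 * v i) - β * ψ * (if k = i then v i else 0)
          - ψ * (sff f ν i k 0 * Hv i) + φ * (if k = i then Hv i else 0) := by
      intro i
      rw [h.sff_symm h.mem k i]; simp only [eq_comm (a := k)]; split_ifs <;> ring
    simp only [this, Finset.sum_add_distrib, Finset.sum_sub_distrib, ← Finset.mul_sum, hHHv]
    have : ∑ i, sff f ν k i 0 * v i = Hv k := rfl
    rw [this]
    simp; ring
  unfold torusForm
  rw [pd_add (dc.fun_neg.fun_sub ((df.fun_mul dν).const_mul 2)) ((dν.fun_mul dν).const_mul α),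
    pd_sub dc.fun_neg ((df.fun_mul dν).const_mul 2), pd_neg, pd_const_mul 2 (df.fun_mul dν),
    pd_const_mul α (dν.fun_mul dν), pd_mul df dν, pd_mul dν dν, hpν, hpf]
  rw [hcar]
  change _ = 2 * (β - 1) * ψ * v k
  change - _ - 2 * (v k * ψ + φ * -Hv k) + α * (-Hv k * ψ + ψ * -Hv k) = _
  ring

end IsAdapted

/-! ### Transfer to arbitrary coordinates -/

lemma IsLocalHypersurface.exists_isAdapted {y : E n} (h : IsLocalHypersurface f ν U) (hy : y ∈ U) :
    ∃ (τ : E n → E n) (V : Set (E n)), τ 0 = y ∧ ContDiff ℝ ∞ τ ∧ Set.MapsTo τ V U ∧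
      (∀ z ∈ V, IsUnit (jacobian τ z).det) ∧ IsAdapted (f ∘ τ) (ν ∘ τ) V := by
  obtain ⟨τ, V, h1, h2, h3, h4, h5, h6, h7, h8, h9⟩ := h.exists_adapted hy
  exact ⟨τ, V, h1, h4, h5, h6, ⟨h7, h2, h8, h9⟩⟩

lemma mixedGram_comp_eq_zero {M J : Matrix (Fin n) (Fin n) ℝ} (hJ : IsUnit J.det) :
    J.transpose * M * J = 0 ↔ M = 0 := by
  refine ⟨fun h => ?_, fun h => by simp [h]⟩
  have hJt : IsUnit J.transpose.det := by rwa [Matrix.det_transpose]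
  have : J.transpose⁻¹ * (J.transpose * M * J) * J⁻¹ = M := by
    rw [show J.transpose⁻¹ * (J.transpose * M * J) * J⁻¹
      = (J.transpose⁻¹ * J.transpose) * M * (J * J⁻¹) by simp only [Matrix.mul_assoc],
      Matrix.nonsing_inv_mul _ hJt, Matrix.mul_nonsing_inv _ hJ]; simp
  rw [← this, h]; simp

lemma quadRel_iff {N : ℕ} {f ν : E n → E N} {y : E n} :
    QuadRel f ν α β y ↔ mixedGram ν ν y + α • mixedGram ν f y - β • mixedGram f f y = 0 := by
  constructor
  · intro h
    ext i j
    have := h i j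
    simp only [sff, gram, Matrix.of_apply] at this
    simp [mixedGram, this]
  · intro h i j
    have := congrFun (congrFun h i) j
    simp only [mixedGram, Matrix.of_apply, Matrix.sub_apply, Matrix.add_apply, Matrix.smul_apply,
      smul_eq_mul, Matrix.zero_apply] at this
    simp only [sff, gram, Matrix.of_apply]
    linarith

lemma quadRel_comp {N : ℕ} {f ν : E n → E N} {τ : E n → E n} {z : E n}
    (hf : DifferentiableAt ℝ f (τ z)) (hν : DifferentiableAt ℝ ν (τ z))
    (hτ : DifferentiableAt ℝ τ z) (hJ : IsUnit (jacobian τ z).det) :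
    QuadRel (f ∘ τ) (ν ∘ τ) α β z ↔ QuadRel f ν α β (τ z) := by
  rw [quadRel_iff, quadRel_iff, mixedGram_comp hν hν hτ, mixedGram_comp hν hf hτ,
    mixedGram_comp hf hf hτ, ← mixedGram_comp_eq_zero
    (M := mixedGram ν ν (τ z) + α • mixedGram ν f (τ z) - β • mixedGram f f (τ z)) hJ]
  simp only [Matrix.mul_sub, Matrix.mul_add, Matrix.sub_mul, Matrix.add_mul, Matrix.mul_smul,
    Matrix.smul_mul]

namespace IsLocalHypersurface

variable {y : E n}

/-- Evaluation of the bracket after a change of parameters. -/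
lemma carre_comp_eq (h : IsLocalHypersurface f ν U) {τ : E n → E n} {z : E n} (hτ : ContDiff ℝ ∞ τ)
    (hz : τ z ∈ U) (hJ : IsUnit (jacobian τ z).det)
    {F : Type*} [NormedAddCommGroup F] [InnerProductSpace ℝ F] {u v : E n → F}
    (hu : ContDiffOn ℝ ∞ u U) (hv : ContDiffOn ℝ ∞ v U) :
    carre (f ∘ τ) (u ∘ τ) (v ∘ τ) z = carre f u v (τ z) :=
  carre_comp (h.diff hz) (differentiableAt_of_contDiffOn hu h.isOpen hz)
    (differentiableAt_of_contDiffOn hv h.isOpen hz) (hτ.differentiable (by simp) z) hJ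

lemma contDiffOn_raise (h : IsLocalHypersurface f ν U) {v : Fin n → E n → ℝ}
    (hv : ∀ i, ContDiffOn ℝ ∞ (v i) U) :
    ContDiffOn ℝ ∞ (fun y => raise f y fun i => v i y) U := by
  refine ContDiffOn.sum fun i _ => ContDiffOn.sum fun j _ => ?_
  exact ((h.contDiffOn_gram_inv i j).mul (hv i)).smul (contDiffOn_pd h.smooth h.isOpen j)

lemma contDiffOn_grad (h : IsLocalHypersurface f ν U) {u : E n → ℝ} (hu : ContDiffOn ℝ ∞ u U) :
    ContDiffOn ℝ ∞ (grad f u) U :=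
  h.contDiffOn_raise fun i => contDiffOn_pd hu h.isOpen i

lemma grad_comp (h : IsLocalHypersurface f ν U) {τ : E n → E n} {z : E n} (hτ : ContDiff ℝ ∞ τ)
    (hz : τ z ∈ U) (hJ : IsUnit (jacobian τ z).det) {u : E n → ℝ} (hu : ContDiffOn ℝ ∞ u U) :
    grad (f ∘ τ) (u ∘ τ) z = grad f u (τ z) := by
  refine ext_inner_right ℝ fun c => ?_
  rw [inner_grad ((h.diff hz).comp z (hτ.differentiable (by simp) z)), inner_grad (h.diff hz)]
  have e : carre (f ∘ τ) (u ∘ τ) ((fun z => inner ℝ (f z) c) ∘ τ) z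
      = carre f u (fun z => inner ℝ (f z) c) (τ z) :=
    h.carre_comp_eq hτ hz hJ hu (contDiffOn_inner_const h.smooth c)
  exact e

lemma laplacian_comp (h : IsLocalHypersurface f ν U) {τ : E n → E n} {V : Set (E n)} {z : E n}
    (hτ : ContDiff ℝ ∞ τ) (hV : IsOpen V) (hm : Set.MapsTo τ V U) (hz : z ∈ V)
    (hJ : ∀ z ∈ V, IsUnit (jacobian τ z).det) {u : E n → ℝ} (hu : ContDiffOn ℝ ∞ u U) :
    carre (f ∘ τ) (grad (f ∘ τ) (u ∘ τ)) (f ∘ τ) z = carre f (grad f u) f (τ z) := by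
  rw [← h.carre_comp_eq hτ (hm hz) (hJ z hz) (h.contDiffOn_grad hu) h.smooth]
  refine carre_congr Filter.EventuallyEq.rfl ?_ Filter.EventuallyEq.rfl
  filter_upwards [hV.mem_nhds hz] with w hw
  exact h.grad_comp hτ (hm hw) (hJ w hw) hu

/-- `Δ(φ²) = 2 |∇φ|² - 2 n φ²` for a height function `φ`. -/
lemma laplacian_height_sq (h : IsLocalHypersurface f ν U) (hy : y ∈ U) (a : E (n + 2)) :
    carre f (grad f fun z => inner ℝ (f z) a ^ 2) f y
      = 2 * carre f (fun z => inner ℝ (f z) a) (fun z => inner ℝ (f z) a) y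
        - 2 * n * inner ℝ (f y) a ^ 2 := by
  obtain ⟨τ, V, rfl, hτ, hm, hJ, had⟩ := h.exists_isAdapted hy
  have hu := contDiffOn_inner_const h.smooth a
  rw [← h.laplacian_comp hτ had.isOpen hm had.mem hJ (hu.pow 2),
    ← h.carre_comp_eq hτ (hm had.mem) (hJ 0 had.mem) hu hu]
  have := had.laplacian_sq (contDiffOn_inner_const had.smooth a)
  rw [had.laplacian_inner had.smooth, had.laplacian_self, inner_smul_left] at this
  refine this.trans ?_
  simp only [RCLike.conj_to_real, Function.comp_def]
  ring

/-- `Δ(ψ²) = 2 |∇ψ|² - 2 S ψ²` for a component `ψ` of the normal. -/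
lemma laplacian_normal_sq (h : IsLocalHypersurface f ν U) (hy : y ∈ U) (a : E (n + 2)) :
    carre f (grad f fun z => inner ℝ (ν z) a ^ 2) f y
      = 2 * carre f (fun z => inner ℝ (ν z) a) (fun z => inner ℝ (ν z) a) y
        - 2 * carre f ν ν y * inner ℝ (ν y) a ^ 2 := by
  obtain ⟨τ, V, rfl, hτ, hm, hJ, had⟩ := h.exists_isAdapted hy
  have hu := contDiffOn_inner_const h.smooth_normal a
  rw [← h.laplacian_comp hτ had.isOpen hm had.mem hJ (hu.pow 2),
    ← h.carre_comp_eq hτ (hm had.mem) (hJ 0 had.mem) hu hu,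
    ← h.carre_comp_eq hτ (hm had.mem) (hJ 0 had.mem) h.smooth_normal h.smooth_normal]
  have := had.laplacian_sq (contDiffOn_inner_const had.smooth_normal a)
  rw [had.laplacian_inner had.smooth_normal, had.laplacian_normal, inner_smul_left] at this
  refine this.trans ?_
  simp only [RCLike.conj_to_real, Function.comp_def]
  ring

lemma transport (h : IsLocalHypersurface f ν U) (hy : y ∈ U) {a : E (n + 2)}
    (ha : ∀ y ∈ U, inner ℝ (ν y) a = (0 : ℝ)) :
    carre f (fun z => inner ℝ (f z) a) (carre f ν ν) y
      = 2 * inner ℝ (f y) a * carre f ν ν y := by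
  obtain ⟨τ, V, rfl, hτ, hm, hJ, had⟩ := h.exists_isAdapted hy
  have hu := contDiffOn_inner_const h.smooth a
  have hS := h.contDiffOn_carre h.smooth_normal h.smooth_normal
  rw [← h.carre_comp_eq hτ (hm had.mem) (hJ 0 had.mem) hu hS,
    ← h.carre_comp_eq hτ (hm had.mem) (hJ 0 had.mem) h.smooth_normal h.smooth_normal]
  refine Eq.trans ?_ (had.transport fun z hz => ha _ (hm hz))
  refine carre_congr Filter.EventuallyEq.rfl Filter.EventuallyEq.rfl ?_
  filter_upwards [had.isOpen.mem_nhds had.mem] with w hw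
  exact (h.carre_comp_eq hτ (hm hw) (hJ w hw) h.smooth_normal h.smooth_normal).symm

lemma carre_self_inner {u : E n → ℝ} (h : IsAdapted f ν U) :
    carre f u u 0 = ∑ i, pd i u 0 * pd i u 0 := by
  rw [h.carre_zero]
  exact Finset.sum_congr rfl fun i _ => by simp [sq]

/-- `n |A aᵀ|² ≤ (n - 1) S |aᵀ|²`. -/
lemma carre_normal_le (h : IsLocalHypersurface f ν U) (hn : 1 ≤ n) (hy : y ∈ U) (a : E (n + 2)) :
    n * carre f (fun z => inner ℝ (ν z) a) (fun z => inner ℝ (ν z) a) y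
      ≤ (n - 1) * carre f ν ν y
        * carre f (fun z => inner ℝ (f z) a) (fun z => inner ℝ (f z) a) y := by
  obtain ⟨τ, V, rfl, hτ, hm, hJ, had⟩ := h.exists_isAdapted hy
  have hu := contDiffOn_inner_const h.smooth a
  have hv := contDiffOn_inner_const h.smooth_normal a
  rw [← h.carre_comp_eq hτ (hm had.mem) (hJ 0 had.mem) hu hu,
    ← h.carre_comp_eq hτ (hm had.mem) (hJ 0 had.mem) hv hv,
    ← h.carre_comp_eq hτ (hm had.mem) (hJ 0 had.mem) h.smooth_normal h.smooth_normal]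
  have := traceless_le hn (H := fun i j => sff (f ∘ τ) (ν ∘ τ) i j 0) (had.sff_symm had.mem)
    had.trace_sff (v := fun i => inner ℝ (pd i (f ∘ τ) 0) a)
    (w := fun i => ∑ j, sff (f ∘ τ) (ν ∘ τ) i j 0 * inner ℝ (pd j (f ∘ τ) 0) a) fun i => rfl
  have ef : ∀ i, pd i ((fun z => inner ℝ (f z) a) ∘ τ) 0 = inner ℝ (pd i (f ∘ τ) 0) a :=
    fun i => pd_inner_const (had.diff had.mem) a i
  have eν : ∀ i, pd i ((fun z => inner ℝ (ν z) a) ∘ τ) 0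
      = - ∑ j, sff (f ∘ τ) (ν ∘ τ) i j 0 * inner ℝ (pd j (f ∘ τ) 0) a :=
    fun i => had.pd_normal_inner_zero a i
  rw [had.carre_normal, carre_self_inner had, carre_self_inner had]
  simp only [ef, eν, neg_mul_neg]
  exact this

lemma quadRel_of_eq (h : IsLocalHypersurface f ν U) (hn : 3 ≤ n) (hy : y ∈ U) {a : E (n + 2)}
    (h0 : carre f (fun z => inner ℝ (f z) a) (fun z => inner ℝ (f z) a) y ≠ 0)
    (heq : n * carre f (fun z => inner ℝ (ν z) a) (fun z => inner ℝ (ν z) a) y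
      = (n - 1) * carre f ν ν y
        * carre f (fun z => inner ℝ (f z) a) (fun z => inner ℝ (f z) a) y) :
    ∃ c : ℝ, carre f ν ν y = n * c ^ 2 / (n - 1) ∧
      QuadRel f ν (c * (n - 2) / (n - 1)) (c ^ 2 / (n - 1)) y := by
  obtain ⟨τ, V, rfl, hτ, hm, hJ, had⟩ := h.exists_isAdapted hy
  have hu := contDiffOn_inner_const h.smooth a
  have hv := contDiffOn_inner_const h.smooth_normal a
  have ef : ∀ i, pd i ((fun z => inner ℝ (f z) a) ∘ τ) 0 = inner ℝ (pd i (f ∘ τ) 0) a :=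
    fun i => pd_inner_const (had.diff had.mem) a i
  have eν : ∀ i, pd i ((fun z => inner ℝ (ν z) a) ∘ τ) 0
      = - ∑ j, sff (f ∘ τ) (ν ∘ τ) i j 0 * inner ℝ (pd j (f ∘ τ) 0) a :=
    fun i => had.pd_normal_inner_zero a i
  rw [← h.carre_comp_eq hτ (hm had.mem) (hJ 0 had.mem) hu hu, carre_self_inner had] at h0
  rw [← h.carre_comp_eq hτ (hm had.mem) (hJ 0 had.mem) hu hu,
    ← h.carre_comp_eq hτ (hm had.mem) (hJ 0 had.mem) hv hv,
    ← h.carre_comp_eq hτ (hm had.mem) (hJ 0 had.mem) h.smooth_normal h.smooth_normal,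
    had.carre_normal, carre_self_inner had, carre_self_inner had] at heq
  simp only [ef, eν, neg_mul_neg] at h0 heq
  obtain ⟨c, hc1, hc2⟩ := traceless_eq hn (H := fun i j => sff (f ∘ τ) (ν ∘ τ) i j 0)
    (had.sff_symm had.mem) had.trace_sff (v := fun i => inner ℝ (pd i (f ∘ τ) 0) a)
    (w := fun i => ∑ j, sff (f ∘ τ) (ν ∘ τ) i j 0 * inner ℝ (pd j (f ∘ τ) 0) a) (fun i => rfl)
    h0 heq
  refine ⟨c, ?_, ?_⟩
  · rw [← h.carre_comp_eq hτ (hm had.mem) (hJ 0 had.mem) h.smooth_normal h.smooth_normal,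
      had.carre_normal, hc1]
  · rw [← quadRel_comp (h.diff (hm had.mem)) (h.diff_normal (hm had.mem))
      (hτ.differentiable (by simp) 0) (hJ 0 had.mem)]
    intro i j
    rw [had.inner_pd_normal_pd_normal had.mem, had.gram_zero, Matrix.one_apply, ← hc2]
    simp [Matrix.one_apply]

/-- On a surface, `A² = (S / 2)` by the Cayley-Hamilton theorem. -/
lemma quadRel_surface {f ν : E 2 → E 4} {U : Set (E 2)} {y : E 2}
    (h : IsLocalHypersurface f ν U) (hy : y ∈ U) :
    QuadRel f ν 0 (carre f ν ν y / 2) y := by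
  obtain ⟨τ, V, rfl, hτ, hm, hJ, had⟩ := h.exists_isAdapted hy
  rw [← h.carre_comp_eq hτ (hm had.mem) (hJ 0 had.mem) h.smooth_normal h.smooth_normal,
    ← quadRel_comp (h.diff (hm had.mem)) (h.diff_normal (hm had.mem))
      (hτ.differentiable (by simp) 0) (hJ 0 had.mem)]
  have ht := had.trace_sff
  have hs := had.sff_symm had.mem 0 1
  intro i j
  rw [had.inner_pd_normal_pd_normal had.mem, had.gram_zero, had.carre_normal]
  simp only [Fin.sum_univ_two, Matrix.one_apply, inv_one] at ht ⊢
  have e : sff (f ∘ τ) (ν ∘ τ) 1 1 0 = - sff (f ∘ τ) (ν ∘ τ) 0 0 0 := by linarith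
  fin_cases i <;> fin_cases j <;> simp <;> simp only [e, ← hs] <;> ring

lemma contDiffOn_sub_const_mul (h : IsLocalHypersurface f ν U) (α c : ℝ) (b : E (n + 2)) :
    ContDiffOn ℝ ∞ (fun y => torusForm f ν α b y - c * inner ℝ (f y) b) U :=
  (h.contDiffOn_torusForm α b).sub (contDiffOn_const.mul (contDiffOn_inner_const h.smooth b))

lemma torusForm_comp (h : IsLocalHypersurface f ν U) {τ : E n → E n} {z : E n}
    (hτ : ContDiff ℝ ∞ τ) (hz : τ z ∈ U) (hJ : IsUnit (jacobian τ z).det) (α : ℝ) (b : E (n + 2)) :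
    torusForm (f ∘ τ) (ν ∘ τ) α b z = torusForm f ν α b (τ z) := by
  have := h.carre_comp_eq hτ hz hJ (contDiffOn_inner_const h.smooth_normal b)
    (contDiffOn_inner_const h.smooth b)
  simp only [torusForm, ← this]; rfl

lemma pd_torusForm (h : IsLocalHypersurface f ν U) (hr : ∀ y ∈ U, QuadRel f ν α β y) (hβ : 0 < β)
    (hy : y ∈ U) (b : E (n + 2)) (k : Fin n) :
    pd k (torusForm f ν α b) y = 2 * (β - 1) * inner ℝ (ν y) b * inner ℝ (pd k f y) b := by
  obtain ⟨τ, V, rfl, hτ, hm, hJ, had⟩ := h.exists_isAdapted hy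
  have hrV : ∀ z ∈ V, QuadRel (f ∘ τ) (ν ∘ τ) α β z := fun z hz =>
    (quadRel_comp (h.diff (hm hz)) (h.diff_normal (hm hz))
      (hτ.differentiable (by simp) z) (hJ z hz)).2 (hr _ (hm hz))
  set c : ℝ := 2 * (β - 1) * inner ℝ (ν (τ 0)) b with hc
  have hw : DifferentiableAt ℝ (fun y => torusForm f ν α b y - c * inner ℝ (f y) b) (τ 0) :=
    differentiableAt_of_contDiffOn (h.contDiffOn_sub_const_mul α c b) h.isOpen (hm had.mem)
  have key : ∀ i, pd i ((fun y => torusForm f ν α b y - c * inner ℝ (f y) b) ∘ τ) 0 = 0 := by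
    intro i
    have e : Set.EqOn ((fun y => torusForm f ν α b y - c * inner ℝ (f y) b) ∘ τ)
        (fun z => torusForm (f ∘ τ) (ν ∘ τ) α b z - c * inner ℝ ((f ∘ τ) z) b) V := by
      intro z hz
      simp only [h.torusForm_comp hτ (hm hz) (hJ z hz), Function.comp_apply]
    have d1 : DifferentiableAt ℝ (torusForm (f ∘ τ) (ν ∘ τ) α b) 0 :=
      differentiableAt_of_contDiffOn (had.contDiffOn_torusForm α b) had.isOpen had.mem
    have d2 : DifferentiableAt ℝ (fun z => inner ℝ ((f ∘ τ) z) b) 0 :=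
      differentiableAt_of_contDiffOn (contDiffOn_inner_const had.smooth b) had.isOpen had.mem
    rw [pd_congr_of_isOpen had.isOpen had.mem e, pd_sub d1 (d2.const_mul c),
      had.pd_torusForm hrV hβ, pd_const_mul c d2, pd_inner_const (had.diff had.mem)]
    simp [hc]
  have := pd_eq_zero_of_comp hw (hτ.differentiable (by simp) 0) (hJ 0 had.mem) key k
  have d1 : DifferentiableAt ℝ (torusForm f ν α b) (τ 0) :=
      differentiableAt_of_contDiffOn (h.contDiffOn_torusForm α b) h.isOpen hy
  have d2 : DifferentiableAt ℝ (fun z => inner ℝ (f z) b) (τ 0) :=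
      differentiableAt_of_contDiffOn (contDiffOn_inner_const h.smooth b) h.isOpen hy
  rw [pd_sub d1 (d2.const_mul c), pd_const_mul c d2, pd_inner_const (h.diff hy)] at this
  linarith

/-- With two distinct constant principal curvatures, their product is `-1`. -/
lemma beta_eq_one (h : IsLocalHypersurface f ν U) (hn : 1 ≤ n)
    (hr : ∀ y ∈ U, QuadRel f ν α β y) (hβ : 0 < β) (hy : y ∈ U) : β = 1 := by
  obtain ⟨τ, V, rfl, hτ, hm, hJ, had⟩ := h.exists_isAdapted hy
  have hrV : ∀ z ∈ V, QuadRel (f ∘ τ) (ν ∘ τ) α β z := fun z hz =>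
    (quadRel_comp (h.diff (hm hz)) (h.diff_normal (hm hz))
      (hτ.differentiable (by simp) z) (hJ z hz)).2 (hr _ (hm hz))
  by_contra hβ1
  set f' := f ∘ τ
  set ν' := ν ∘ τ
  -- equality of the mixed second derivatives of the torus form
  have hsym : ∀ (b : E (n + 2)) (j k : Fin n),
      inner ℝ (pd j ν' 0) b * inner ℝ (pd k f' 0) b
        = inner ℝ (pd k ν' 0) b * inner ℝ (pd j f' 0) b := by
    intro b j k
    have hpp : ∀ j k, pd j (pd k (torusForm f' ν' α b)) 0
        = 2 * (β - 1) * (inner ℝ (pd j ν' 0) b * inner ℝ (pd k f' 0) b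
          + inner ℝ (ν' 0) b * inner ℝ (pd j (pd k f') 0) b) := by
      intro j k
      have d1 : DifferentiableAt ℝ (fun z => inner ℝ (ν' z) b) 0 :=
        (had.diff_normal had.mem).inner ℝ (differentiableAt_const b)
      have d2 : DifferentiableAt ℝ (fun z => inner ℝ (pd k f' z) b) 0 :=
        (had.diff_pd had.mem k).inner ℝ (differentiableAt_const b)
      have e : Set.EqOn (pd k (torusForm f' ν' α b)) (fun z => 2 * (β - 1) *
          (inner ℝ (ν' z) b * inner ℝ (pd k f' z) b)) V := fun z hz => by
        rw [had.toIsLocalHypersurface.pd_torusForm hrV hβ hz]; ring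
      rw [pd_congr_of_isOpen had.isOpen had.mem e, pd_const_mul _ (d1.fun_mul d2), pd_mul d1 d2,
        pd_inner_const (had.diff_normal had.mem), pd_inner_const (had.diff_pd had.mem k)]
    have := pd_comm (had.contDiffOn_torusForm α b) had.isOpen had.mem j k
    rw [hpp, hpp, pd_comm had.smooth had.isOpen had.mem j k] at this
    have h2 : 2 * (β - 1) ≠ 0 := mul_ne_zero two_ne_zero (sub_ne_zero.2 hβ1)
    have := mul_left_cancel₀ h2 this
    linarith
  have hH : ∀ (v : Fin n → ℝ) (j k : Fin n),
      (∑ m, sff f' ν' j m 0 * v m) * v k = (∑ m, sff f' ν' k m 0 * v m) * v j := by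
    intro v j k
    have e := hsym (raise f' 0 v) j k
    have hp : ∀ i, inner ℝ (pd i f' 0) (raise f' 0 v) = v i := fun i =>
      inner_pd_raise (had.det 0 had.mem) v i
    have hq : ∀ i, inner ℝ (pd i ν' 0) (raise f' 0 v) = - ∑ m, sff f' ν' i m 0 * v m := by
      intro i
      rw [had.pd_normal_zero, inner_neg_left, sum_inner]
      simp only [inner_smul_left, hp, RCLike.conj_to_real]
    rw [hp, hp, hq, hq] at e
    linarith
  have hoff : ∀ i j, i ≠ j → sff f' ν' i j 0 = 0 := by
    intro i j hij
    have := hH (fun m => if m = j then 1 else 0) i j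
    simpa [hij] using this
  have hdiag : ∀ i j, sff f' ν' i i 0 = sff f' ν' j j 0 := by
    intro i j
    by_cases hij : i = j
    · rw [hij]
    have := hH (fun m => (if m = i then 1 else 0) + if m = j then 1 else 0) i j
    simp [mul_add, Finset.sum_add_distrib, hij, Ne.symm hij, hoff i j hij,
      hoff j i (Ne.symm hij)] at this
    exact this
  let i0 : Fin n := ⟨0, hn⟩
  have htr := had.trace_sff
  have hz : sff f' ν' i0 i0 0 = 0 := by
    have e : ∑ i, sff f' ν' i i 0 = n * sff f' ν' i0 i0 0 := by
      rw [Finset.sum_congr rfl fun i _ => hdiag i i0]; simp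
    have : (n : ℝ) ≠ 0 := by positivity
    rw [e] at htr
    exact (mul_eq_zero.1 htr).resolve_left this
  have := had.sum_sff_mul (hrV 0 had.mem) i0 i0
  have hz' : ∀ m, sff f' ν' i0 m 0 = 0 := fun m => by
    by_cases hm : i0 = m
    · rw [← hm, hz]
    · exact hoff _ _ hm
  simp [hz'] at this
  exact hβ.ne this

lemma pd_torusForm_eq_zero (h : IsLocalHypersurface f ν U) (hn : 1 ≤ n)
    (hr : ∀ y ∈ U, QuadRel f ν α β y) (hβ : 0 < β) (hy : y ∈ U) (b : E (n + 2)) (k : Fin n) :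
    pd k (torusForm f ν α b) y = 0 := by
  rw [h.pd_torusForm hr hβ hy, h.beta_eq_one hn hr hβ hy]; ring

end IsLocalHypersurface
end

/-! ### From the manifold to charts -/

lemma jacobian_comp {n : ℕ} {σ τ : E n → E n} {z : E n} (hσ : DifferentiableAt ℝ σ (τ z))
    (hτ : DifferentiableAt ℝ τ z) :
    jacobian (σ ∘ τ) z = jacobian σ (τ z) * jacobian τ z := by
  ext k i
  simp only [jacobian, Matrix.of_apply, pd_comp hσ hτ, Matrix.mul_apply, WithLp.ofLp_sum,
    WithLp.ofLp_smul, Finset.sum_apply, Pi.smul_apply, smul_eq_mul]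
  exact Finset.sum_congr rfl fun j _ => mul_comm _ _

lemma jacobian_id {n : ℕ} (z : E n) : jacobian (fun z : E n => z) z = 1 := by
  ext k i
  simp [jacobian, pd, Matrix.one_apply]

lemma isUnit_gram_of_injective {n N : ℕ} {f : E n → E N} {y : E n}
    (h : Function.Injective (fderiv ℝ f y)) : IsUnit (gram f y).det := by
  rw [isUnit_iff_ne_zero]
  intro h0
  obtain ⟨v, hv, hv0⟩ := Matrix.exists_mulVec_eq_zero_iff.2 h0
  apply hv
  have e : fderiv ℝ f y (WithLp.toLp 2 v) = 0 := by
    rw [← inner_self_eq_zero (𝕜 := ℝ), fderiv_apply_eq_sum_pd]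
    have : inner ℝ (∑ i, v i • pd i f y) (∑ i, v i • pd i f y)
        = ∑ i, v i * (gram f y).mulVec v i := by
      simp only [sum_inner, inner_sum, inner_smul_left, inner_smul_right, Matrix.mulVec,
        dotProduct, gram, Matrix.of_apply, Finset.mul_sum, RCLike.conj_to_real]
      refine Finset.sum_congr rfl fun i _ => Finset.sum_congr rfl fun j _ => ?_
      rw [real_inner_comm]; ring
    change inner ℝ (∑ i, v i • pd i f y) (∑ i, v i • pd i f y) = (0 : ℝ)
    rw [this, hv0]; simp
  have := h (e.trans (map_zero _).symm)
  ext i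
  exact congrArg (fun w : E n => w i) this

/-- A unit normal field exists locally. -/
lemma exists_isFramed {n : ℕ} {f : E n → E (n + 2)} {U : Set (E n)} (hU : IsOpen U)
    (hf : ContDiffOn ℝ ∞ f U) (hd : ∀ y ∈ U, IsUnit (gram f y).det)
    (h1 : ∀ y ∈ U, inner ℝ (f y) (f y) = (1 : ℝ)) {y : E n} (hy : y ∈ U) :
    ∃ (ν : E n → E (n + 2)) (V : Set (E n)), y ∈ V ∧ V ⊆ U ∧ IsFramed f ν V := by
  have hpf : ∀ z ∈ U, ∀ i, inner ℝ (pd i f z) (f z) = (0 : ℝ) := by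
    intro z hz i
    have df := differentiableAt_of_contDiffOn hf hU hz
    have := pd_congr_of_isOpen hU hz h1 i
    rw [pd_inner df df, pd_const, real_inner_comm (f z)] at this
    rw [real_inner_comm]; linarith
  let T : E (n + 2) →ₗ[ℝ] (ℝ × (Fin n → ℝ)) :=
    (innerₛₗ ℝ (f y)).prod (LinearMap.pi fun i => innerₛₗ ℝ (pd i f y))
  -- the tangent space and the position vector span only `n + 1` dimensions
  have hker : LinearMap.ker T ≠ ⊥ := by
    apply LinearMap.ker_ne_bot_of_finrank_lt
    simp [Module.finrank_prod]; omega
  obtain ⟨ν₀, hν₀, hν₀0⟩ := (Submodule.ne_bot_iff _).1 hker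
  have hT : T ν₀ = 0 := hν₀
  have e1 : inner ℝ (f y) ν₀ = (0 : ℝ) := congrArg Prod.fst hT
  have e2 : ∀ i, inner ℝ (pd i f y) ν₀ = (0 : ℝ) := fun i => congrFun (congrArg Prod.snd hT) i
  -- the component of the fixed vector `ν₀` along the moving normal line
  set P : E n → E (n + 2) := fun z => ν₀ - inner ℝ (f z) ν₀ • f z
    - raise f z fun i => inner ℝ (pd i f z) ν₀ with hP
  have hPs : ContDiffOn ℝ ∞ P U := by
    refine (contDiffOn_const.sub ((contDiffOn_inner_const hf ν₀).smul hf)).sub ?_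
    refine ContDiffOn.sum fun i _ => ContDiffOn.sum fun j _ => ?_
    exact ((contDiffOn_inv_entry (contDiffOn_gram hf hU) hd i j).mul
      (contDiffOn_inner_const (contDiffOn_pd hf hU i) ν₀)).smul (contDiffOn_pd hf hU j)
  have hPy : P y = ν₀ := by simp [hP, e1, e2, raise]
  have hPf : ∀ z ∈ U, inner ℝ (f z) (P z) = (0 : ℝ) := by
    intro z hz
    simp only [hP, inner_sub_right, inner_smul_right, h1 z hz]
    rw [real_inner_comm (raise _ _ _), inner_raise]
    simp [hpf z hz]
  have hPp : ∀ z ∈ U, ∀ i, inner ℝ (pd i f z) (P z) = (0 : ℝ) := by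
    intro z hz i
    simp only [hP, inner_sub_right, inner_smul_right, hpf z hz, inner_pd_raise (hd z hz)]
    ring
  set V : Set (E n) := U ∩ P ⁻¹' {0}ᶜ with hV
  have hVo : IsOpen V := hPs.continuousOn.isOpen_inter_preimage hU isOpen_compl_singleton
  have hVU : V ⊆ U := Set.inter_subset_left
  have hPV : ∀ z ∈ V, P z ≠ 0 := fun z hz => hz.2
  refine ⟨fun z => ‖P z‖⁻¹ • P z, V, ⟨hy, by simpa [hPy] using hν₀0⟩, hVU,
    hVo, hf.mono hVU, ?_, fun z hz => hd z (hVU hz), fun z hz => h1 z (hVU hz), ?_, ?_, ?_⟩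
  · have hPs' := hPs.mono hVU
    exact (ContDiffOn.inv (hPs'.norm ℝ hPV) fun z hz => norm_ne_zero_iff.2 (hPV z hz)).smul hPs'
  · intro z hz
    have := norm_ne_zero_iff.2 (hPV z hz)
    rw [inner_smul_left, inner_smul_right, real_inner_self_eq_norm_sq]
    simp only [RCLike.conj_to_real]
    field_simp
  · intro z hz
    rw [inner_smul_right, hPf z (hVU hz), mul_zero]
  · intro z hz i
    rw [inner_smul_right, hPp z (hVU hz), mul_zero]

section Charts

variable {n N : ℕ} {M : Type*} [TopologicalSpace M] [ChartedSpace (E n) M]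

/-- The preferred chart around `p`. -/
abbrev ch (n : ℕ) {M : Type*} [TopologicalSpace M] [ChartedSpace (E n) M] (p : M) :
    OpenPartialHomeomorph M (E n) := chartAt (E n) p

lemma coord_mem_target (p : M) : coord p ∈ (ch n p).target := mem_chart_target _ p

lemma ch_symm_coord (p : M) : (ch n p).symm (coord p) = p :=
  (ch n p).left_inv (mem_chart_source _ p)

/-- The transition from the chart at `q` to the chart at `p`. -/
def trans (n : ℕ) {M : Type*} [TopologicalSpace M] [ChartedSpace (E n) M] (q p : M) : E n → E n :=
  ch n p ∘ (ch n q).symm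

/-- The domain of the transition map. -/
def transDom (n : ℕ) {M : Type*} [TopologicalSpace M] [ChartedSpace (E n) M] (q p : M) :
    Set (E n) := (ch n q).target ∩ (ch n q).symm ⁻¹' (ch n p).source

lemma isOpen_transDom (q p : M) : IsOpen (transDom n q p) :=
  (ch n q).symm.isOpen_inter_preimage (ch n p).open_source

lemma trans_mapsTo (q p : M) : Set.MapsTo (trans n q p) (transDom n q p) (transDom n p q) := by
  intro z hz
  refine ⟨(ch n p).map_source hz.2, ?_⟩
  rw [Set.mem_preimage, trans, Function.comp_apply, (ch n p).left_inv hz.2]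
  exact (ch n q).map_target hz.1

lemma symm_trans {q p : M} {z : E n} (hz : z ∈ transDom n q p) :
    (ch n p).symm (trans n q p z) = (ch n q).symm z :=
  (ch n p).left_inv hz.2

lemma trans_trans {q p : M} {z : E n} (hz : z ∈ transDom n q p) :
    trans n p q (trans n q p z) = z := by
  change ch n q ((ch n p).symm (trans n q p z)) = z
  rw [symm_trans hz, (ch n q).right_inv hz.1]

lemma comp_trans_eqOn {G : Type*} (u : M → G) (q p : M) :
    Set.EqOn (u ∘ (ch n q).symm) ((u ∘ (ch n p).symm) ∘ trans n q p) (transDom n q p) := by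
  intro z hz
  simp only [Function.comp_apply, symm_trans hz]

/-- The bracket of two maps on `M` with respect to the metric induced by `x`. -/
def Gam {F : Type*} [NormedAddCommGroup F] [InnerProductSpace ℝ F]
    (x : M → E N) (u v : M → F) (p : M) : ℝ :=
  carre (param x p) (u ∘ (ch n p).symm) (v ∘ (ch n p).symm) (coord p)

lemma coord_mem_transDom {p : M} {y : E n} (hy : y ∈ (ch n p).target) :
    coord ((ch n p).symm y) ∈ transDom n ((ch n p).symm y) p := by
  refine ⟨coord_mem_target _, ?_⟩
  rw [Set.mem_preimage, ch_symm_coord]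
  exact (ch n p).map_target hy

lemma trans_coord {p : M} {y : E n} (hy : y ∈ (ch n p).target) :
    trans n ((ch n p).symm y) p (coord ((ch n p).symm y)) = y := by
  rw [trans, Function.comp_apply, ch_symm_coord, (ch n p).right_inv hy]

variable [IsManifold (𝓡 n) ∞ M]

lemma contDiffOn_chart {F : Type*} [NormedAddCommGroup F] [NormedSpace ℝ F] {u : M → F}
    (hu : ContMDiff (𝓡 n) 𝓘(ℝ, F) ∞ u) (p : M) :
    ContDiffOn ℝ ∞ (u ∘ (ch n p).symm) (ch n p).target := by
  rw [← contMDiffOn_iff_contDiffOn]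
  exact hu.comp_contMDiffOn contMDiffOn_chart_symm

lemma contMDiff_of_charts {F : Type*} [NormedAddCommGroup F] [NormedSpace ℝ F] {u : M → F}
    (hu : ∀ p : M, ∃ U : Set (E n), IsOpen U ∧ coord p ∈ U ∧
      ContDiffOn ℝ ∞ (u ∘ (ch n p).symm) U) : ContMDiff (𝓡 n) 𝓘(ℝ, F) ∞ u := by
  intro p
  obtain ⟨U, hU, hp, h⟩ := hu p
  have h1 : ContMDiffAt 𝓘(ℝ, E n) 𝓘(ℝ, F) ∞ (u ∘ (ch n p).symm) (ch n p p) :=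
    contMDiffAt_iff_contDiffAt.2 (h.contDiffAt (hU.mem_nhds hp))
  have h2 : ContMDiffAt (𝓡 n) 𝓘(ℝ, E n) ∞ (ch n p) p :=
    contMDiffAt_of_mem_maximalAtlas (IsManifold.chart_mem_maximalAtlas p) (mem_chart_source _ p)
  refine (h1.comp p h2).congr_of_eventuallyEq ?_
  filter_upwards [(ch n p).open_source.mem_nhds (mem_chart_source _ p)] with q hq
  simp [(ch n p).left_inv hq]

lemma contDiffOn_trans (q p : M) : ContDiffOn ℝ ∞ (trans n q p) (transDom n q p) := by
  rw [← contMDiffOn_iff_contDiffOn]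
  have h1 : ContMDiffOn (𝓡 n) 𝓘(ℝ, E n) ∞ (ch n p) (ch n p).source := contMDiffOn_chart
  have h2 : ContMDiffOn 𝓘(ℝ, E n) (𝓡 n) ∞ (ch n q).symm (ch n q).target := contMDiffOn_chart_symm
  exact h1.comp (h2.mono Set.inter_subset_left) fun z hz => hz.2

lemma isUnit_jacobian_trans {q p : M} {z : E n} (hz : z ∈ transDom n q p) :
    IsUnit (jacobian (trans n q p) z).det := by
  have d1 := differentiableAt_of_contDiffOn (contDiffOn_trans q p) (isOpen_transDom q p) hz
  have d2 := differentiableAt_of_contDiffOn (contDiffOn_trans p q) (isOpen_transDom p q)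
    (trans_mapsTo q p hz)
  have e : jacobian (trans n p q ∘ trans n q p) z = 1 := by
    rw [← jacobian_id z]
    ext k i
    simp only [jacobian, Matrix.of_apply]
    have he : Set.EqOn (trans n p q ∘ trans n q p) (fun z => z) (transDom n q p) :=
      fun w hw => trans_trans hw
    rw [pd_congr_of_isOpen (isOpen_transDom q p) hz he]
  rw [jacobian_comp d2 d1] at e
  have := congrArg Matrix.det e
  rw [Matrix.det_mul, Matrix.det_one] at this
  exact IsUnit.of_mul_eq_one _ (by rw [mul_comm]; exact this)

/-- The bracket may be computed in any preferred chart. -/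
lemma carre_trans {F : Type*} [NormedAddCommGroup F] [InnerProductSpace ℝ F]
    {x : M → E N} {u v : M → F} {q p : M} {z : E n} (hz : z ∈ transDom n q p)
    (hx : DifferentiableAt ℝ (x ∘ (ch n p).symm) (trans n q p z))
    (hu : DifferentiableAt ℝ (u ∘ (ch n p).symm) (trans n q p z))
    (hv : DifferentiableAt ℝ (v ∘ (ch n p).symm) (trans n q p z)) :
    carre (x ∘ (ch n q).symm) (u ∘ (ch n q).symm) (v ∘ (ch n q).symm) z
      = carre (x ∘ (ch n p).symm) (u ∘ (ch n p).symm) (v ∘ (ch n p).symm) (trans n q p z) := by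
  have hN := (isOpen_transDom (n := n) q p).mem_nhds hz
  rw [← carre_comp hx hu hv (differentiableAt_of_contDiffOn (contDiffOn_trans q p)
    (isOpen_transDom q p) hz) (isUnit_jacobian_trans hz)]
  exact carre_congr ((comp_trans_eqOn x q p).eventuallyEq_of_mem hN)
    ((comp_trans_eqOn u q p).eventuallyEq_of_mem hN)
    ((comp_trans_eqOn v q p).eventuallyEq_of_mem hN)

lemma Gam_eq {F : Type*} [NormedAddCommGroup F] [InnerProductSpace ℝ F]
    {x : M → E N} {u v : M → F} {p : M} {y : E n} (hy : y ∈ (ch n p).target)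
    (hx : DifferentiableAt ℝ (x ∘ (ch n p).symm) y)
    (hu : DifferentiableAt ℝ (u ∘ (ch n p).symm) y)
    (hv : DifferentiableAt ℝ (v ∘ (ch n p).symm) y) :
    Gam (n := n) x u v ((ch n p).symm y)
      = carre (param x p) (u ∘ (ch n p).symm) (v ∘ (ch n p).symm) y := by
  have h := carre_trans (x := x) (u := u) (v := v) (coord_mem_transDom hy)
  rw [trans_coord hy] at h
  exact h hx hu hv

end Charts

section Immersion

variable {n : ℕ} {M : Type*} [TopologicalSpace M] [ChartedSpace (E n) M] {x : M → E (n + 2)}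

lemma IsSphericalImmersion.inner_self (hx : IsSphericalImmersion (n := n) x) (p : M) :
    inner ℝ (x p) (x p) = (1 : ℝ) := by
  rw [real_inner_self_eq_norm_sq, hx.norm_eq_one, one_pow]

/-- The domain on which local data in the chart at `p` are seen in the chart at `q`. -/
def pullDom (q p : M) (U : Set (E n)) : Set (E n) := transDom n q p ∩ trans n q p ⁻¹' U

lemma coord_mem_pullDom {p : M} {U : Set (E n)} (hU : U ⊆ (ch n p).target) {y : E n} (hy : y ∈ U) :
    coord ((ch n p).symm y) ∈ pullDom ((ch n p).symm y) p U :=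
  ⟨coord_mem_transDom (hU hy), by rw [Set.mem_preimage, trans_coord (hU hy)]; exact hy⟩

variable [IsManifold (𝓡 n) ∞ M]

lemma IsSphericalImmersion.contDiffOn (hx : IsSphericalImmersion (n := n) x) (p : M) :
    ContDiffOn ℝ ∞ (param x p) (ch n p).target :=
  contDiffOn_chart hx.smooth p

lemma IsSphericalImmersion.injective_fderiv (hx : IsSphericalImmersion (n := n) x) (p : M)
    {y : E n} (hy : y ∈ (ch n p).target) : Function.Injective (fderiv ℝ (param x p) y) := by
  have h1 : MDifferentiableAt 𝓘(ℝ, E n) (𝓡 n) (ch n p).symm y :=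
    mdifferentiableAt_atlas_symm (chart_mem_atlas _ p) hy
  have h2 : MDifferentiableAt (𝓡 n) 𝓘(ℝ, E (n + 2)) x ((ch n p).symm y) :=
    hx.smooth.mdifferentiableAt (by simp)
  have e : mfderiv 𝓘(ℝ, E n) 𝓘(ℝ, E (n + 2)) (x ∘ (ch n p).symm) y
      = (mfderiv (𝓡 n) 𝓘(ℝ, E (n + 2)) x ((ch n p).symm y)).comp
        (mfderiv 𝓘(ℝ, E n) (𝓡 n) (ch n p).symm y) := mfderiv_comp y h2 h1
  rw [mfderiv_eq_fderiv] at e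
  change Function.Injective (fderiv ℝ (x ∘ (ch n p).symm) y)
  rw [e]
  have h3 : Function.Injective (mfderiv 𝓘(ℝ, E n) (𝓡 n) (ch n p).symm y) :=
    (mdifferentiable_chart (I := 𝓡 n) p).symm.mfderiv_injective hy
  exact (hx.immersive _).comp h3

lemma IsSphericalImmersion.isUnit_gram (hx : IsSphericalImmersion (n := n) x) (p : M) {y : E n}
    (hy : y ∈ (ch n p).target) : IsUnit (gram (param x p) y).det :=
  isUnit_gram_of_injective (hx.injective_fderiv p hy)

lemma carre_transfer {q p : M} {ν : E n → E (n + 2)} {U : Set (E n)}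
    (h : IsFramed (param x p) ν U) {F : Type*} [NormedAddCommGroup F] [InnerProductSpace ℝ F]
    {u v : E n → F} {z : E n} (hz : z ∈ pullDom q p U)
    (hu : DifferentiableAt ℝ u (trans n q p z)) (hv : DifferentiableAt ℝ v (trans n q p z)) :
    carre (param x q) (u ∘ trans n q p) (v ∘ trans n q p) z
      = carre (param x p) u v (trans n q p z) := by
  rw [← carre_comp (h.diff hz.2) hu hv (differentiableAt_of_contDiffOn (contDiffOn_trans q p)
    (isOpen_transDom q p) hz.1) (isUnit_jacobian_trans hz.1)]
  exact carre_congr ((comp_trans_eqOn x q p).eventuallyEq_of_mem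
    ((isOpen_transDom q p).mem_nhds hz.1)) Filter.EventuallyEq.rfl Filter.EventuallyEq.rfl

lemma IsFramed.transfer {p : M} {ν : E n → E (n + 2)} {U : Set (E n)}
    (h : IsFramed (param x p) ν U) (q : M) :
    IsFramed (param x q) (ν ∘ trans n q p) (pullDom q p U) := by
  have hVo : IsOpen (pullDom q p U) :=
    (contDiffOn_trans q p).continuousOn.isOpen_inter_preimage (isOpen_transDom q p) h.isOpen
  have h' := h.comp hVo ((contDiffOn_trans q p).mono Set.inter_subset_left) (fun z hz => hz.2)
    fun z hz => isUnit_jacobian_trans hz.1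
  have e : Set.EqOn (param x q) (param x p ∘ trans n q p) (pullDom q p U) :=
    (comp_trans_eqOn x q p).mono Set.inter_subset_left
  have epd : ∀ z ∈ pullDom q p U, ∀ i, pd i (param x q) z = pd i (param x p ∘ trans n q p) z :=
    fun z hz i => pd_congr_of_isOpen hVo hz e i
  refine ⟨hVo, h'.smooth.congr e, h'.smooth_normal, fun z hz => ?_, fun z hz => ?_,
    h'.normal_self, fun z hz => ?_, fun z hz i => ?_⟩
  · have : gram (param x q) z = gram (param x p ∘ trans n q p) z := by
      ext i j; simp only [gram, Matrix.of_apply, epd z hz]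
    rw [this]; exact h'.det z hz
  · rw [e hz]; exact h'.inner_self z hz
  · rw [e hz]; exact h'.inner_normal z hz
  · rw [epd z hz]; exact h'.pd_normal z hz i

lemma IsLocalHypersurface.transfer {p : M} {ν : E n → E (n + 2)} {U : Set (E n)}
    (h : IsLocalHypersurface (param x p) ν U) (q : M) :
    IsLocalHypersurface (param x q) (ν ∘ trans n q p) (pullDom q p U) where
  toIsFramed := h.toIsFramed.transfer q
  minimal z hz := by
    rw [← h.minimal _ hz.2, ← carre_transfer h.toIsFramed hz (h.diff_normal hz.2) (h.diff hz.2)]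
    exact carre_congr Filter.EventuallyEq.rfl Filter.EventuallyEq.rfl
      ((comp_trans_eqOn x q p).eventuallyEq_of_mem ((isOpen_transDom q p).mem_nhds hz.1))

/-- Around every point of the manifold there is a unit normal field, and the hypersurface is
minimal in the sense of local parametrizations. -/
theorem exists_local (hx : IsSphericalImmersion (n := n) x) (hmin : IsMinimal (n := n) x)
    (p : M) {y : E n} (hy : y ∈ (ch n p).target) : ∃ (ν : E n → E (n + 2)) (U : Set (E n)),
      y ∈ U ∧ U ⊆ (ch n p).target ∧ IsLocalHypersurface (param x p) ν U := by
  obtain ⟨ν, U, hp, hU, h⟩ := exists_isFramed (ch n p).open_target (hx.contDiffOn p)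
    (fun y hy => hx.isUnit_gram p hy) (fun y _ => hx.inner_self _) hy
  refine ⟨ν, U, hp, hU, h, fun y hy => ?_⟩
  -- minimality is known in the chart centred at the point under consideration
  set q := (ch n p).symm y with hq
  have hz : coord q ∈ pullDom q p U := coord_mem_pullDom hU hy
  have hτz : trans n q p (coord q) = y := trans_coord (hU hy)
  have hfr := h.transfer q
  have hc := carre_transfer h hz (h.diff_normal hz.2) (h.diff hz.2)
  rw [hτz] at hc
  have hc' : carre (param x q) (ν ∘ trans n q p) (param x q) (coord q)
      = carre (param x q) (ν ∘ trans n q p) (param x p ∘ trans n q p) (coord q) :=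
    carre_congr Filter.EventuallyEq.rfl Filter.EventuallyEq.rfl
      ((comp_trans_eqOn x q p).eventuallyEq_of_mem ((isOpen_transDom q p).mem_nhds hz.1))
  rw [← hc, ← hc', carre_normal_self, neg_eq_zero]
  have hm := hmin q
  simp only [hfr.secondFF_eq hz, smul_smul, ← Finset.sum_smul] at hm
  refine (smul_eq_zero.1 hm).resolve_right fun h0 => ?_
  have := hfr.normal_self _ hz
  rw [h0] at this
  simp at this

namespace IsLocalHypersurface

variable {p : M} {ν : E n → E (n + 2)} {U : Set (E n)} {y : E n}

lemma sqNormSFF_eq (h : IsLocalHypersurface (param x p) ν U) (hU : U ⊆ (ch n p).target)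
    (hy : y ∈ U) : sqNormSFF (n := n) x ((ch n p).symm y) = carre (param x p) ν ν y := by
  have hz := coord_mem_pullDom hU hy
  have hq := h.transfer ((ch n p).symm y)
  have hc := carre_transfer h.toIsFramed hz (h.diff_normal hz.2) (h.diff_normal hz.2)
  rw [trans_coord (hU hy)] at hc
  rw [← hc, hq.carre_normal_normal hz, sqNormSFF]
  refine Finset.sum_congr rfl fun i _ => Finset.sum_congr rfl fun j _ =>
    Finset.sum_congr rfl fun k _ => Finset.sum_congr rfl fun l _ => ?_
  rw [hq.secondFF_eq hz, hq.secondFF_eq hz, inner_smul_left, inner_smul_right,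
    hq.normal_self _ hz]
  simp

lemma scalar_coord_eq (h : IsLocalHypersurface (param x p) ν U) (hU : U ⊆ (ch n p).target)
    (hy : y ∈ U) : scalar (n := n) (param x ((ch n p).symm y)) (coord ((ch n p).symm y))
      = n * ((n : ℝ) - 1) - sqNormSFF (n := n) x ((ch n p).symm y) := by
  have hz := coord_mem_pullDom hU hy
  have hq := h.transfer ((ch n p).symm y)
  have hc := carre_transfer h.toIsFramed hz (h.diff_normal hz.2) (h.diff_normal hz.2)
  rw [trans_coord (hU hy)] at hc
  rw [hq.scalar_eq hz, h.sqNormSFF_eq hU hy, hc]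

lemma tracelessRicci_coord_eq (h : IsLocalHypersurface (param x p) ν U) (hn : 1 ≤ n)
    (hU : U ⊆ (ch n p).target) (hy : y ∈ U) (a : E (n + 2)) :
    tracelessRicci (n := n) (param x ((ch n p).symm y)) a (coord ((ch n p).symm y))
      = carre (param x p) ν ν y / n * carre (param x p) (fun z => inner ℝ (param x p z) a)
          (fun z => inner ℝ (param x p z) a) y
        - carre (param x p) (fun z => inner ℝ (ν z) a) (fun z => inner ℝ (ν z) a) y := by
  have hz := coord_mem_pullDom hU hy
  have hq := h.transfer ((ch n p).symm y)
  have hc := carre_transfer h.toIsFramed hz (h.diff_normal hz.2) (h.diff_normal hz.2)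
  have d1 := differentiableAt_of_contDiffOn (contDiffOn_inner_const h.smooth a) h.isOpen hz.2
  have d2 := differentiableAt_of_contDiffOn (contDiffOn_inner_const h.smooth_normal a)
    h.isOpen hz.2
  have hc1 := carre_transfer h.toIsFramed hz d1 d1
  have hc2 := carre_transfer h.toIsFramed hz d2 d2
  rw [trans_coord (hU hy)] at hc hc1 hc2
  rw [hq.tracelessRicci_eq hn hz, hc, ← hc1, ← hc2]
  congr 2
  have e : (fun z => inner ℝ (param x ((ch n p).symm y) z) a)
      =ᶠ[nhds (coord ((ch n p).symm y))]
      (fun z => inner ℝ (param x p z) a) ∘ trans n ((ch n p).symm y) p :=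
    (comp_trans_eqOn (fun q => inner ℝ (x q) a) _ p).eventuallyEq_of_mem
      ((isOpen_transDom _ p).mem_nhds hz.1)
  exact carre_congr Filter.EventuallyEq.rfl e e

/-- Where the second fundamental form has length zero, the unit normal is stationary. -/
lemma pd_normal_eq_zero {f ν : E n → E (n + 2)} {U : Set (E n)} {y : E n}
    (h : IsLocalHypersurface f ν U) (hy : y ∈ U) (h0 : carre f ν ν y = 0) (k : Fin n) :
    pd k ν y = 0 := by
  obtain ⟨τ, V, hτ0, hτ, hτm, hJ, hA⟩ := h.exists_isAdapted hy
  have dτ : DifferentiableAt ℝ τ 0 := hτ.differentiable (by simp) 0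
  have h1 : carre (f ∘ τ) (ν ∘ τ) (ν ∘ τ) 0 = 0 := by
    rw [carre_comp (h.diff (hτm hA.mem)) (h.diff_normal (hτm hA.mem)) (h.diff_normal (hτm hA.mem))
      dτ (hJ 0 hA.mem), hτ0, h0]
  rw [hA.carre_normal] at h1
  have h2 : ∀ i j, sff (f ∘ τ) (ν ∘ τ) i j 0 = 0 := by
    intro i j
    have := (Finset.sum_eq_zero_iff_of_nonneg fun i _ => Finset.sum_nonneg fun j _ =>
      sq_nonneg (sff (f ∘ τ) (ν ∘ τ) i j 0)).1 h1 i (Finset.mem_univ _)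
    have := (Finset.sum_eq_zero_iff_of_nonneg fun j _ =>
      sq_nonneg (sff (f ∘ τ) (ν ∘ τ) i j 0)).1 this j (Finset.mem_univ _)
    exact pow_eq_zero_iff two_ne_zero |>.1 this
  have h3 : ∀ k, pd k (ν ∘ τ) 0 = 0 := by
    intro k
    rw [hA.pd_normal_zero]
    simp [h2]
  rw [← hτ0]
  exact pd_eq_zero_of_comp (h.diff_normal (hτm hA.mem)) dτ (hJ 0 hA.mem) h3 k

end IsLocalHypersurface

lemma isTotallyGeodesic_iff (hx : IsSphericalImmersion (n := n) x)
    (hmin : IsMinimal (n := n) x) :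
    IsTotallyGeodesic (n := n) x ↔ ∀ q, sqNormSFF (n := n) x q = 0 := by
  constructor
  · intro h q
    simp [sqNormSFF, h q]
  · intro h q i j
    obtain ⟨ν, U, hy, hU, hL⟩ := exists_local hx hmin q (coord_mem_target q)
    have := hL.sqNormSFF_eq hU hy
    rw [ch_symm_coord, h q] at this
    rw [hL.secondFF_eq hy, sff, hL.pd_normal_eq_zero hy this.symm]
    simp

end Immersion

/-! ### The divergence theorem in a chart -/

/-- The determinant as a function of the entries. -/
def detFun (n : ℕ) (A : Fin n → Fin n → ℝ) : ℝ := (Matrix.of A).det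

lemma differentiable_detFun (n : ℕ) : Differentiable ℝ (detFun n) := by
  have : detFun n = fun A : Fin n → Fin n → ℝ =>
      ∑ σ : Equiv.Perm (Fin n), ((Equiv.Perm.sign σ : ℤ) : ℝ) * ∏ i, A (σ i) i := by
    ext A; simp [detFun, Matrix.det_apply']
  rw [this]
  fun_prop

lemma fderiv_detFun_one {n : ℕ} (M : Matrix (Fin n) (Fin n) ℝ) :
    fderiv ℝ (detFun n) (1 : Matrix (Fin n) (Fin n) ℝ) M = M.trace := by
  have h1 : HasDerivAt (fun r : ℝ => (fun i j => (1 : Matrix (Fin n) (Fin n) ℝ) i j + r * M i j :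
      Fin n → Fin n → ℝ)) (fun i j => M i j) 0 := by
    refine hasDerivAt_pi.2 fun i => hasDerivAt_pi.2 fun j => ?_
    simpa using ((hasDerivAt_id (0 : ℝ)).mul_const (M i j)).const_add
      ((1 : Matrix (Fin n) (Fin n) ℝ) i j)
  have h2 : HasFDerivAt (detFun n) (fderiv ℝ (detFun n) (1 : Matrix (Fin n) (Fin n) ℝ))
      (fun i j => (1 : Matrix (Fin n) (Fin n) ℝ) i j + 0 * M i j : Fin n → Fin n → ℝ) := by
    simpa using (differentiable_detFun n (1 : Matrix (Fin n) (Fin n) ℝ)).hasFDerivAt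
  have h3 := h2.comp_hasDerivAt (0 : ℝ) h1
  have h4 : HasDerivAt (fun r : ℝ => ((1 : Matrix (Fin n) (Fin n) ℝ) + r • M).det) M.trace 0 := by
    have hp := ((Polynomial.hasDerivAt (Matrix.det (1 + (Polynomial.X : Polynomial ℝ) •
      M.map (Polynomial.C))).divX.divX (0 : ℝ))).mul ((hasDerivAt_id (0 : ℝ)).pow 2)
    have h := (((hasDerivAt_id (0 : ℝ)).const_mul M.trace).const_add 1).add hp
    have e : M.trace = M.trace * 1 + (Polynomial.eval 0 (Polynomial.derivative (Matrix.det
        (1 + (Polynomial.X : Polynomial ℝ) • M.map (Polynomial.C))).divX.divX) * (id ^ 2) (0 : ℝ)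
      + Polynomial.eval 0 (Matrix.det (1 + (Polynomial.X : Polynomial ℝ) •
          M.map (Polynomial.C))).divX.divX * (((2 : ℕ) : ℝ) * id (0 : ℝ) ^ (2 - 1) * 1)) := by
      simp
    rw [e]
    refine h.congr_of_eventuallyEq (Filter.Eventually.of_forall fun r => ?_)
    exact Matrix.det_one_add_smul r M
  have h5 : (detFun n ∘ fun r : ℝ => (fun i j => (1 : Matrix (Fin n) (Fin n) ℝ) i j + r * M i j :
      Fin n → Fin n → ℝ)) = fun r : ℝ => ((1 : Matrix (Fin n) (Fin n) ℝ) + r • M).det := by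
    ext r; rfl
  rw [h5] at h3
  exact h3.unique h4

/-- Jacobi's formula for the derivative of a determinant. -/
lemma pd_det {n m : ℕ} {A : E m → Matrix (Fin n) (Fin n) ℝ} {y : E m}
    (hA : ∀ i j, DifferentiableAt ℝ (fun z => A z i j) y) (hd : IsUnit (A y).det) (k : Fin m) :
    pd k (fun z => (A z).det) y
      = (A y).det * ∑ i, ∑ j, (A y)⁻¹ i j * pd k (fun z => A z j i) y := by
  set B : E m → Fin n → Fin n → ℝ := fun z i j => ∑ l, (A y)⁻¹ i l * A z l j with hB
  have hBd : HasFDerivAt B (fderiv ℝ B y) y := by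
    refine DifferentiableAt.hasFDerivAt ?_
    refine differentiableAt_pi.2 fun i => differentiableAt_pi.2 fun j => ?_
    exact DifferentiableAt.fun_sum fun l _ => (hA l j).const_mul _
  have hBm : ∀ z, Matrix.of (B z) = (A y)⁻¹ * A z := fun z => rfl
  have hB1 : B y = (1 : Matrix (Fin n) (Fin n) ℝ) :=
    (hBm y).trans (Matrix.nonsing_inv_mul _ hd)
  have hdet : (fun z => (A z).det) = fun z => (A y).det * detFun n (B z) := by
    ext z
    rw [detFun, hBm, Matrix.det_mul, ← mul_assoc, ← Matrix.det_mul, Matrix.mul_nonsing_inv _ hd,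
      Matrix.det_one, one_mul]
  have hc : HasFDerivAt (fun z => detFun n (B z))
      ((fderiv ℝ (detFun n) (B y)).comp (fderiv ℝ B y)) y :=
    ((differentiable_detFun n (B y)).hasFDerivAt).comp y hBd
  have hpdB : fderiv ℝ B y (EuclideanSpace.single k 1)
      = Matrix.of fun i j => ∑ l, (A y)⁻¹ i l * pd k (fun z => A z l j) y := by
    ext i j
    have h1 := (hasFDerivAt_pi'.1 (hasFDerivAt_pi'.1 hBd i) j).fderiv
    have h2 : pd k (fun z => B z i j) y = ∑ l, (A y)⁻¹ i l * pd k (fun z => A z l j) y := by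
      rw [pd_sum fun l _ => (hA l j).const_mul _]
      exact Finset.sum_congr rfl fun l _ => pd_const_mul _ (hA l j) k
    rw [Matrix.of_apply, ← h2, pd, h1]; rfl
  rw [hdet, pd_const_mul _ hc.differentiableAt, pd, hc.fderiv, ContinuousLinearMap.comp_apply,
    hpdB, hB1, fderiv_detFun_one]
  rfl

section Divergence

variable {n N : ℕ} {f X : E n → E N} {U : Set (E n)}

/-- The contravariant components of a tangent field. -/
def contra (f X : E n → E N) (i : Fin n) (y : E n) : ℝ :=
  ∑ j, (gram f y)⁻¹ j i * inner ℝ (pd j f y) (X y)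

lemma raise_eq_sum_contra (y : E n) :
    raise f y (fun i => inner ℝ (pd i f y) (X y)) = ∑ i, contra f X i y • pd i f y := by
  simp only [raise, contra, Finset.sum_smul]
  exact Finset.sum_comm

lemma contDiffOn_contra (hU : IsOpen U) (hf : ContDiffOn ℝ ∞ f U)
    (hd : ∀ y ∈ U, IsUnit (gram f y).det) (hX : ContDiffOn ℝ ∞ X U) (i : Fin n) :
    ContDiffOn ℝ ∞ (contra f X i) U :=
  ContDiffOn.sum fun j _ => (contDiffOn_inv_entry (contDiffOn_gram hf hU) hd j i).mul
    ((contDiffOn_pd hf hU j).inner ℝ hX)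

lemma gram_posSemidef (f : E n → E N) (y : E n) : (gram f y).PosSemidef := by
  refine Matrix.PosSemidef.of_dotProduct_mulVec_nonneg ?_ fun v => ?_
  · ext i j; simp [gram, real_inner_comm]
  · have : inner ℝ (∑ i, v i • pd i f y) (∑ i, v i • pd i f y)
        = dotProduct (star v) ((gram f y).mulVec v) := by
      simp only [sum_inner, inner_sum, inner_smul_left, inner_smul_right, Matrix.mulVec,
        dotProduct, gram, Matrix.of_apply, Finset.mul_sum, RCLike.conj_to_real, Pi.star_apply,
        star_trivial]
      refine Finset.sum_congr rfl fun i _ => Finset.sum_congr rfl fun j _ => ?_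
      rw [real_inner_comm]; ring
    rw [← this]
    exact real_inner_self_nonneg

lemma gram_det_pos (f : E n → E N) {y : E n} (hd : IsUnit (gram f y).det) :
    0 < (gram f y).det :=
  lt_of_le_of_ne (gram_posSemidef f y).det_nonneg (Ne.symm hd.ne_zero)

lemma contDiffOn_sqrt_det (hU : IsOpen U) (hf : ContDiffOn ℝ ∞ f U)
    (hd : ∀ y ∈ U, IsUnit (gram f y).det) :
    ContDiffOn ℝ ∞ (fun y => Real.sqrt (gram f y).det) U :=
  (contDiffOn_det (contDiffOn_gram hf hU)).sqrt fun y hy => (hd y hy).ne_zero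

/-- The bracket of a tangent field with the position vector is its Riemannian divergence. -/
lemma sqrt_det_mul_carre (hU : IsOpen U) (hf : ContDiffOn ℝ ∞ f U)
    (hd : ∀ y ∈ U, IsUnit (gram f y).det) (hX : ContDiffOn ℝ ∞ X U)
    (hT : ∀ y ∈ U, X y = raise f y fun i => inner ℝ (pd i f y) (X y)) {y : E n} (hy : y ∈ U) :
    Real.sqrt (gram f y).det * carre f X f y
      = ∑ i, pd i (fun z => Real.sqrt (gram f z).det * contra f X i z) y := by
  have hg := contDiffOn_gram hf hU
  have dg := fun i j => differentiableAt_of_contDiffOn (hg i j) hU hy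
  have dc := fun i => differentiableAt_of_contDiffOn (contDiffOn_contra hU hf hd hX i) hU hy
  have dp := fun i => differentiableAt_of_contDiffOn (contDiffOn_pd hf hU i) hU hy
  have ds := differentiableAt_of_contDiffOn (contDiffOn_sqrt_det hU hf hd) hU hy
  have hpos := gram_det_pos f (hd y hy)
  have hs := Real.sqrt_pos.2 hpos
  set s := Real.sqrt (gram f y).det with hsdef
  -- half of the logarithmic derivative of the determinant
  set L : Fin n → ℝ := fun k => ∑ i, ∑ j, (gram f y)⁻¹ i j * inner ℝ (pd i (pd k f) y) (pd j f y)
    with hL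
  have hdg : ∀ k i j, pd k (fun z => gram f z i j) y
      = inner ℝ (pd i (pd k f) y) (pd j f y) + inner ℝ (pd j (pd k f) y) (pd i f y) := by
    intro k i j
    change pd k (fun z => inner ℝ (pd i f z) (pd j f z)) y = _
    rw [pd_inner (dp i) (dp j), pd_comm hf hU hy k i, pd_comm hf hU hy k j,
      real_inner_comm (pd i f y)]
  have hlog : ∀ k, pd k (fun z => Real.sqrt (gram f z).det) y = s * L k := by
    intro k
    have h1 : pd k (fun z => (gram f z).det) y = (gram f y).det * (2 * L k) := by
      rw [pd_det dg (hd y hy)]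
      congr 1
      rw [two_mul]
      simp only [hL]
      nth_rewrite 2 [Finset.sum_comm]
      rw [← Finset.sum_add_distrib]
      refine Finset.sum_congr rfl fun i _ => ?_
      rw [← Finset.sum_add_distrib]
      refine Finset.sum_congr rfl fun j _ => ?_
      rw [hdg, gram_inv_symm f y j i]; ring
    have h2 : ((gram f y).det) = s * s := (Real.mul_self_sqrt hpos.le).symm
    have h3 : pd k (fun z => (gram f z).det) y
        = 2 * s * pd k (fun z => Real.sqrt (gram f z).det) y := by
      have : pd k (fun z => (gram f z).det) y
          = pd k (fun z => Real.sqrt (gram f z).det * Real.sqrt (gram f z).det) y :=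
        pd_congr_of_isOpen hU hy (fun z hz =>
          (Real.mul_self_sqrt (gram_det_pos f (hd z hz)).le).symm) k
      rw [this, pd_mul ds ds]; ring
    rw [h1, h2] at h3
    have : s ≠ 0 := hs.ne'
    apply mul_left_cancel₀ (mul_ne_zero two_ne_zero this)
    linarith
  have hXe : Set.EqOn X (fun z => ∑ i, contra f X i z • pd i f z) U := fun z hz =>
    (hT z hz).trans (raise_eq_sum_contra z)
  have hpX : ∀ i, pd i X y
      = ∑ k, (pd i (contra f X k) y • pd k f y + contra f X k y • pd i (pd k f) y) := by
    intro i
    rw [pd_congr_of_isOpen hU hy hXe i, pd_sum fun k _ => (dc k).fun_smul (dp k)]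
    exact Finset.sum_congr rfl fun k _ => pd_smul (dc k) (dp k) i
  have hcar : carre f X f y = ∑ k, (pd k (contra f X k) y + contra f X k y * L k) := by
    have e : carre f X f y = ∑ k, ((∑ i, pd i (contra f X k) y *
        ∑ j, (gram f y)⁻¹ i j * gram f y j k) + contra f X k y * L k) := by
      simp only [carre, hpX, sum_inner, inner_add_left, inner_smul_left, RCLike.conj_to_real, hL,
        Finset.mul_sum, ← Finset.sum_add_distrib]
      conv_lhs => enter [2, i]; rw [Finset.sum_comm]
      rw [Finset.sum_comm]
      refine Finset.sum_congr rfl fun k _ => Finset.sum_congr rfl fun i _ =>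
        Finset.sum_congr rfl fun j _ => ?_
      simp only [gram, Matrix.of_apply, real_inner_comm (pd j f y) (pd k f y)]
      ring
    rw [e]
    refine Finset.sum_congr rfl fun k _ => ?_
    congr 1
    have : ∀ i, ∑ j, (gram f y)⁻¹ i j * gram f y j k = if i = k then 1 else 0 := by
      intro i
      rw [← Matrix.mul_apply, Matrix.nonsing_inv_mul _ (hd y hy), Matrix.one_apply]
    simp [this]
  rw [hcar, Finset.mul_sum]
  refine Finset.sum_congr rfl fun k _ => ?_
  rw [pd_mul ds (dc k), hlog]; ring

/-- The integral of a partial derivative of a compactly supported function vanishes. -/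
lemma integral_pd_eq_zero {V : E n → ℝ} (hV : ContDiff ℝ ∞ V) (hc : HasCompactSupport V)
    (i : Fin n) : ∫ y, pd i V y = 0 := by
  have hV' : Continuous (fderiv ℝ V) := hV.continuous_fderiv (by simp)
  have := integral_mul_fderiv_eq_neg_fderiv_mul_of_integrable (μ := (volume : Measure (E n)))
    (f := fun _ => (1 : ℝ)) (g := V) (v := EuclideanSpace.single i 1)
    (by simp) (by
      simp only [one_mul]
      refine Continuous.integrable_of_hasCompactSupport (hV'.clm_apply continuous_const) ?_
      exact hc.fderiv_apply ℝ _)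
    (by simpa using hV.continuous.integrable_of_hasCompactSupport hc)
    (fun x _ => differentiableAt_const _)
    (fun x _ => hV.differentiable (by simp) x)
  simpa [pd] using this

/-- The divergence theorem for a tangent field with compact support inside a chart. -/
lemma integral_divergence_eq_zero (hU : IsOpen U) (hf : ContDiffOn ℝ ∞ f U)
    (hd : ∀ y ∈ U, IsUnit (gram f y).det) (hX : ContDiffOn ℝ ∞ X U)
    (hT : ∀ y ∈ U, X y = raise f y fun i => inner ℝ (pd i f y) (X y))
    {K : Set (E n)} (hK : IsCompact K) (hKU : K ⊆ U) (hXK : ∀ y ∈ U \ K, X y = 0) :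
    ∫ y in U, Real.sqrt (gram f y).det * carre f X f y = 0 := by
  set W : Fin n → E n → ℝ := fun i z => Real.sqrt (gram f z).det * contra f X i z with hW
  -- extended by zero, the components are smooth on the whole space since they vanish off `K`
  set V : Fin n → E n → ℝ := fun i => U.indicator (W i) with hVdef
  have hV0 : ∀ i, ∀ y ∉ K, V i y = 0 := by
    intro i y hy
    by_cases hyU : y ∈ U
    · simp [hVdef, hyU, hW, contra, hXK y ⟨hyU, hy⟩]
    · simp [hVdef, hyU]
  have hVU : ∀ i, Set.EqOn (V i) (W i) U := fun i y hy => Set.indicator_of_mem hy _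
  have hVs : ∀ i, ContDiff ℝ ∞ (V i) := by
    intro i
    refine contDiff_iff_contDiffAt.2 fun y => ?_
    by_cases hy : y ∈ K
    · have h1 : ContDiffOn ℝ ∞ (W i) U :=
        (contDiffOn_sqrt_det hU hf hd).mul (contDiffOn_contra hU hf hd hX i)
      exact (h1.contDiffAt (hU.mem_nhds (hKU hy))).congr_of_eventuallyEq
        ((hVU i).eventuallyEq_of_mem (hU.mem_nhds (hKU hy)))
    · have : V i =ᶠ[nhds y] fun _ => 0 := by
        filter_upwards [hK.isClosed.isOpen_compl.mem_nhds hy] with z hz using hV0 i z hz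
      exact contDiffAt_const.congr_of_eventuallyEq this
  have hVc : ∀ i, HasCompactSupport (V i) := fun i => HasCompactSupport.intro hK (hV0 i)
  have e : ∀ y, U.indicator (fun y => Real.sqrt (gram f y).det * carre f X f y) y
      = ∑ i, pd i (V i) y := by
    intro y
    by_cases hy : y ∈ U
    · rw [Set.indicator_of_mem hy, sqrt_det_mul_carre hU hf hd hX hT hy]
      exact Finset.sum_congr rfl fun i _ => (pd_congr_of_isOpen hU hy (hVU i) i).symm
    · rw [Set.indicator_of_notMem hy]
      refine (Finset.sum_eq_zero fun i _ => ?_).symm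
      have : V i =ᶠ[nhds y] fun _ => 0 := by
        filter_upwards [hK.isClosed.isOpen_compl.mem_nhds fun h => hy (hKU h)] with z hz
          using hV0 i z hz
      rw [pd_congr this, pd_const]
  rw [← integral_indicator hU.measurableSet]
  simp_rw [e]
  rw [integral_finsetSum]
  · exact Finset.sum_eq_zero fun i _ => integral_pd_eq_zero (hVs i) (hVc i) i
  · intro i _
    refine Continuous.integrable_of_hasCompactSupport
      (((hVs i).continuous_fderiv (by simp)).clm_apply continuous_const) ?_
    exact (hVc i).fderiv_apply ℝ _

end Divergence

/-! ### The volume measure and the divergence theorem on the manifold -/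

lemma det_fderiv_eq_det_jacobian {n : ℕ} (τ : E n → E n) (z : E n) :
    (fderiv ℝ τ z).det = (jacobian τ z).det := by
  rw [ContinuousLinearMap.det, ← LinearMap.det_toMatrix (EuclideanSpace.basisFun (Fin n) ℝ).toBasis]
  congr 1

section Partition

variable {n : ℕ} {M : Type*} [TopologicalSpace M] [ChartedSpace (E n) M] [IsManifold (𝓡 n) ∞ M]

lemma continuousOn_sqrt_det {x : M → E (n + 2)} (hx : IsSphericalImmersion (n := n) x) (p : M) :
    ContinuousOn (fun y => Real.sqrt (gram (param x p) y).det) (ch n p).target :=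
  (contDiffOn_sqrt_det (ch n p).open_target (hx.contDiffOn p)
    fun _ hy => hx.isUnit_gram p hy).continuousOn

variable [T2Space M] [CompactSpace M]

lemma chartPartition_subordinate (n : ℕ) (M : Type*) [TopologicalSpace M] [ChartedSpace (E n) M]
    [IsManifold (𝓡 n) ∞ M] [T2Space M] [CompactSpace M] (p : M) :
    tsupport (chartPartition n M p) ⊆ (ch n p).source :=
  (SmoothPartitionOfUnity.exists_isSubordinate_chartAt_source (𝓡 n) M).choose_spec p

/-- The indices of the members of the partition of unity that are not identically zero. -/
def activeIndices (n : ℕ) (M : Type*) [TopologicalSpace M] [ChartedSpace (E n) M]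
    [IsManifold (𝓡 n) ∞ M] [T2Space M] [CompactSpace M] : Finset M :=
  ((chartPartition n M).locallyFinite.finite_nonempty_of_compact).toFinset

lemma chartPartition_eq_zero {p : M} (hp : p ∉ activeIndices n M) (q : M) :
    chartPartition n M p q = 0 := by
  by_contra h
  exact hp ((Set.Finite.mem_toFinset _).2 ⟨q, h⟩)

lemma sum_chartPartition (q : M) : ∑ p ∈ activeIndices n M, chartPartition n M p q = 1 := by
  rw [← (chartPartition n M).sum_eq_one (Set.mem_univ q)]
  refine (finsum_eq_sum_of_support_subset _ fun p hp => ?_).symm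
  by_contra h
  exact hp (chartPartition_eq_zero h q)

end Partition

section Volume

variable {n : ℕ} {M : Type*} [TopologicalSpace M] [ChartedSpace (E n) M]
  [MeasurableSpace M] [BorelSpace M] {x : M → E (n + 2)}

lemma aemeasurable_ch_symm (p : M) :
    AEMeasurable (ch n p).symm ((volume : Measure (E n)).restrict (ch n p).target) :=
  (ch n p).continuousOn_symm.aemeasurable (ch n p).open_target.measurableSet

lemma measurableSet_target_inter (p : M) {A : Set M} (hA : MeasurableSet A) :
    MeasurableSet ((ch n p).target ∩ (ch n p).symm ⁻¹' A) := by
  have h1 : Measurable ((ch n p).target.domRestrict (ch n p).symm) :=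
    (continuousOn_iff_continuous_domRestrict.1 (ch n p).continuousOn_symm).measurable
  have h2 := (ch n p).open_target.measurableSet.subtype_image (h1 hA)
  convert h2 using 1
  ext y
  constructor
  · rintro ⟨hy, h⟩
    exact ⟨⟨y, hy⟩, h, rfl⟩
  · rintro ⟨⟨z, hz⟩, h, rfl⟩
    exact ⟨hz, h⟩

lemma chartMeasure_apply (x : M → E (n + 2)) (p : M) {A : Set M} (hA : MeasurableSet A) :
    chartMeasure (n := n) x p A = ∫⁻ y in (ch n p).target ∩ (ch n p).symm ⁻¹' A,
      ENNReal.ofReal (Real.sqrt (gram (param x p) y).det) := by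
  rw [chartMeasure, Measure.map_apply_of_aemeasurable
    ((aemeasurable_ch_symm p).mono_ac (withDensity_absolutelyContinuous _ _)) hA,
    withDensity_apply', Measure.restrict_restrict' (ch n p).open_target.measurableSet,
    Set.inter_comm]

lemma chartMeasure_inter_source (p : M) {A : Set M} (hA : MeasurableSet A) :
    chartMeasure (n := n) x p (A ∩ (ch n p).source) = chartMeasure (n := n) x p A := by
  rw [chartMeasure_apply x p (hA.inter (ch n p).open_source.measurableSet),
    chartMeasure_apply x p hA]
  congr 2
  ext y
  simp only [Set.mem_inter_iff, Set.mem_preimage]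
  constructor
  · rintro ⟨h1, h2, -⟩
    exact ⟨h1, h2⟩
  · rintro ⟨h1, h2⟩
    exact ⟨h1, h2, (ch n p).map_target h1⟩

variable [IsManifold (𝓡 n) ∞ M]

/-- The chart measures agree on the overlap of charts. -/
lemma chartMeasure_congr (hx : IsSphericalImmersion (n := n) x) (p q : M) {A : Set M}
    (hA : MeasurableSet A) (hp : A ⊆ (ch n p).source) (hq : A ⊆ (ch n q).source) :
    chartMeasure (n := n) x p A = chartMeasure (n := n) x q A := by
  rw [chartMeasure_apply x p hA, chartMeasure_apply x q hA]
  set B := (ch n q).target ∩ (ch n q).symm ⁻¹' A with hB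
  have hBD : B ⊆ transDom n q p := fun z hz => ⟨hz.1, hp hz.2⟩
  have himg : (ch n p).target ∩ (ch n p).symm ⁻¹' A = trans n q p '' B := by
    ext y
    constructor
    · rintro ⟨h1, h2⟩
      have hy : y ∈ transDom n p q := ⟨h1, hq h2⟩
      refine ⟨trans n p q y, ⟨(trans_mapsTo p q hy).1, ?_⟩, trans_trans hy⟩
      rw [Set.mem_preimage, symm_trans hy]; exact h2
    · rintro ⟨z, hz, rfl⟩
      refine ⟨(trans_mapsTo q p (hBD hz)).1, ?_⟩
      rw [Set.mem_preimage, symm_trans (hBD hz)]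
      exact hz.2
  have hinj : Set.InjOn (trans n q p) B := by
    intro z hz w hw h
    rw [← trans_trans (hBD hz), h, trans_trans (hBD hw)]
  have hdiff := fun z (hz : z ∈ B) =>
    differentiableAt_of_contDiffOn (contDiffOn_trans q p) (isOpen_transDom q p) (hBD hz)
  -- change of variables; the Jacobian determinant is absorbed by `√(det g)`
  rw [himg, lintegral_image_eq_lintegral_abs_det_fderiv_mul volume
    (measurableSet_target_inter q hA) (fun z hz => (hdiff z hz).hasFDerivAt.hasFDerivWithinAt) hinj]
  refine setLIntegral_congr_fun (measurableSet_target_inter q hA) fun z hz => ?_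
  have hz' := hBD hz
  have dx := differentiableAt_of_contDiffOn (hx.contDiffOn p) (ch n p).open_target
    (trans_mapsTo q p hz').1
  have hg : gram (param x q) z = gram (param x p ∘ trans n q p) z := by
    ext i j
    simp only [gram, Matrix.of_apply]
    have e : Set.EqOn (param x q) (param x p ∘ trans n q p) (transDom n q p) :=
      comp_trans_eqOn x q p
    rw [pd_congr_of_isOpen (isOpen_transDom q p) hz' e i,
      pd_congr_of_isOpen (isOpen_transDom q p) hz' e j]
  beta_reduce
  rw [hg, gram_comp dx (hdiff z hz), Matrix.det_mul, Matrix.det_mul, Matrix.det_transpose,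
    det_fderiv_eq_det_jacobian, ← ENNReal.ofReal_mul (abs_nonneg _)]
  congr 1
  rw [mul_right_comm, Real.sqrt_mul (mul_self_nonneg _), Real.sqrt_mul_self_eq_abs]

variable [T2Space M] [CompactSpace M]

lemma measurable_chartPartition (p : M) :
    Measurable fun q => ENNReal.ofReal (chartPartition n M p q) :=
  ENNReal.measurable_ofReal.comp (chartPartition n M p).contMDiff.continuous.measurable

/-- Inside the domain of a chart the volume is the measure of that chart. -/
lemma vol_restrict_source (hx : IsSphericalImmersion (n := n) x) (q : M) :
    (vol (n := n) x).restrict (ch n q).source = chartMeasure (n := n) x q := by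
  ext A hA
  set A' := A ∩ (ch n q).source with hA'
  have hA'm : MeasurableSet A' := hA.inter (ch n q).open_source.measurableSet
  rw [Measure.restrict_apply hA, ← chartMeasure_inter_source q hA, vol,
    Measure.sum_apply _ hA'm, tsum_eq_sum (s := activeIndices n M)]
  · have h1 : ∀ p, (chartMeasure (n := n) x p).withDensity
        (fun q => ENNReal.ofReal (chartPartition n M p q)) A'
          = ∫⁻ r in A', ENNReal.ofReal (chartPartition n M p r) ∂(chartMeasure (n := n) x q) := by
      intro p
      have hs := (ch n p).open_source.measurableSet
      -- the weight of index `p` is supported in the chart of `p`, where the two measures agree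
      have hr : (chartMeasure (n := n) x p).restrict (A' ∩ (ch n p).source)
          = (chartMeasure (n := n) x q).restrict (A' ∩ (ch n p).source) := by
        ext B hB
        rw [Measure.restrict_apply hB, Measure.restrict_apply hB]
        exact chartMeasure_congr hx p q (hB.inter (hA'm.inter hs)) (fun r hr => hr.2.2)
          fun r hr => hr.2.1.2
      have hz : ∀ μ : Measure M, ∫⁻ r in A', ENNReal.ofReal (chartPartition n M p r) ∂μ
          = ∫⁻ r in A' ∩ (ch n p).source, ENNReal.ofReal (chartPartition n M p r) ∂μ := by
        intro μ
        rw [← lintegral_indicator hA'm, ← lintegral_indicator (hA'm.inter hs)]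
        refine lintegral_congr fun r => ?_
        by_cases h1 : r ∈ A' <;> by_cases h2 : r ∈ (ch n p).source <;>
          simp only [Set.indicator, Set.mem_inter_iff, h1, h2, and_true, and_false, if_true,
            if_false]
        have : chartPartition n M p r = 0 := by
          by_contra h
          exact h2 (chartPartition_subordinate n M p (subset_tsupport _ h))
        rw [this, ENNReal.ofReal_zero]
      rw [withDensity_apply _ hA'm, hz, hr, ← hz]
    simp only [h1]
    rw [← lintegral_finsetSum _ fun p _ => measurable_chartPartition p]
    have : ∀ r, ∑ p ∈ activeIndices n M, ENNReal.ofReal (chartPartition n M p r) = 1 := by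
      intro r
      rw [← ENNReal.ofReal_sum_of_nonneg fun p _ => (chartPartition n M).nonneg p r,
        sum_chartPartition, ENNReal.ofReal_one]
    simp [this, hA']
  · intro p hp
    simp [chartPartition_eq_zero hp]

lemma isFiniteMeasure_vol (hx : IsSphericalImmersion (n := n) x) :
    IsFiniteMeasure (vol (n := n) x) := by
  have : IsLocallyFiniteMeasure (vol (n := n) x) := by
    refine ⟨fun p => ?_⟩
    obtain ⟨K, hK, hKn, hKt⟩ := exists_compact_subset (ch n p).open_target (coord_mem_target p)
    have hW : (ch n p).source ∩ (ch n p) ⁻¹' (interior K) ∈ nhds p :=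
      ((ch n p).isOpen_inter_preimage isOpen_interior).mem_nhds ⟨mem_chart_source _ p, hKn⟩
    have hWm := ((ch n p).isOpen_inter_preimage (isOpen_interior (s := K))).measurableSet
    refine ⟨_, hW, ?_⟩
    set W := (ch n p).source ∩ (ch n p) ⁻¹' (interior K) with hWdef
    have e : vol (n := n) x W = chartMeasure (n := n) x p W := by
      rw [← vol_restrict_source hx p, Measure.restrict_apply hWm]
      congr 1
      exact (Set.inter_eq_left.2 Set.inter_subset_left).symm
    rw [e, chartMeasure_apply x p hWm]
    refine lt_of_le_of_lt (lintegral_mono_set (t := K) ?_) ?_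
    · rintro y ⟨h1, h2⟩
      have := h2.2
      rw [Set.mem_preimage, (ch n p).right_inv h1] at this
      exact interior_subset this
    · obtain ⟨C, hC⟩ := hK.exists_bound_of_continuousOn ((continuousOn_sqrt_det hx p).mono hKt)
      calc _ ≤ ∫⁻ _ in K, ENNReal.ofReal C := by
            refine setLIntegral_mono' hK.measurableSet fun y hy => ?_
            exact ENNReal.ofReal_le_ofReal ((le_abs_self _).trans (hC y hy))
        _ < ⊤ := by
            rw [setLIntegral_const]
            exact ENNReal.mul_lt_top ENNReal.ofReal_lt_top hK.measure_lt_top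
  exact CompactSpace.isFiniteMeasure

lemma isOpenPosMeasure_vol (hx : IsSphericalImmersion (n := n) x) :
    (vol (n := n) x).IsOpenPosMeasure := by
  refine ⟨fun W hW ⟨p, hp⟩ h0 => ?_⟩
  have h1 : chartMeasure (n := n) x p W = 0 := by
    rw [← vol_restrict_source hx p]
    exact Measure.restrict_le_self.absolutelyContinuous h0
  rw [chartMeasure_apply x p hW.measurableSet, lintegral_eq_zero_iff'] at h1
  · have hD : IsOpen ((ch n p).target ∩ (ch n p).symm ⁻¹' W) :=
      (ch n p).symm.isOpen_inter_preimage hW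
    have hpos : 0 < (volume : Measure (E n)) ((ch n p).target ∩ (ch n p).symm ⁻¹' W) :=
      hD.measure_pos _ ⟨coord p, coord_mem_target p, by
        rw [Set.mem_preimage, ch_symm_coord]; exact hp⟩
    have h2 : ∀ᵐ y ∂((volume : Measure (E n)).restrict
        ((ch n p).target ∩ (ch n p).symm ⁻¹' W)), False := by
      filter_upwards [h1, ae_restrict_mem hD.measurableSet] with y hy hyD
      have := Real.sqrt_pos.2 (gram_det_pos _ (hx.isUnit_gram p hyD.1))
      exact (ENNReal.ofReal_pos.2 this).ne' hy
    rw [Filter.eventually_false_iff_eq_bot, ae_eq_bot, Measure.restrict_eq_zero] at h2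
    exact hpos.ne' h2
  · exact ((continuousOn_sqrt_det hx p).mono Set.inter_subset_left).aemeasurable
      (measurableSet_target_inter p hW.measurableSet) |>.ennreal_ofReal

lemma integral_eq_integral_chart (hx : IsSphericalImmersion (n := n) x) (p : M) {F : M → ℝ}
    (hF : Continuous F) (h0 : ∀ q ∉ (ch n p).source, F q = 0) :
    ∫ q, F q ∂(vol (n := n) x)
      = ∫ y in (ch n p).target, Real.sqrt (gram (param x p) y).det * F ((ch n p).symm y) := by
  have hs := (continuousOn_sqrt_det hx p).aemeasurable (μ := volume) (ch n p).open_target.measurableSet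
  rw [← setIntegral_eq_integral_of_forall_compl_eq_zero h0, vol_restrict_source hx p, chartMeasure,
    integral_map ((aemeasurable_ch_symm p).mono_ac (withDensity_absolutelyContinuous _ _))
      hF.aestronglyMeasurable,
    integral_withDensity_eq_integral_toReal_smul₀ hs.ennreal_ofReal
      (Filter.Eventually.of_forall fun _ => ENNReal.ofReal_lt_top)]
  refine integral_congr_ae (Filter.Eventually.of_forall fun y => ?_)
  simp only [smul_eq_mul, ENNReal.toReal_ofReal (Real.sqrt_nonneg _)]

end Volume

section Divergence

variable {n : ℕ} {M : Type*} [TopologicalSpace M] [ChartedSpace (E n) M]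
  [IsManifold (𝓡 n) ∞ M] {x : M → E (n + 2)}

lemma contMDiff_Gam (hx : IsSphericalImmersion (n := n) x) {F : Type*} [NormedAddCommGroup F]
    [InnerProductSpace ℝ F] {u v : M → F} (hu : ContMDiff (𝓡 n) 𝓘(ℝ, F) ∞ u)
    (hv : ContMDiff (𝓡 n) 𝓘(ℝ, F) ∞ v) : ContMDiff (𝓡 n) 𝓘(ℝ, ℝ) ∞ (Gam (n := n) x u v) := by
  refine contMDiff_of_charts fun p => ⟨_, (ch n p).open_target, coord_mem_target p, ?_⟩
  refine (contDiffOn_carre (ch n p).open_target (hx.contDiffOn p) (fun y hy => hx.isUnit_gram p hy)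
    (contDiffOn_chart hu p) (contDiffOn_chart hv p)).congr fun y hy => ?_
  have hO := (ch n p).open_target
  exact Gam_eq hy (differentiableAt_of_contDiffOn (hx.contDiffOn p) hO hy)
    (differentiableAt_of_contDiffOn (contDiffOn_chart hu p) hO hy)
    (differentiableAt_of_contDiffOn (contDiffOn_chart hv p) hO hy)

variable [T2Space M] [CompactSpace M] [MeasurableSpace M] [BorelSpace M]

/-- The divergence theorem: the integral of the divergence of a smooth tangent field vanishes. -/
theorem integral_Gam_eq_zero (hx : IsSphericalImmersion (n := n) x) {X : M → E (n + 2)}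
    (hX : ContMDiff (𝓡 n) 𝓘(ℝ, E (n + 2)) ∞ X)
    (hT : ∀ p, ∀ y ∈ (ch n p).target, X ((ch n p).symm y) = raise (param x p) y
      fun i => inner ℝ (pd i (param x p) y) (X ((ch n p).symm y))) :
    ∫ q, Gam (n := n) x X x q ∂(vol (n := n) x) = 0 := by
  have := isFiniteMeasure_vol hx
  -- the pieces of `X` under the partition of unity, each supported in one chart
  set Y : M → M → E (n + 2) := fun q r => chartPartition n M q r • X r with hY
  have hYs : ∀ q, ContMDiff (𝓡 n) 𝓘(ℝ, E (n + 2)) ∞ (Y q) := fun q =>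
    (chartPartition n M q).contMDiff.smul hX
  have hGs := fun q => (contMDiff_Gam hx (hYs q) hx.smooth).continuous
  have hsum : ∀ r, Gam (n := n) x X x r = ∑ q ∈ activeIndices n M, Gam (n := n) x (Y q) x r := by
    intro r
    have e : X ∘ (ch n r).symm
        = fun z => ∑ q ∈ activeIndices n M, (Y q ∘ (ch n r).symm) z := by
      ext1 z
      simp only [hY, Function.comp_apply, ← Finset.sum_smul, sum_chartPartition, one_smul]
    have d := fun q => differentiableAt_of_contDiffOn (contDiffOn_chart (hYs q) r)
      (ch n r).open_target (coord_mem_target r)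
    simp only [Gam, carre]
    rw [e]
    simp only [pd_sum fun q (_ : q ∈ activeIndices n M) => d q, sum_inner, Finset.mul_sum]
    conv_lhs => enter [2, i]; rw [Finset.sum_comm]
    rw [Finset.sum_comm]
  simp_rw [hsum]
  rw [integral_finsetSum _ fun q _ =>
    (hGs q).integrable_of_hasCompactSupport (HasCompactSupport.of_compactSpace _)]
  refine Finset.sum_eq_zero fun q _ => ?_
  have hnear : ∀ r ∉ tsupport (chartPartition n M q), Y q =ᶠ[nhds r] fun _ => 0 := by
    intro r hr
    filter_upwards [(isClosed_tsupport _).isOpen_compl.mem_nhds hr] with s hs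
    simp only [hY, image_eq_zero_of_notMem_tsupport hs, zero_smul]
  rw [integral_eq_integral_chart hx q (hGs q)]
  · set K := ch n q '' tsupport (chartPartition n M q) with hK
    have hKc : IsCompact K := (isClosed_tsupport _).isCompact.image_of_continuousOn
      ((ch n q).continuousOn.mono (chartPartition_subordinate n M q))
    have hKt : K ⊆ (ch n q).target := by
      rintro _ ⟨r, hr, rfl⟩
      exact (ch n q).map_source (chartPartition_subordinate n M q hr)
    rw [← integral_divergence_eq_zero (X := Y q ∘ (ch n q).symm) (ch n q).open_target
      (hx.contDiffOn q) (fun y hy => hx.isUnit_gram q hy) (contDiffOn_chart (hYs q) q) ?_ hKc hKt ?_]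
    · refine setIntegral_congr_fun (ch n q).open_target.measurableSet fun y hy => ?_
      have d1 := differentiableAt_of_contDiffOn (hx.contDiffOn q) (ch n q).open_target hy
      have d2 := differentiableAt_of_contDiffOn (contDiffOn_chart (hYs q) q)
        (ch n q).open_target hy
      rw [Gam_eq hy d1 d2 d1]
      rfl
    · intro y hy
      simp only [hY, Function.comp_apply, inner_smul_right]
      conv_lhs => rw [hT q y hy]
      simp only [raise, Finset.smul_sum, smul_smul]
      refine Finset.sum_congr rfl fun i _ => Finset.sum_congr rfl fun j _ => ?_
      congr 1; ring
    · rintro y ⟨hy, hyK⟩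
      have : (ch n q).symm y ∉ tsupport (chartPartition n M q) := fun h =>
        hyK ⟨_, h, (ch n q).right_inv hy⟩
      exact (hnear _ this).self_of_nhds
  · intro r hr
    have h := hnear r fun h => hr (chartPartition_subordinate n M q h)
    have hc : Filter.Tendsto (ch n r).symm (nhds (coord r)) (nhds r) := by
      have := (ch n r).continuousAt_symm (coord_mem_target r)
      rwa [ContinuousAt, ch_symm_coord] at this
    have h2 : Y q ∘ (ch n r).symm =ᶠ[nhds (coord r)] fun _ => 0 := hc.eventually h
    simp only [Gam, carre, pd_congr h2, pd_const, inner_zero_left, mul_zero, Finset.sum_const_zero]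

end Divergence

/-! ### Height functions and the Gauss map on the manifold -/

section Global

variable {n : ℕ} {M : Type*} [TopologicalSpace M] [ChartedSpace (E n) M]

/-- The height function `⟨x, a⟩`. -/
def height {N : ℕ} (x : M → E N) (a : E N) (q : M) : ℝ := inner ℝ (x q) a

/-- The square `⟨ν, a⟩²` of the component of the unit normal in direction `a`, expressed without
a choice of unit normal: `|a|² = ⟨x, a⟩² + |aᵀ|² + ⟨ν, a⟩²`. -/
def normalSq {N : ℕ} (n : ℕ) [ChartedSpace (E n) M] (x : M → E N) (a : E N) (q : M) : ℝ :=
  ‖a‖ ^ 2 - height x a q ^ 2 - Gam (n := n) x (height x a) (height x a) q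

/-- The squared length of the gradient of `⟨ν, a⟩`, expressed through the traceless Ricci
tensor. -/
def normalEnergy {N : ℕ} (n : ℕ) [ChartedSpace (E n) M] (x : M → E N) (a : E N) (q : M) : ℝ :=
  sqNormSFF (n := n) x q / n * Gam (n := n) x (height x a) (height x a) q
    - tracelessRicci (n := n) (param x q) a (coord q)

/-- The gradient of a function on `M`, as a map to the ambient space. -/
def gradM {N : ℕ} (n : ℕ) [ChartedSpace (E n) M] (x : M → E N) (u : M → ℝ) (q : M) : E N :=
  WithLp.toLp 2 fun k => Gam (n := n) x u (height x (EuclideanSpace.single k 1)) q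

variable {x : M → E (n + 2)}

lemma carre_self_nonneg {n N : ℕ} {F : Type*} [NormedAddCommGroup F] [InnerProductSpace ℝ F]
    (f : E n → E N) (u : E n → F) {y : E n} : 0 ≤ carre f u u y := by
  have hp := gram_posSemidef f y
  obtain ⟨m, B, hB⟩ := Matrix.posSemidef_iff_eq_sum_vecMulVec.1 hp.inv
  have : carre f u u y = ∑ k, inner ℝ (∑ i, B k i • pd i u y) (∑ i, B k i • pd i u y) := by
    simp only [carre, hB, Matrix.sum_apply, Matrix.vecMulVec_apply, star_trivial, sum_inner,
      inner_sum, inner_smul_left, inner_smul_right, RCLike.conj_to_real, Finset.sum_mul,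
      Finset.mul_sum]
    conv_lhs => enter [2, i]; rw [Finset.sum_comm]
    rw [Finset.sum_comm]
    refine Finset.sum_congr rfl fun k _ => ?_
    refine Finset.sum_congr rfl fun i _ => Finset.sum_congr rfl fun j _ => ?_
    rw [real_inner_comm]; ring
  rw [this]
  exact Finset.sum_nonneg fun k _ => real_inner_self_nonneg

lemma Gam_self_nonneg {F : Type*} [NormedAddCommGroup F] [InnerProductSpace ℝ F] (u : M → F)
    (q : M) : 0 ≤ Gam (n := n) x u u q :=
  carre_self_nonneg _ _

lemma contMDiff_height (hx : IsSphericalImmersion (n := n) x) (a : E (n + 2)) :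
    ContMDiff (𝓡 n) 𝓘(ℝ, ℝ) ∞ (height x a) := by
  have : ContDiff ℝ ∞ fun v : E (n + 2) => inner ℝ v a := contDiff_id.inner ℝ contDiff_const
  exact this.contMDiff.comp hx.smooth

lemma continuous_height (hx : IsSphericalImmersion (n := n) x) (a : E (n + 2)) :
    Continuous (height x a) :=
  (contMDiff_height hx a).continuous

variable [IsManifold (𝓡 n) ∞ M]

lemma contMDiff_normalSq (hx : IsSphericalImmersion (n := n) x) (a : E (n + 2)) :
    ContMDiff (𝓡 n) 𝓘(ℝ, ℝ) ∞ (normalSq n x a) :=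
  (contMDiff_const.sub ((contMDiff_height hx a).pow 2)).sub
    (contMDiff_Gam hx (contMDiff_height hx a) (contMDiff_height hx a))

lemma continuous_normalSq (hx : IsSphericalImmersion (n := n) x) (a : E (n + 2)) :
    Continuous (normalSq n x a) :=
  (contMDiff_normalSq hx a).continuous

lemma contMDiff_gradM (hx : IsSphericalImmersion (n := n) x) {u : M → ℝ}
    (hu : ContMDiff (𝓡 n) 𝓘(ℝ, ℝ) ∞ u) :
    ContMDiff (𝓡 n) 𝓘(ℝ, E (n + 2)) ∞ (gradM n x u) := by
  refine contMDiff_of_charts fun p => ⟨_, (ch n p).open_target, coord_mem_target p, ?_⟩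
  rw [contDiffOn_euclidean]
  intro k
  exact contDiffOn_chart (contMDiff_Gam hx hu (contMDiff_height hx _)) p

lemma contMDiff_sqNormSFF (hx : IsSphericalImmersion (n := n) x) (hmin : IsMinimal (n := n) x) :
    ContMDiff (𝓡 n) 𝓘(ℝ, ℝ) ∞ (sqNormSFF (n := n) x) := by
  refine contMDiff_of_charts fun p => ?_
  obtain ⟨ν, U, hy, hU, h⟩ := exists_local hx hmin p (coord_mem_target p)
  refine ⟨U, h.isOpen, hy, ?_⟩
  exact (h.contDiffOn_carre h.smooth_normal h.smooth_normal).congr fun y hy => h.sqNormSFF_eq hU hy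

lemma gradM_chart (hx : IsSphericalImmersion (n := n) x) {u : M → ℝ}
    (hu : ContMDiff (𝓡 n) 𝓘(ℝ, ℝ) ∞ u) {p : M} {y : E n} (hy : y ∈ (ch n p).target) :
    gradM n x u ((ch n p).symm y) = grad (param x p) (u ∘ (ch n p).symm) y := by
  have hO := (ch n p).open_target
  have dx := differentiableAt_of_contDiffOn (hx.contDiffOn p) hO hy
  have du := differentiableAt_of_contDiffOn (contDiffOn_chart hu p) hO hy
  ext k
  have h1 : grad (param x p) (u ∘ (ch n p).symm) y k
      = inner ℝ (grad (param x p) (u ∘ (ch n p).symm) y) (EuclideanSpace.single k 1) := by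
    simp [EuclideanSpace.inner_single_right]
  rw [h1, inner_grad dx]
  exact Gam_eq hy dx du (differentiableAt_of_contDiffOn
    (contDiffOn_chart (contMDiff_height hx (EuclideanSpace.single k 1)) p) hO hy)

/-- The Laplacian of a function on `M` may be computed in any preferred chart. -/
lemma laplacian_chart (hx : IsSphericalImmersion (n := n) x) {u : M → ℝ}
    (hu : ContMDiff (𝓡 n) 𝓘(ℝ, ℝ) ∞ u) {p : M} {y : E n} {U : Set (E n)} (hU : IsOpen U)
    (hUt : U ⊆ (ch n p).target) (hy : y ∈ U) {w : E n → ℝ}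
    (hw : ∀ z ∈ U, u ((ch n p).symm z) = w z) :
    Gam (n := n) x (gradM n x u) x ((ch n p).symm y)
      = carre (param x p) (grad (param x p) w) (param x p) y := by
  have hO := (ch n p).open_target
  have dx := differentiableAt_of_contDiffOn (hx.contDiffOn p) hO (hUt hy)
  have dg := differentiableAt_of_contDiffOn (contDiffOn_chart (contMDiff_gradM hx hu) p) hO (hUt hy)
  rw [Gam_eq (hUt hy) dx dg dx]
  refine carre_congr Filter.EventuallyEq.rfl ?_ Filter.EventuallyEq.rfl
  filter_upwards [hU.mem_nhds hy] with z hz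
  rw [Function.comp_apply, gradM_chart hx hu (hUt hz)]
  simp only [grad]
  congr 1
  ext i
  exact pd_congr_of_isOpen hU hz hw i

namespace IsLocalHypersurface

variable {p : M} {ν : E n → E (n + 2)} {U : Set (E n)} {y : E n}

lemma Gam_height_eq (hx : IsSphericalImmersion (n := n) x)
    (hU : U ⊆ (ch n p).target) (hy : y ∈ U) (a b : E (n + 2)) :
    Gam (n := n) x (height x a) (height x b) ((ch n p).symm y)
      = carre (param x p) (fun z => inner ℝ (param x p z) a)
          (fun z => inner ℝ (param x p z) b) y := by
  have hO := (ch n p).open_target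
  exact Gam_eq (hU hy) (differentiableAt_of_contDiffOn (hx.contDiffOn p) hO (hU hy))
    (differentiableAt_of_contDiffOn (contDiffOn_chart (contMDiff_height hx a) p) hO (hU hy))
    (differentiableAt_of_contDiffOn (contDiffOn_chart (contMDiff_height hx b) p) hO (hU hy))

lemma normalSq_eq (h : IsLocalHypersurface (param x p) ν U) (hx : IsSphericalImmersion (n := n) x)
    (hU : U ⊆ (ch n p).target) (hy : y ∈ U) (a : E (n + 2)) :
    normalSq n x a ((ch n p).symm y) = inner ℝ (ν y) a ^ 2 := by
  rw [normalSq, Gam_height_eq hx hU hy, h.carre_height hy, real_inner_self_eq_norm_sq]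
  simp only [height, param, Function.comp_apply]
  ring

lemma normalEnergy_eq (h : IsLocalHypersurface (param x p) ν U) (hn : 1 ≤ n)
    (hx : IsSphericalImmersion (n := n) x)
    (hU : U ⊆ (ch n p).target) (hy : y ∈ U) (a : E (n + 2)) :
    normalEnergy n x a ((ch n p).symm y)
      = carre (param x p) (fun z => inner ℝ (ν z) a) (fun z => inner ℝ (ν z) a) y := by
  rw [normalEnergy, h.tracelessRicci_coord_eq hn hU hy, Gam_height_eq hx hU hy,
    h.sqNormSFF_eq hU hy]
  ring

end IsLocalHypersurface

section Pointwise

lemma sqNormSFF_nonneg (hx : IsSphericalImmersion (n := n) x) (hmin : IsMinimal (n := n) x)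
    (q : M) : 0 ≤ sqNormSFF (n := n) x q := by
  obtain ⟨ν, U, hy, hU, h⟩ := exists_local hx hmin q (coord_mem_target q)
  have := h.sqNormSFF_eq hU hy
  rw [ch_symm_coord] at this
  rw [this]
  exact carre_self_nonneg _ _

lemma normalSq_nonneg (hx : IsSphericalImmersion (n := n) x) (hmin : IsMinimal (n := n) x)
    (a : E (n + 2)) (q : M) : 0 ≤ normalSq n x a q := by
  obtain ⟨ν, U, hy, hU, h⟩ := exists_local hx hmin q (coord_mem_target q)
  have := h.normalSq_eq hx hU hy a
  rw [ch_symm_coord] at this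
  rw [this]
  positivity

lemma scalar_eq_sub (hx : IsSphericalImmersion (n := n) x) (hmin : IsMinimal (n := n) x)
    (q : M) : scalar (n := n) (param x q) (coord q)
      = n * ((n : ℝ) - 1) - sqNormSFF (n := n) x q := by
  obtain ⟨ν, U, hy, hU, h⟩ := exists_local hx hmin q (coord_mem_target q)
  have := h.scalar_coord_eq hU hy
  rwa [ch_symm_coord] at this

lemma laplacian_height_sq (hx : IsSphericalImmersion (n := n) x) (hmin : IsMinimal (n := n) x)
    (a : E (n + 2)) (q : M) :
    Gam (n := n) x (gradM n x fun r => height x a r ^ 2) x q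
      = 2 * (‖a‖ ^ 2 - (n + 1) * height x a q ^ 2 - normalSq n x a q) := by
  obtain ⟨ν, U, hy, hU, h⟩ := exists_local hx hmin q (coord_mem_target q)
  have h1 := laplacian_chart hx ((contMDiff_height hx a).pow 2) h.isOpen hU hy
    (w := fun z => inner ℝ (param x q z) a ^ 2) fun z _ => rfl
  rw [h.laplacian_height_sq hy, ← IsLocalHypersurface.Gam_height_eq hx hU hy a a,
    ch_symm_coord] at h1
  refine h1.trans ?_
  have e : param x q (coord q) = x q := congrArg x (ch_symm_coord (n := n) q)
  rw [normalSq, e, height]; ring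

lemma laplacian_normalSq (hn : 1 ≤ n) (hx : IsSphericalImmersion (n := n) x)
    (hmin : IsMinimal (n := n) x) (a : E (n + 2)) (q : M) :
    Gam (n := n) x (gradM n x (normalSq n x a)) x q
      = 2 * (normalEnergy n x a q - sqNormSFF (n := n) x q * normalSq n x a q) := by
  obtain ⟨ν, U, hy, hU, h⟩ := exists_local hx hmin q (coord_mem_target q)
  have h1 := laplacian_chart hx (contMDiff_normalSq hx a) h.isOpen hU hy
    (w := fun z => inner ℝ (ν z) a ^ 2) fun z hz => h.normalSq_eq hx hU hz a
  rw [h.laplacian_normal_sq hy, ← h.normalEnergy_eq hn hx hU hy, ← h.sqNormSFF_eq hU hy,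
    ← h.normalSq_eq hx hU hy, ch_symm_coord] at h1
  rw [h1]; ring

lemma normalEnergy_le (hn : 1 ≤ n) (hx : IsSphericalImmersion (n := n) x)
    (hmin : IsMinimal (n := n) x) (a : E (n + 2)) (q : M) :
    n * normalEnergy n x a q ≤ (n - 1) * sqNormSFF (n := n) x q
      * Gam (n := n) x (height x a) (height x a) q := by
  obtain ⟨ν, U, hy, hU, h⟩ := exists_local hx hmin q (coord_mem_target q)
  have h1 := h.carre_normal_le hn hy a
  rwa [← h.normalEnergy_eq hn hx hU hy, ← h.sqNormSFF_eq hU hy,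
    ← IsLocalHypersurface.Gam_height_eq hx hU hy, ch_symm_coord] at h1

lemma continuous_normalEnergy (hn : 1 ≤ n) (hx : IsSphericalImmersion (n := n) x)
    (hmin : IsMinimal (n := n) x) (a : E (n + 2)) : Continuous (normalEnergy n x a) := by
  have h1 : Continuous (Gam (n := n) x (gradM n x (normalSq n x a)) x) :=
    (contMDiff_Gam hx (contMDiff_gradM hx (contMDiff_normalSq hx a)) hx.smooth).continuous
  have h2 := (contMDiff_sqNormSFF hx hmin).continuous
  have : normalEnergy n x a = fun q => Gam (n := n) x (gradM n x (normalSq n x a)) x q / 2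
      + sqNormSFF (n := n) x q * normalSq n x a q := by
    ext q
    rw [laplacian_normalSq hn hx hmin]; ring
  rw [this]
  exact (h1.div_const 2).add (h2.mul (continuous_normalSq hx a))

end Pointwise

end Global

/-! ### Integral identities and the quadratic form of the height functions -/

lemma exists_orthonormalBasis {n : ℕ} (a : E (n + 2)) (ha : ‖a‖ = 1) :
    ∃ b : OrthonormalBasis (Fin (n + 2)) ℝ (E (n + 2)), b 0 = a := by
  have hv : Orthonormal ℝ (Set.domRestrict ({0} : Set (Fin (n + 2))) fun _ => a) := by
    refine ⟨fun i => ha, fun i j hij => ?_⟩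
    exact absurd (Subsingleton.elim i j) hij
  obtain ⟨b, hb⟩ := hv.exists_orthonormalBasis_extension_of_card_eq (by simp)
  exact ⟨b, hb 0 rfl⟩

section HeightMean

variable {n : ℕ} {M : Type*} [TopologicalSpace M] [ChartedSpace (E n) M]
  [IsManifold (𝓡 n) ∞ M] [T2Space M] [CompactSpace M] [MeasurableSpace M] {x : M → E (n + 2)}

lemma heightMean_eq (a : E (n + 2)) : heightMean (n := n) x a
    = (∫ q, height x a q ^ 2 ∂(vol (n := n) x)) / (vol (n := n) x).real Set.univ := rfl

lemma heightMean_nonneg (a : E (n + 2)) : 0 ≤ heightMean (n := n) x a :=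
  div_nonneg (integral_nonneg fun _ => sq_nonneg _) measureReal_nonneg

lemma iInf_heightMean_le (a : E (n + 2)) (ha : ‖a‖ = 1) :
    (⨅ a : Metric.sphere (0 : E (n + 2)) 1, heightMean (n := n) x a) ≤ heightMean (n := n) x a :=
  ciInf_le ⟨0, by rintro _ ⟨a, rfl⟩; exact heightMean_nonneg _⟩
    (⟨a, by simpa using ha⟩ : Metric.sphere (0 : E (n + 2)) 1)

end HeightMean

section Integral

variable {n : ℕ} {M : Type*} [TopologicalSpace M] [ChartedSpace (E n) M]
  [IsManifold (𝓡 n) ∞ M] [T2Space M] [CompactSpace M] [MeasurableSpace M] [BorelSpace M]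
  {x : M → E (n + 2)}

lemma integrable_vol (hx : IsSphericalImmersion (n := n) x) {F : M → ℝ} (hF : Continuous F) :
    Integrable F (vol (n := n) x) :=
  have := isFiniteMeasure_vol hx
  hF.integrable_of_hasCompactSupport (HasCompactSupport.of_compactSpace _)

lemma integrable_height_sq (hx : IsSphericalImmersion (n := n) x) (a : E (n + 2)) :
    Integrable (fun q => height x a q ^ 2) (vol (n := n) x) :=
  integrable_vol hx ((continuous_height hx a).pow 2)

lemma integral_laplacian (hx : IsSphericalImmersion (n := n) x) {u : M → ℝ}
    (hu : ContMDiff (𝓡 n) 𝓘(ℝ, ℝ) ∞ u) :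
    ∫ q, Gam (n := n) x (gradM n x u) x q ∂(vol (n := n) x) = 0 := by
  refine integral_Gam_eq_zero hx (contMDiff_gradM hx hu) fun p y hy => ?_
  rw [gradM_chart hx hu hy]
  simp only [grad, inner_pd_raise (hx.isUnit_gram p hy)]

/-- `∫ ⟨ν, a⟩² = |a|² Vol - (n + 1) ∫ ⟨x, a⟩²`. -/
lemma integral_normalSq (hx : IsSphericalImmersion (n := n) x) (hmin : IsMinimal (n := n) x)
    (a : E (n + 2)) :
    ∫ q, normalSq n x a q ∂(vol (n := n) x) = ‖a‖ ^ 2 * (vol (n := n) x).real Set.univ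
      - (n + 1) * ∫ q, height x a q ^ 2 ∂(vol (n := n) x) := by
  have := isFiniteMeasure_vol hx
  have h := integral_laplacian hx ((contMDiff_height hx a).pow 2)
  change ∫ q, Gam (n := n) x (gradM n x fun r => height x a r ^ 2) x q ∂(vol (n := n) x) = 0 at h
  simp_rw [laplacian_height_sq hx hmin a] at h
  have i1 := integrable_height_sq hx a
  have i2 : Integrable (fun q => ‖a‖ ^ 2 - (n + 1) * height x a q ^ 2) (vol (n := n) x) :=
    (integrable_const _).sub (i1.const_mul _)
  rw [integral_const_mul, integral_sub i2 (integrable_vol hx (continuous_normalSq hx a)),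
    integral_sub (integrable_const _)
    (i1.const_mul _), integral_const_mul, integral_const, smul_eq_mul] at h
  linarith

lemma integral_normalEnergy (hn : 1 ≤ n) (hx : IsSphericalImmersion (n := n) x)
    (hmin : IsMinimal (n := n) x) {s : ℝ} (hs : ∀ q, sqNormSFF (n := n) x q = s) (a : E (n + 2)) :
    ∫ q, normalEnergy n x a q ∂(vol (n := n) x) = s * ∫ q, normalSq n x a q ∂(vol (n := n) x) := by
  have h := integral_laplacian hx (contMDiff_normalSq hx a)
  simp_rw [laplacian_normalSq hn hx hmin a, hs] at h
  rw [integral_const_mul, integral_sub (integrable_vol hx (continuous_normalEnergy hn hx hmin a))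
    ((integrable_vol hx (continuous_normalSq hx a)).const_mul _), integral_const_mul] at h
  linarith

lemma integral_Gam_height (hx : IsSphericalImmersion (n := n) x) (hmin : IsMinimal (n := n) x)
    (a : E (n + 2)) :
    ∫ q, Gam (n := n) x (height x a) (height x a) q ∂(vol (n := n) x)
      = n * ∫ q, height x a q ^ 2 ∂(vol (n := n) x) := by
  have := isFiniteMeasure_vol hx
  have h := integral_normalSq hx hmin a
  simp only [normalSq] at h
  have i1 := integrable_height_sq hx a
  have i3 : Integrable (fun q => ‖a‖ ^ 2 - height x a q ^ 2) (vol (n := n) x) :=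
    (integrable_const _).sub i1
  have i2 := integrable_vol hx
    (contMDiff_Gam hx (contMDiff_height hx a) (contMDiff_height hx a)).continuous
  rw [integral_sub i3 i2, integral_sub (integrable_const _) i1,
    integral_const, smul_eq_mul] at h
  linarith

/-- The integral of the traceless Ricci curvature in direction `aᵀ` when `S` is constant. -/
lemma integral_tracelessRicci (hn : 1 ≤ n) (hx : IsSphericalImmersion (n := n) x)
    (hmin : IsMinimal (n := n) x) {s : ℝ} (hs : ∀ q, sqNormSFF (n := n) x q = s) {a : E (n + 2)}
    (ha : ‖a‖ = 1) :
    ∫ q, tracelessRicci (n := n) (param x q) a (coord q) ∂(vol (n := n) x)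
      = s * ((n + 2) * ∫ q, height x a q ^ 2 ∂(vol (n := n) x)
        - (vol (n := n) x).real Set.univ) := by
  have e : ∀ q, tracelessRicci (n := n) (param x q) a (coord q)
      = s / n * Gam (n := n) x (height x a) (height x a) q - normalEnergy n x a q := by
    intro q
    rw [normalEnergy, hs]; ring
  have i2 := integrable_vol hx
    (contMDiff_Gam hx (contMDiff_height hx a) (contMDiff_height hx a)).continuous
  simp_rw [e]
  rw [integral_sub (i2.const_mul _) (integrable_vol hx (continuous_normalEnergy hn hx hmin a)),
    integral_const_mul, integral_Gam_height hx hmin, integral_normalEnergy hn hx hmin hs,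
    integral_normalSq hx hmin, ha]
  have : (n : ℝ) ≠ 0 := by positivity
  field_simp
  ring

lemma vol_real_pos [Nonempty M] (hx : IsSphericalImmersion (n := n) x) :
    0 < (vol (n := n) x).real Set.univ := by
  have := isFiniteMeasure_vol hx
  have := isOpenPosMeasure_vol hx
  exact ENNReal.toReal_pos (isOpen_univ.measure_pos _ Set.univ_nonempty).ne' (measure_ne_top _ _)

lemma eq_zero_of_integral_eq_zero (hx : IsSphericalImmersion (n := n) x) {F : M → ℝ}
    (hF : Continuous F) (h0 : ∀ q, 0 ≤ F q) (hi : ∫ q, F q ∂(vol (n := n) x) = 0) (q : M) :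
    F q = 0 := by
  have := isOpenPosMeasure_vol hx
  rw [integral_eq_zero_iff_of_nonneg h0 (integrable_vol hx hF)] at hi
  exact congrFun ((hF.ae_eq_iff_eq _ continuous_const).1 hi) q

lemma integral_height_sq [Nonempty M] (hx : IsSphericalImmersion (n := n) x) (a : E (n + 2)) :
    ∫ q, height x a q ^ 2 ∂(vol (n := n) x)
      = heightMean (n := n) x a * (vol (n := n) x).real Set.univ := by
  rw [heightMean_eq, div_mul_cancel₀ _ (vol_real_pos hx).ne']

lemma continuous_heightMean (hx : IsSphericalImmersion (n := n) x) :
    Continuous (heightMean (n := n) x) := by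
  have := isFiniteMeasure_vol hx
  have h : Continuous (Function.uncurry fun (a : E (n + 2)) (q : M) => height x a q ^ 2) :=
    ((hx.smooth.continuous.comp continuous_snd).inner continuous_fst).pow 2
  have := continuous_parametric_integral_of_continuous (μ := vol (n := n) x) h isCompact_univ
  simp only [Measure.restrict_univ] at this
  exact this.div_const _

/-- The trace of the quadratic form `heightMean` is one. -/
lemma sum_heightMean [Nonempty M] (hx : IsSphericalImmersion (n := n) x) {ι : Type*} [Fintype ι]
    (b : OrthonormalBasis ι ℝ (E (n + 2))) : ∑ i, heightMean (n := n) x (b i) = 1 := by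
  have := isFiniteMeasure_vol hx
  simp only [heightMean_eq, ← Finset.sum_div]
  rw [← integral_finsetSum _ fun i _ => integrable_height_sq hx (b i)]
  have : ∀ q, ∑ i, height x (b i) q ^ 2 = 1 := by
    intro q
    rw [← hx.inner_self q, ← b.sum_inner_mul_inner (x q) (x q)]
    exact Finset.sum_congr rfl fun i _ => by rw [height, sq, real_inner_comm (x q) (b i)]
  simp only [this, integral_const, smul_eq_mul, mul_one]
  exact div_self (vol_real_pos hx).ne'

section Extrema

lemma exists_heightMean_eq_iInf (hx : IsSphericalImmersion (n := n) x) :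
    ∃ a₀ : E (n + 2), ‖a₀‖ = 1 ∧
      (⨅ a : Metric.sphere (0 : E (n + 2)) 1, heightMean (n := n) x a) = heightMean (n := n) x a₀ := by
  have hne : (Metric.sphere (0 : E (n + 2)) 1).Nonempty := NormedSpace.sphere_nonempty.2 zero_le_one
  obtain ⟨a₀, ha, hm⟩ := (isCompact_sphere (0 : E (n + 2)) 1).exists_isMinOn hne
    (continuous_heightMean hx).continuousOn
  have := hne.to_subtype
  refine ⟨a₀, by simpa using ha, le_antisymm ?_ (le_ciInf fun a => hm a.2)⟩
  exact ciInf_le ⟨0, by rintro _ ⟨a, rfl⟩; exact heightMean_nonneg _⟩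
    (⟨a₀, ha⟩ : Metric.sphere (0 : E (n + 2)) 1)

lemma exists_heightMean_eq_iSup (hx : IsSphericalImmersion (n := n) x) :
    ∃ a₀ : E (n + 2), ‖a₀‖ = 1 ∧
      (⨆ a : Metric.sphere (0 : E (n + 2)) 1, heightMean (n := n) x a) = heightMean (n := n) x a₀
      ∧ ∀ a : E (n + 2), ‖a‖ = 1 → heightMean (n := n) x a ≤ heightMean (n := n) x a₀ := by
  have hne : (Metric.sphere (0 : E (n + 2)) 1).Nonempty := NormedSpace.sphere_nonempty.2 zero_le_one
  obtain ⟨a₀, ha, hm⟩ := (isCompact_sphere (0 : E (n + 2)) 1).exists_isMaxOn hne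
    (continuous_heightMean hx).continuousOn
  have := hne.to_subtype
  refine ⟨a₀, by simpa using ha, le_antisymm (ciSup_le fun a => hm a.2) ?_,
    fun a ha => hm (by simpa using ha)⟩
  exact le_ciSup (f := fun a : Metric.sphere (0 : E (n + 2)) 1 => heightMean (n := n) x a)
    ⟨heightMean (n := n) x a₀, by rintro _ ⟨a, rfl⟩; exact hm a.2⟩ ⟨a₀, ha⟩

variable [Nonempty M]

/-- If the average `1 / (n + 2)` is a bound for the form, then it is its only value. -/
lemma heightMean_eq_of_bound (hx : IsSphericalImmersion (n := n) x)
    (h : (∀ a : E (n + 2), ‖a‖ = 1 → 1 / ((n : ℝ) + 2) ≤ heightMean (n := n) x a) ∨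
      ∀ a : E (n + 2), ‖a‖ = 1 → heightMean (n := n) x a ≤ 1 / ((n : ℝ) + 2))
    {a : E (n + 2)} (ha : ‖a‖ = 1) : heightMean (n := n) x a = 1 / ((n : ℝ) + 2) := by
  obtain ⟨b, rfl⟩ := exists_orthonormalBasis a ha
  have hs := sum_heightMean hx b
  have hc : ∑ _i : Fin (n + 2), 1 / ((n : ℝ) + 2) = 1 := by
    rw [Finset.sum_const, Finset.card_univ, Fintype.card_fin, nsmul_eq_mul]
    push_cast
    field_simp
  rcases h with h | h
  · exact ((Finset.sum_eq_sum_iff_of_le fun i _ => h (b i) (b.norm_eq_one i)).1 (hc.trans hs.symm)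
      0 (Finset.mem_univ _)).symm
  · exact (Finset.sum_eq_sum_iff_of_le fun i _ => h (b i) (b.norm_eq_one i)).1 (hs.trans hc.symm)
      0 (Finset.mem_univ _)

lemma exists_heightMean_le (hx : IsSphericalImmersion (n := n) x) :
    ∃ a : E (n + 2), ‖a‖ = 1 ∧ heightMean (n := n) x a ≤ 1 / ((n : ℝ) + 2) := by
  by_contra! h
  obtain ⟨a, ha, -⟩ := exists_heightMean_eq_iInf hx
  have := heightMean_eq_of_bound hx (Or.inl fun a ha => (h a ha).le) ha
  exact (h a ha).ne' this

lemma exists_le_heightMean (hx : IsSphericalImmersion (n := n) x) :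
    ∃ a : E (n + 2), ‖a‖ = 1 ∧ 1 / ((n : ℝ) + 2) ≤ heightMean (n := n) x a := by
  by_contra! h
  obtain ⟨a, ha, -⟩ := exists_heightMean_eq_iInf hx
  have := heightMean_eq_of_bound hx (Or.inr fun a ha => (h a ha).le) ha
  exact (h a ha).ne this

end Extrema

end Integral

/-! ### Totally geodesic hypersurfaces and the extreme values -/

section Extreme

variable {n : ℕ} {M : Type*} [TopologicalSpace M] [ChartedSpace (E n) M]

lemma eq_of_pd_eq_zero [PreconnectedSpace M] {u : M → ℝ}
    (hu : ∀ p : M, ∃ U : Set (E n), IsOpen U ∧ coord p ∈ U ∧ ∀ z ∈ U,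
      DifferentiableAt ℝ (u ∘ (ch n p).symm) z ∧ ∀ k, pd k (u ∘ (ch n p).symm) z = 0) (p q : M) :
    u p = u q := by
  have hl : IsLocallyConstant u := by
    rw [IsLocallyConstant.iff_eventually_eq]
    intro p
    obtain ⟨U, hU, hp, h⟩ := hu p
    obtain ⟨r, hr, hb⟩ := Metric.isOpen_iff.1 hU _ hp
    have hd : DifferentiableOn ℝ (u ∘ (ch n p).symm) (Metric.ball (coord p) r) := fun z hz =>
      (h z (hb hz)).1.differentiableWithinAt
    have h0 : Set.EqOn (fderiv ℝ (u ∘ (ch n p).symm)) 0 (Metric.ball (coord p) r) := fun z hz =>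
      fderiv_eq_zero_of_pd (h z (hb hz)).2
    have hN : (ch n p).source ∩ (ch n p) ⁻¹' (Metric.ball (coord p) r) ∈ nhds p :=
      ((ch n p).isOpen_inter_preimage Metric.isOpen_ball).mem_nhds
        ⟨mem_chart_source _ p, Metric.mem_ball_self hr⟩
    filter_upwards [hN] with q hq
    have := Metric.isOpen_ball.is_const_of_fderiv_eq_zero (convex_ball _ _).isPreconnected hd h0
      hq.2 (Metric.mem_ball_self hr)
    simpa [(ch n p).left_inv hq.1, ch_symm_coord] using this
  exact hl.apply_eq_of_preconnectedSpace p q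

lemma Gam_eq_zero_of_extr {x : M → E (n + 2)} (u : M → ℝ) {m : M → ℝ} {q : M}
    (hm : (∀ r, m r ≤ m q) ∨ ∀ r, m q ≤ m r) : Gam (n := n) x u m q = 0 := by
  have h : fderiv ℝ (m ∘ (ch n q).symm) (coord q) = 0 := by
    have e : (m ∘ (ch n q).symm) (coord q) = m q := congrArg m (ch_symm_coord q)
    rcases hm with hm | hm
    · refine IsLocalMax.fderiv_eq_zero (Filter.Eventually.of_forall fun z => ?_)
      rw [e]; exact hm _
    · refine IsLocalMin.fderiv_eq_zero (Filter.Eventually.of_forall fun z => ?_)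
      rw [e]; exact hm _
  simp only [Gam, carre, pd, h]
  simp

variable [IsManifold (𝓡 n) ∞ M] {x : M → E (n + 2)}

/-- On a totally geodesic hypersurface the Gauss map is constant up to sign. -/
lemma normalSq_eq_of_isTotallyGeodesic [PreconnectedSpace M]
    (hx : IsSphericalImmersion (n := n) x) (hmin : IsMinimal (n := n) x)
    (ht : IsTotallyGeodesic (n := n) x) (a : E (n + 2)) (p q : M) :
    normalSq n x a p = normalSq n x a q := by
  refine eq_of_pd_eq_zero (n := n) (fun p => ?_) p q
  obtain ⟨ν, U, hy, hU, h⟩ := exists_local hx hmin p (coord_mem_target p)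
  refine ⟨U, h.isOpen, hy, fun z hz => ⟨differentiableAt_of_contDiffOn
    (contDiffOn_chart (contMDiff_normalSq hx a) p) (ch n p).open_target (hU hz), fun k => ?_⟩⟩
  have e : Set.EqOn (normalSq n x a ∘ (ch n p).symm) (fun y => inner ℝ (ν y) a * inner ℝ (ν y) a)
      U := fun y hy => (h.normalSq_eq hx hU hy a).trans (sq _)
  have d := differentiableAt_of_contDiffOn (contDiffOn_inner_const h.smooth_normal a) h.isOpen hz
  have hS := h.sqNormSFF_eq hU hz
  rw [(isTotallyGeodesic_iff hx hmin).1 ht] at hS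
  rw [pd_congr_of_isOpen h.isOpen hz e, pd_mul d d, pd_inner_const (h.diff_normal hz),
    h.pd_normal_eq_zero hz hS.symm, inner_zero_left]
  ring

lemma Gam_mul {u v w : M → ℝ}
    (hu : ContMDiff (𝓡 n) 𝓘(ℝ, ℝ) ∞ u) (hv : ContMDiff (𝓡 n) 𝓘(ℝ, ℝ) ∞ v) (q : M) :
    Gam (n := n) x w (fun r => u r * v r) q
      = u q * Gam (n := n) x w v q + v q * Gam (n := n) x w u q := by
  have hO := (ch n q).open_target
  have du := differentiableAt_of_contDiffOn (contDiffOn_chart hu q) hO (coord_mem_target q)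
  have dv := differentiableAt_of_contDiffOn (contDiffOn_chart hv q) hO (coord_mem_target q)
  have e : ∀ j, pd j ((fun r => u r * v r) ∘ (ch n q).symm) (coord q)
      = pd j (u ∘ (ch n q).symm) (coord q) * v q + u q * pd j (v ∘ (ch n q).symm) (coord q) := by
    intro j
    have := pd_mul du dv j
    simp only [Function.comp_apply, ch_symm_coord] at this
    exact this
  simp only [Gam, carre, e, Finset.mul_sum, ← Finset.sum_add_distrib]
  refine Finset.sum_congr rfl fun i _ => Finset.sum_congr rfl fun j _ => ?_
  simp only [RCLike.inner_apply, conj_trivial]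
  ring

/-- If `⟨ν, a⟩` vanishes identically then `⟨∇S, aᵀ⟩ = 2 ⟨x, a⟩ S`, by the Codazzi equation. -/
lemma Gam_height_sqNormSFF (hx : IsSphericalImmersion (n := n) x) (hmin : IsMinimal (n := n) x)
    {a : E (n + 2)} (ha : ∀ q, normalSq n x a q = 0) (q : M) :
    Gam (n := n) x (height x a) (sqNormSFF (n := n) x) q
      = 2 * height x a q * sqNormSFF (n := n) x q := by
  obtain ⟨ν, U, hy, hU, h⟩ := exists_local hx hmin q (coord_mem_target q)
  have hν : ∀ y ∈ U, inner ℝ (ν y) a = (0 : ℝ) := fun y hy => by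
    have := h.normalSq_eq hx hU hy a
    rw [ha] at this
    exact pow_eq_zero_iff two_ne_zero |>.1 this.symm
  have h1 := h.transport hy hν
  have e : param x q (coord q) = x q := congrArg x (ch_symm_coord (n := n) q)
  have hS := h.sqNormSFF_eq hU hy
  rw [ch_symm_coord] at hS
  rw [← hS, e] at h1
  refine Eq.trans ?_ h1
  refine carre_congr Filter.EventuallyEq.rfl Filter.EventuallyEq.rfl ?_
  filter_upwards [h.isOpen.mem_nhds hy] with z hz
  exact h.sqNormSFF_eq hU hz

/-- If some `⟨ν, a⟩` with `a ≠ 0` vanishes identically, the hypersurface is totally geodesic: the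
function `m = S ⟨x, a⟩` satisfies `⟨∇m, aᵀ⟩ = S (1 + ⟨x, a⟩²)`, so that `S = 0` where `m` is
extremal, and `m` is identically zero. -/
lemma isTotallyGeodesic_of_normalSq_eq_zero [CompactSpace M] [Nonempty M]
    (hx : IsSphericalImmersion (n := n) x) (hmin : IsMinimal (n := n) x)
    {a : E (n + 2)} (ha1 : ‖a‖ = 1) (ha : ∀ q, normalSq n x a q = 0) :
    IsTotallyGeodesic (n := n) x := by
  rw [isTotallyGeodesic_iff hx hmin]
  set m : M → ℝ := fun r => sqNormSFF (n := n) x r * height x a r with hm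
  have hS := contMDiff_sqNormSFF hx hmin
  have hmc : Continuous m := hS.continuous.mul (continuous_height hx a)
  have hξ : ∀ q, Gam (n := n) x (height x a) m q
      = sqNormSFF (n := n) x q * (1 + height x a q ^ 2) := by
    intro q
    have h1 : Gam (n := n) x (height x a) (height x a) q = 1 - height x a q ^ 2 := by
      have := ha q
      rw [normalSq, ha1] at this
      linarith
    rw [hm, Gam_mul hS (contMDiff_height hx a), h1, Gam_height_sqNormSFF hx hmin ha]
    ring
  have hz : ∀ q, Gam (n := n) x (height x a) m q = 0 → sqNormSFF (n := n) x q = 0 := by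
    intro q h
    rw [hξ] at h
    exact (mul_eq_zero.1 h).resolve_right (by positivity)
  obtain ⟨q₁, -, h₁⟩ := isCompact_univ.exists_isMaxOn Set.univ_nonempty hmc.continuousOn
  obtain ⟨q₂, -, h₂⟩ := isCompact_univ.exists_isMinOn Set.univ_nonempty hmc.continuousOn
  have hmax : ∀ r, m r ≤ m q₁ := fun r => h₁ (Set.mem_univ r)
  have hmin' : ∀ r, m q₂ ≤ m r := fun r => h₂ (Set.mem_univ r)
  have e₁ : m q₁ = 0 := by
    simp only [hm, hz q₁ (Gam_eq_zero_of_extr _ (Or.inl hmax)), zero_mul]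
  have e₂ : m q₂ = 0 := by
    simp only [hm, hz q₂ (Gam_eq_zero_of_extr _ (Or.inr hmin')), zero_mul]
  intro q
  have hq : m q = 0 := le_antisymm (e₁ ▸ hmax q) (e₂ ▸ hmin' q)
  refine hz q (Gam_eq_zero_of_extr _ (Or.inl fun r => ?_))
  rw [hq, ← e₁]; exact hmax r

/-- A hypersurface contained in a hyperplane is totally geodesic. -/
lemma isTotallyGeodesic_of_height_eq_zero (hn : 1 ≤ n) (hx : IsSphericalImmersion (n := n) x)
    (hmin : IsMinimal (n := n) x) {a : E (n + 2)} (ha1 : ‖a‖ = 1) (ha : ∀ q, height x a q = 0) :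
    IsTotallyGeodesic (n := n) x := by
  rw [isTotallyGeodesic_iff hx hmin]
  have h0 : height x a = fun _ => 0 := funext ha
  have hG : ∀ q, Gam (n := n) x (height x a) (height x a) q = 0 := by
    intro q
    rw [h0]
    exact Gam_eq_zero_of_extr _ (Or.inl fun _ => le_rfl)
  have hN : normalSq n x a = fun _ => 1 := by
    ext q; rw [normalSq, hG, ha, ha1]; ring
  intro q
  have h1 := laplacian_normalSq hn hx hmin a q
  have h2 : Gam (n := n) x (gradM n x (normalSq n x a)) x q = 0 := by
    have : gradM n x (normalSq n x a) = fun _ => 0 := by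
      ext r k
      rw [hN]
      change Gam (n := n) x (fun _ => (1 : ℝ)) _ r = 0
      simp only [Gam, carre, Function.comp_def, pd_const, inner_zero_left, mul_zero,
        Finset.sum_const_zero]
    simp only [this, Gam, carre, Function.comp_def, pd_const, inner_zero_left, mul_zero,
      Finset.sum_const_zero]
  have h3 := normalEnergy_le hn hx hmin a q
  have h4 := sqNormSFF_nonneg hx hmin q
  rw [h2, hN] at h1
  rw [hG, mul_zero] at h3
  have hn' : (1 : ℝ) ≤ n := by exact_mod_cast hn
  have h5 : normalEnergy n x a q = sqNormSFF (n := n) x q := by linarith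
  rw [h5] at h3
  nlinarith

lemma exists_unit_normal (hx : IsSphericalImmersion (n := n) x) (hmin : IsMinimal (n := n) x)
    (p : M) : ∃ ν₀ : E (n + 2), ‖ν₀‖ = 1 ∧ ∀ a, normalSq n x a p = inner ℝ ν₀ a ^ 2 := by
  obtain ⟨ν, U, hy, hU, h⟩ := exists_local hx hmin p (coord_mem_target p)
  refine ⟨ν (coord p), ?_, fun a => ?_⟩
  · have := h.normal_self _ hy
    rw [real_inner_self_eq_norm_sq] at this
    exact (pow_eq_one_iff_of_nonneg (norm_nonneg _) two_ne_zero).1 this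
  · rw [← h.normalSq_eq hx hU hy a, ch_symm_coord]

variable [T2Space M] [CompactSpace M] [ConnectedSpace M] [MeasurableSpace M] [BorelSpace M]

lemma heightMean_le (hx : IsSphericalImmersion (n := n) x) (hmin : IsMinimal (n := n) x)
    {a : E (n + 2)} (ha : ‖a‖ = 1) : heightMean (n := n) x a ≤ 1 / ((n : ℝ) + 1) := by
  have hV := vol_real_pos hx
  have h := integral_normalSq hx hmin a
  have h0 : 0 ≤ ∫ q, normalSq n x a q ∂(vol (n := n) x) :=
    integral_nonneg fun q => normalSq_nonneg hx hmin a q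
  rw [h, ha, integral_height_sq hx] at h0
  rw [le_div_iff₀ (by positivity)]
  by_contra! hc
  nlinarith

lemma heightMean_eq_top_iff (hx : IsSphericalImmersion (n := n) x) (hmin : IsMinimal (n := n) x)
    {a : E (n + 2)} (ha : ‖a‖ = 1) :
    heightMean (n := n) x a = 1 / ((n : ℝ) + 1) ↔ ∀ q, normalSq n x a q = 0 := by
  have hV := vol_real_pos hx
  have h := integral_normalSq hx hmin a
  rw [ha, integral_height_sq hx] at h
  constructor
  · intro he
    refine eq_zero_of_integral_eq_zero hx (continuous_normalSq hx a) (normalSq_nonneg hx hmin a) ?_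
    rw [h, he]; field_simp; ring
  · intro he
    simp only [he, integral_zero] at h
    have : (1 - (n + 1) * heightMean (n := n) x a) * (vol (n := n) x).real Set.univ = 0 := by
      linarith
    have := (mul_eq_zero.1 this).resolve_right hV.ne'
    field_simp
    linarith

lemma heightMean_eq_zero_iff (hx : IsSphericalImmersion (n := n) x) (a : E (n + 2)) :
    heightMean (n := n) x a = 0 ↔ ∀ q, height x a q = 0 := by
  constructor
  · intro h q
    have hi := integral_height_sq hx a
    rw [h, zero_mul] at hi
    exact pow_eq_zero_iff two_ne_zero |>.1 (eq_zero_of_integral_eq_zero hx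
      ((continuous_height hx a).pow 2) (fun q => sq_nonneg _) hi q)
  · intro h
    simp [heightMean_eq, h]

lemma iInf_eq_zero_iff (hn : 1 ≤ n) (hx : IsSphericalImmersion (n := n) x)
    (hmin : IsMinimal (n := n) x) :
    (⨅ a : Metric.sphere (0 : E (n + 2)) 1, heightMean (n := n) x a) = 0
      ↔ IsTotallyGeodesic (n := n) x := by
  obtain ⟨a, ha, h⟩ := exists_heightMean_eq_iInf hx
  constructor
  · intro h0
    rw [h, heightMean_eq_zero_iff hx] at h0
    exact isTotallyGeodesic_of_height_eq_zero hn hx hmin ha h0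
  · intro ht
    obtain ⟨p⟩ := (inferInstance : Nonempty M)
    obtain ⟨ν₀, hν, hN⟩ := exists_unit_normal hx hmin p
    refine le_antisymm ((iInf_heightMean_le ν₀ hν).trans (le_of_eq ?_)) ?_
    · rw [heightMean_eq_zero_iff hx]
      intro q
      have h1 := normalSq_eq_of_isTotallyGeodesic hx hmin ht ν₀ q p
      rw [hN, real_inner_self_eq_norm_sq, normalSq, hν] at h1
      have := Gam_self_nonneg (n := n) (x := x) (height x ν₀) q
      exact pow_eq_zero_iff two_ne_zero |>.1 (le_antisymm (by linarith) (sq_nonneg _))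
    · rw [h]; exact heightMean_nonneg a

lemma iSup_eq_iff (hx : IsSphericalImmersion (n := n) x)
    (hmin : IsMinimal (n := n) x) :
    (⨆ a : Metric.sphere (0 : E (n + 2)) 1, heightMean (n := n) x a) = 1 / ((n : ℝ) + 1)
      ↔ IsTotallyGeodesic (n := n) x := by
  obtain ⟨a, ha, h, hmax⟩ := exists_heightMean_eq_iSup hx
  constructor
  · intro h0
    rw [h, heightMean_eq_top_iff hx hmin ha] at h0
    exact isTotallyGeodesic_of_normalSq_eq_zero hx hmin ha h0
  · intro ht
    obtain ⟨p⟩ := (inferInstance : Nonempty M)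
    obtain ⟨ν₀, hν, hN⟩ := exists_unit_normal hx hmin p
    obtain ⟨b, hb⟩ := exists_orthonormalBasis ν₀ hν
    have hb1 : inner ℝ ν₀ (b 1) = (0 : ℝ) := by
      rw [← hb]; exact b.orthonormal.2 (by simp)
    rw [h]
    refine le_antisymm (heightMean_le hx hmin ha) ?_
    rw [← (heightMean_eq_top_iff hx hmin (b.norm_eq_one 1)).2 fun q => ?_]
    · exact hmax _ (b.norm_eq_one 1)
    · rw [normalSq_eq_of_isTotallyGeodesic hx hmin ht _ q p, hN, hb1]; ring

end Extreme

section ConstantScalarCurvature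

variable {n : ℕ} {M : Type*} [TopologicalSpace M] [ChartedSpace (E n) M]
  [IsManifold (𝓡 n) ∞ M] {x : M → E (n + 2)}

lemma IsCSC.exists_sqNormSFF_eq (h : IsCSC (n := n) x) (hx : IsSphericalImmersion (n := n) x)
    (hmin : IsMinimal (n := n) x) : ∃ s : ℝ, ∀ q, sqNormSFF (n := n) x q = s := by
  obtain ⟨c, hc⟩ := h
  refine ⟨n * ((n : ℝ) - 1) - c, fun q => ?_⟩
  rw [← hc q, scalar_eq_sub hx hmin]; ring

lemma isTotallyGeodesic_iff_const [Nonempty M] (hx : IsSphericalImmersion (n := n) x)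
    (hmin : IsMinimal (n := n) x) {s : ℝ} (hs : ∀ q, sqNormSFF (n := n) x q = s) :
    IsTotallyGeodesic (n := n) x ↔ s = 0 := by
  rw [isTotallyGeodesic_iff hx hmin]
  simp only [hs]
  simp

variable [T2Space M] [CompactSpace M] [ConnectedSpace M] [MeasurableSpace M] [BorelSpace M]

lemma isIntegralEinstein_iff (hn : 1 ≤ n) (hx : IsSphericalImmersion (n := n) x)
    (hmin : IsMinimal (n := n) x) {s : ℝ} (hs : ∀ q, sqNormSFF (n := n) x q = s) (hs0 : s ≠ 0) :
    IsIntegralEinstein (n := n) x ↔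
      ∀ a : E (n + 2), ‖a‖ = 1 → heightMean (n := n) x a = 1 / ((n : ℝ) + 2) := by
  have hV := vol_real_pos hx
  refine forall_congr' fun a => forall_congr' fun ha => ?_
  rw [integral_tracelessRicci hn hx hmin hs ha, integral_height_sq hx]
  have : s * ((n + 2) * (heightMean (n := n) x a * (vol (n := n) x).real Set.univ)
      - (vol (n := n) x).real Set.univ)
      = (s * (vol (n := n) x).real Set.univ) * ((n + 2) * heightMean (n := n) x a - 1) := by ring
  rw [this, mul_eq_zero, or_iff_right (mul_ne_zero hs0 hV.ne'), sub_eq_zero,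
    eq_div_iff (by positivity), mul_comm]

lemma iInf_eq_average_iff (hn : 1 ≤ n) (hx : IsSphericalImmersion (n := n) x)
    (hmin : IsMinimal (n := n) x) {s : ℝ} (hs : ∀ q, sqNormSFF (n := n) x q = s) :
    (⨅ a : Metric.sphere (0 : E (n + 2)) 1, heightMean (n := n) x a) = 1 / ((n : ℝ) + 2)
      ↔ IsIntegralEinstein (n := n) x ∧ ¬ IsTotallyGeodesic (n := n) x := by
  constructor
  · intro h
    have ht : ¬ IsTotallyGeodesic (n := n) x := by
      rw [← iInf_eq_zero_iff hn hx hmin, h]; positivity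
    refine ⟨(isIntegralEinstein_iff hn hx hmin hs
      fun h0 => ht ((isTotallyGeodesic_iff_const hx hmin hs).2 h0)).2 fun a ha => ?_, ht⟩
    exact heightMean_eq_of_bound hx (Or.inl fun a ha => h ▸ iInf_heightMean_le a ha) ha
  · rintro ⟨h, ht⟩
    rw [isIntegralEinstein_iff hn hx hmin hs
      fun h0 => ht ((isTotallyGeodesic_iff_const hx hmin hs).2 h0)] at h
    obtain ⟨a, ha, e⟩ := exists_heightMean_eq_iInf hx
    rw [e, h a ha]

lemma iSup_eq_average_iff (hn : 1 ≤ n) (hx : IsSphericalImmersion (n := n) x)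
    (hmin : IsMinimal (n := n) x) {s : ℝ} (hs : ∀ q, sqNormSFF (n := n) x q = s) :
    (⨆ a : Metric.sphere (0 : E (n + 2)) 1, heightMean (n := n) x a) = 1 / ((n : ℝ) + 2)
      ↔ IsIntegralEinstein (n := n) x ∧ ¬ IsTotallyGeodesic (n := n) x := by
  obtain ⟨a, ha, e, hmax⟩ := exists_heightMean_eq_iSup hx
  constructor
  · intro h
    have ht : ¬ IsTotallyGeodesic (n := n) x := by
      rw [← iSup_eq_iff hx hmin, h]
      intro h1
      field_simp at h1
      linarith
    refine ⟨(isIntegralEinstein_iff hn hx hmin hs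
      fun h0 => ht ((isTotallyGeodesic_iff_const hx hmin hs).2 h0)).2 fun b hb => ?_, ht⟩
    exact heightMean_eq_of_bound hx (Or.inr fun b hb => by
      rw [← h, e]; exact hmax b hb) hb
  · rintro ⟨h, ht⟩
    rw [isIntegralEinstein_iff hn hx hmin hs
      fun h0 => ht ((isTotallyGeodesic_iff_const hx hmin hs).2 h0)] at h
    rw [e, h a ha]

/-- The defect in the lower bound for the form, as an integral. -/
lemma integral_energy_defect (hn : 1 ≤ n) (hx : IsSphericalImmersion (n := n) x)
    (hmin : IsMinimal (n := n) x) {s : ℝ} (hs : ∀ q, sqNormSFF (n := n) x q = s) {a : E (n + 2)}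
    (ha : ‖a‖ = 1) :
    ∫ q, ((n - 1) * s * Gam (n := n) x (height x a) (height x a) q - n * normalEnergy n x a q)
        ∂(vol (n := n) x)
      = n * s * (2 * n * heightMean (n := n) x a - 1) * (vol (n := n) x).real Set.univ := by
  have i2 := integrable_vol hx
    (contMDiff_Gam hx (contMDiff_height hx a) (contMDiff_height hx a)).continuous
  rw [integral_sub (i2.const_mul _)
    ((integrable_vol hx (continuous_normalEnergy hn hx hmin a)).const_mul _),
    integral_const_mul, integral_const_mul, integral_Gam_height hx hmin,
    integral_normalEnergy hn hx hmin hs, integral_normalSq hx hmin, ha, integral_height_sq hx]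
  ring

lemma le_heightMean (hn : 1 ≤ n) (hx : IsSphericalImmersion (n := n) x)
    (hmin : IsMinimal (n := n) x) {s : ℝ} (hs : ∀ q, sqNormSFF (n := n) x q = s) (hs0 : 0 < s)
    {a : E (n + 2)} (ha : ‖a‖ = 1) : 1 / (2 * (n : ℝ)) ≤ heightMean (n := n) x a := by
  have hV := vol_real_pos hx
  have hn' : (0 : ℝ) < n := by exact_mod_cast hn
  have h := integral_energy_defect hn hx hmin hs ha
  have h0 : 0 ≤ ∫ q, ((n - 1) * s * Gam (n := n) x (height x a) (height x a) q
      - n * normalEnergy n x a q) ∂(vol (n := n) x) := by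
    refine integral_nonneg fun q => ?_
    have := normalEnergy_le hn hx hmin a q
    rw [hs] at this
    simp only [Pi.zero_apply]
    linarith
  rw [h] at h0
  rw [div_le_iff₀ (by positivity)]
  by_contra! hc
  have h1 : 0 < n * s * (vol (n := n) x).real Set.univ := by positivity
  nlinarith

lemma normalEnergy_eq_of_heightMean_eq (hn : 1 ≤ n) (hx : IsSphericalImmersion (n := n) x)
    (hmin : IsMinimal (n := n) x) {s : ℝ} (hs : ∀ q, sqNormSFF (n := n) x q = s)
    {a : E (n + 2)} (ha : ‖a‖ = 1) (he : heightMean (n := n) x a = 1 / (2 * (n : ℝ))) (q : M) :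
    n * normalEnergy n x a q = (n - 1) * s * Gam (n := n) x (height x a) (height x a) q := by
  have hn' : (0 : ℝ) < n := by exact_mod_cast hn
  have h := integral_energy_defect hn hx hmin hs ha
  rw [he] at h
  have hc : Continuous fun q => (n - 1) * s * Gam (n := n) x (height x a) (height x a) q
      - n * normalEnergy n x a q :=
    (continuous_const.mul (contMDiff_Gam hx (contMDiff_height hx a)
      (contMDiff_height hx a)).continuous).sub
      (continuous_const.mul (continuous_normalEnergy hn hx hmin a))
  have := eq_zero_of_integral_eq_zero hx hc (fun q => by
    have := normalEnergy_le hn hx hmin a q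
    rw [hs] at this
    linarith) (by rw [h]; field_simp; ring) q
  linarith

end ConstantScalarCurvature

/-! ### The shape operator in the equality case -/

section Local

variable {n : ℕ} {f ν : E n → E (n + 2)} {U : Set (E n)} {y : E n} {α β s κ : ℝ}

/-- The squared defect of the relation `A² = α A + β`. -/
def quadDefect {N : ℕ} (f ν : E n → E N) (α β : ℝ) (y : E n) : ℝ :=
  ∑ i, ∑ j, (inner ℝ (pd i ν y) (pd j ν y) - (α * sff f ν i j y + β * gram f y i j)) ^ 2

lemma quadDefect_eq_zero_iff {N : ℕ} {f ν : E n → E N} :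
    quadDefect f ν α β y = 0 ↔ QuadRel f ν α β y := by
  constructor
  · intro h i j
    have h1 := (Finset.sum_eq_zero_iff_of_nonneg fun i _ => Finset.sum_nonneg fun j _ =>
      sq_nonneg _).1 h i (Finset.mem_univ _)
    have h2 := (Finset.sum_eq_zero_iff_of_nonneg fun j _ => sq_nonneg _).1 h1 j (Finset.mem_univ _)
    exact sub_eq_zero.1 (pow_eq_zero_iff two_ne_zero |>.1 h2)
  · intro h
    refine Finset.sum_eq_zero fun i _ => Finset.sum_eq_zero fun j _ => ?_
    rw [h i j, sub_self]; ring

namespace IsLocalHypersurface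

lemma mono (h : IsLocalHypersurface f ν U) {V : Set (E n)} (hV : IsOpen V) (hVU : V ⊆ U) :
    IsLocalHypersurface f ν V where
  toIsFramed := h.toIsFramed.mono hV hVU
  minimal y hy := h.minimal y (hVU hy)

lemma neg (h : IsLocalHypersurface f ν U) : IsLocalHypersurface f (fun z => - ν z) U where
  isOpen := h.isOpen
  smooth := h.smooth
  smooth_normal := h.smooth_normal.neg
  det := h.det
  inner_self := h.inner_self
  normal_self y hy := by rw [inner_neg_neg]; exact h.normal_self y hy
  inner_normal y hy := by rw [inner_neg_right, h.inner_normal y hy, neg_zero]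
  pd_normal y hy i := by rw [inner_neg_right, h.pd_normal y hy i, neg_zero]
  minimal y hy := by
    have := h.minimal y hy
    simp only [carre, pd_neg, inner_neg_left, mul_neg, Finset.sum_neg_distrib] at this ⊢
    rw [this, neg_zero]

lemma continuousOn_quadDefect (h : IsLocalHypersurface f ν U) (α β : ℝ) :
    ContinuousOn (quadDefect f ν α β) U := by
  refine continuousOn_finsetSum _ fun i _ => continuousOn_finsetSum _ fun j _ => ?_
  have h1 := ((contDiffOn_pd h.smooth_normal h.isOpen i).inner ℝ
    (contDiffOn_pd h.smooth_normal h.isOpen j)).continuousOn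
  exact (h1.sub ((continuousOn_const.mul (h.contDiffOn_sff i j).continuousOn).add
    (continuousOn_const.mul (contDiffOn_gram h.smooth h.isOpen i j).continuousOn))).pow 2

lemma laplacian_add (h : IsLocalHypersurface f ν U) (hy : y ∈ U) {u v : E n → ℝ}
    (hu : ContDiffOn ℝ ∞ u U) (hv : ContDiffOn ℝ ∞ v U) :
    carre f (grad f fun z => u z + v z) f y = carre f (grad f u) f y + carre f (grad f v) f y := by
  have e : ∀ i, pd i (grad f fun z => u z + v z) y = pd i (grad f u) y + pd i (grad f v) y := by
    intro i
    rw [← pd_add (differentiableAt_of_contDiffOn (h.contDiffOn_grad hu) h.isOpen hy)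
      (differentiableAt_of_contDiffOn (h.contDiffOn_grad hv) h.isOpen hy)]
    refine pd_congr_of_isOpen h.isOpen hy (fun z hz => ?_) i
    simp only [grad, raise, pd_add (differentiableAt_of_contDiffOn hu h.isOpen hz)
      (differentiableAt_of_contDiffOn hv h.isOpen hz), mul_add, add_smul, Finset.sum_add_distrib]
  simp only [carre, e, inner_add_left, mul_add, Finset.sum_add_distrib]

/-- Where the length of the shape operator is positive, no height function has vanishing gradient
on an open set if it attains equality in the inequality for `|A aᵀ|²`. -/
lemma exists_carre_height_ne_zero (h : IsLocalHypersurface f ν U) (hn : 1 ≤ n) (hs0 : 0 < s)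
    (hs : ∀ z ∈ U, carre f ν ν z = s) {a : E (n + 2)} (ha : ‖a‖ = 1) (hy : y ∈ U) :
    ∃ z ∈ U, carre f (fun z => inner ℝ (f z) a) (fun z => inner ℝ (f z) a) z ≠ 0 := by
  by_contra! h0
  have hn' : (1 : ℝ) ≤ n := by exact_mod_cast hn
  have hu := contDiffOn_inner_const h.smooth a
  have hv := contDiffOn_inner_const h.smooth_normal a
  have e : ∀ z ∈ U, inner ℝ (f z) a ^ 2 + inner ℝ (ν z) a ^ 2 = 1 := by
    intro z hz
    have := h.carre_height hz a a
    rw [h0 z hz, real_inner_self_eq_norm_sq, ha] at this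
    linarith
  -- the sum of the squares is constant and its Laplacian is `-2 (n φ² + S ψ² - |∇ψ|²)`
  have h1 : carre f (grad f fun z => inner ℝ (f z) a ^ 2 + inner ℝ (ν z) a ^ 2) f y = 0 := by
    have hg : Set.EqOn (grad f fun z => inner ℝ (f z) a ^ 2 + inner ℝ (ν z) a ^ 2)
        (fun _ => 0) U := by
      intro z hz
      have : ∀ i, pd i (fun z => inner ℝ (f z) a ^ 2 + inner ℝ (ν z) a ^ 2) z = 0 := fun i => by
        rw [pd_congr_of_isOpen h.isOpen hz e i, pd_const]
      simp [grad, raise, this]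
    simp only [carre, pd_congr_of_isOpen h.isOpen hy hg, pd_const, inner_zero_left, mul_zero,
      Finset.sum_const_zero]
  rw [h.laplacian_add hy (hu.pow 2) (hv.pow 2)] at h1
  have h2 := h.laplacian_height_sq hy a
  have h3 := h.laplacian_normal_sq hy a
  have h4 := h.carre_normal_le hn hy a
  rw [h0 y hy] at h2 h4
  rw [hs y hy] at h3
  rw [mul_zero] at h4
  have h1' : carre f (grad f fun z => inner ℝ (f z) a ^ 2) f y
      + carre f (grad f fun z => inner ℝ (ν z) a ^ 2) f y = 0 := h1
  rw [h2, h3] at h1'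
  have h5 : carre f (fun z => inner ℝ (ν z) a) (fun z => inner ℝ (ν z) a) y ≤ 0 := by
    by_contra! hc
    have : 0 < n * carre f (fun z => inner ℝ (ν z) a) (fun z => inner ℝ (ν z) a) y := by
      positivity
    linarith
  have h6 := e y hy
  have h7 : 0 ≤ (n : ℝ) * inner ℝ (f y) a ^ 2 := by positivity
  have h8 : 0 ≤ s * inner ℝ (ν y) a ^ 2 := by positivity
  have h9 : (n : ℝ) * inner ℝ (f y) a ^ 2 = 0 := by linarith
  have h10 : s * inner ℝ (ν y) a ^ 2 = 0 := by linarith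
  have h11 := (mul_eq_zero.1 h9).resolve_left (by linarith)
  have h12 := (mul_eq_zero.1 h10).resolve_left hs0.ne'
  rw [h11, h12] at h6
  norm_num at h6

lemma exists_sff_ne_zero (h : IsLocalHypersurface f ν U) (hy : y ∈ U) (h0 : carre f ν ν y ≠ 0) :
    ∃ i j, sff f ν i j y ≠ 0 := by
  by_contra! hc
  apply h0
  rw [h.carre_normal_normal hy]
  simp [hc]

/-- In the equality case the unit normal can be chosen, locally, such that the shape operator has
the eigenvalues of the Clifford torus. -/
lemma exists_quadRel_normal (h : IsLocalHypersurface f ν U) (hn : 3 ≤ n) (hκ0 : 0 < κ)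
    (hs : ∀ z ∈ U, carre f ν ν z = n * κ ^ 2 / (n - 1)) {a : E (n + 2)} (ha : ‖a‖ = 1)
    (heq : ∀ z ∈ U, n * carre f (fun z => inner ℝ (ν z) a) (fun z => inner ℝ (ν z) a) z
      = (n - 1) * carre f ν ν z
        * carre f (fun z => inner ℝ (f z) a) (fun z => inner ℝ (f z) a) z) (hy : y ∈ U) :
    ∃ (ν' : E n → E (n + 2)) (V : Set (E n)), y ∈ V ∧ V ⊆ U ∧ IsLocalHypersurface f ν' V ∧
      ∀ z ∈ V, QuadRel f ν' (κ * (n - 2) / (n - 1)) (κ ^ 2 / (n - 1)) z := by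
  have hn3 : (3 : ℝ) ≤ n := by exact_mod_cast hn
  have hn1 : (0 : ℝ) < n - 1 := by linarith
  have hs0 : (0 : ℝ) < n * κ ^ 2 / (n - 1) := by positivity
  set α := κ * (n - 2) / (n - 1) with hα
  set β := κ ^ 2 / (n - 1) with hβ
  have hα0 : α ≠ 0 := by
    have : (0 : ℝ) < n - 2 := by linarith
    positivity
  obtain ⟨r, hr, hb⟩ := Metric.isOpen_iff.1 h.isOpen _ hy
  set B := Metric.ball y r with hB
  have hBo : IsOpen B := Metric.isOpen_ball
  have hL := h.mono hBo hb
  have c1 := hL.continuousOn_quadDefect α β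
  have c2 := hL.continuousOn_quadDefect (-α) β
  -- the relation holds with one of the two signs on a dense set, and so everywhere
  have hprod : ∀ z ∈ B, quadDefect f ν α β z * quadDefect f ν (-α) β z = 0 := by
    intro z hz
    by_contra hne
    have hW : IsOpen (B ∩ (fun w => quadDefect f ν α β w * quadDefect f ν (-α) β w) ⁻¹' {0}ᶜ) :=
      (c1.mul c2).isOpen_inter_preimage hBo isOpen_compl_singleton
    obtain ⟨w, hw, hw0⟩ := (hL.mono hW Set.inter_subset_left).exists_carre_height_ne_zero
      (by omega) hs0 (fun z hz => hs z (hb hz.1)) ha ⟨hz, hne⟩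
    apply hw.2
    obtain ⟨c, hc1, hc2⟩ := hL.quadRel_of_eq hn hw.1 hw0 (heq w (hb hw.1))
    rw [hs w (hb hw.1)] at hc1
    have hcc : c ^ 2 = κ ^ 2 := by
      have : (n : ℝ) * (n - 1) ≠ 0 := by positivity
      field_simp at hc1
      linarith
    rcases sq_eq_sq_iff_eq_or_eq_neg.1 hcc with rfl | rfl
    · simp only [Set.mem_singleton_iff]
      rw [quadDefect_eq_zero_iff.2 hc2, zero_mul]
    · simp only [Set.mem_singleton_iff]
      rw [neg_sq, neg_mul, neg_div] at hc2
      rw [quadDefect_eq_zero_iff.2 hc2, mul_zero]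
  -- the two signs exclude each other
  have hexcl : ∀ z ∈ B, quadDefect f ν α β z = 0 → quadDefect f ν (-α) β z ≠ 0 := by
    intro z hz h1 h2
    rw [quadDefect_eq_zero_iff] at h1 h2
    obtain ⟨i, j, hij⟩ := hL.exists_sff_ne_zero hz (by rw [hs z (hb hz)]; exact hs0.ne')
    have := (h1 i j).symm.trans (h2 i j)
    have h3 : α * sff f ν i j z = 0 := by linarith
    exact (mul_ne_zero hα0 hij) h3
  -- both zero sets are closed and cover the ball, which is connected
  have hcases : (∀ z ∈ B, QuadRel f ν α β z) ∨ ∀ z ∈ B, QuadRel f ν (-α) β z := by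
    have o1 := c1.isOpen_inter_preimage hBo (isOpen_compl_singleton (x := (0 : ℝ)))
    have o2 := c2.isOpen_inter_preimage hBo (isOpen_compl_singleton (x := (0 : ℝ)))
    have hd : Disjoint (B ∩ quadDefect f ν α β ⁻¹' {0}ᶜ) (B ∩ quadDefect f ν (-α) β ⁻¹' {0}ᶜ) := by
      rw [Set.disjoint_left]
      rintro z ⟨hz, h1⟩ ⟨-, h2⟩
      exact (mul_ne_zero h1 h2) (hprod z hz)
    have hcov : B ⊆ (B ∩ quadDefect f ν α β ⁻¹' {0}ᶜ) ∪ (B ∩ quadDefect f ν (-α) β ⁻¹' {0}ᶜ) := by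
      intro z hz
      by_cases h1 : quadDefect f ν α β z = 0
      · exact Or.inr ⟨hz, hexcl z hz h1⟩
      · exact Or.inl ⟨hz, h1⟩
    rcases (convex_ball y r).isPreconnected.subset_or_subset o1 o2 hd hcov with hsub | hsub
    · right
      intro z hz
      exact quadDefect_eq_zero_iff.1 ((mul_eq_zero.1 (hprod z hz)).resolve_left (hsub hz).2)
    · left
      intro z hz
      exact quadDefect_eq_zero_iff.1 ((mul_eq_zero.1 (hprod z hz)).resolve_right (hsub hz).2)
  rcases hcases with hc | hc
  · exact ⟨ν, B, Metric.mem_ball_self hr, hb, hL, hc⟩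
  · refine ⟨fun z => - ν z, B, Metric.mem_ball_self hr, hb, hL.neg, fun z hz i j => ?_⟩
    have := hc z hz i j
    simp only [sff, pd_neg, inner_neg_left, inner_neg_right, neg_neg] at this ⊢
    rw [this]; ring

/-- Two unit normals agree up to sign, to first order. -/
lemma normal_unique (h : IsLocalHypersurface f ν U) {ν' : E n → E (n + 2)} {U' : Set (E n)}
    (h' : IsLocalHypersurface f ν' U') (hy : y ∈ U) (hy' : y ∈ U') :
    ∃ ε : ℝ, (ε = 1 ∨ ε = -1) ∧ ν' y = ε • ν y ∧ (∀ i j, sff f ν' i j y = ε * sff f ν i j y) ∧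
      ∀ i, pd i ν' y = ε • pd i ν y := by
  have e := h.expand hy (ν' y)
  rw [h'.inner_normal y hy'] at e
  simp only [h'.pd_normal y hy'] at e
  set ε : ℝ := inner ℝ (ν y) (ν' y) with hε
  have e1 : ν' y = ε • ν y := by
    rw [e]; simp [raise]
  have hε2 : ε ^ 2 = 1 := by
    have := h'.normal_self y hy'
    rw [e1, inner_smul_left, inner_smul_right, h.normal_self y hy] at this
    simp only [RCLike.conj_to_real] at this
    linarith
  have hsff : ∀ i j, sff f ν' i j y = ε * sff f ν i j y := by
    intro i j
    rw [← h.inner_pd_pd_normal hy, ← h'.inner_pd_pd_normal hy', e1, inner_smul_right]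
  refine ⟨ε, sq_eq_sq_iff_eq_or_eq_neg.1 (hε2.trans (one_pow 2).symm), e1, hsff, fun i => ?_⟩
  rw [h.weingarten hy, h'.weingarten hy', smul_neg]
  simp only [raise, hsff, Finset.smul_sum, smul_smul]
  congr 1
  refine Finset.sum_congr rfl fun k _ => Finset.sum_congr rfl fun l _ => ?_
  congr 1; ring

/-- The square of the torus form does not depend on the choice of a unit normal for which the
quadratic relation holds. -/
lemma torusForm_sq_unique (h : IsLocalHypersurface f ν U) {ν' : E n → E (n + 2)} {U' : Set (E n)}
    (h' : IsLocalHypersurface f ν' U') (hy : y ∈ U) (hy' : y ∈ U') (hr : QuadRel f ν α β y)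
    (hr' : QuadRel f ν' α β y) (h0 : carre f ν ν y ≠ 0) (b : E (n + 2)) :
    torusForm f ν' α b y ^ 2 = torusForm f ν α b y ^ 2 := by
  obtain ⟨ε, hε, e1, e2, e3⟩ := h.normal_unique h' hy hy'
  have hc : carre f (fun z => inner ℝ (ν' z) b) (fun z => inner ℝ (f z) b) y
      = ε * carre f (fun z => inner ℝ (ν z) b) (fun z => inner ℝ (f z) b) y := by
    simp only [carre, pd_inner_const (h.diff_normal hy), pd_inner_const (h'.diff_normal hy'), e3,
      inner_smul_left, Finset.mul_sum, RCLike.conj_to_real]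
    refine Finset.sum_congr rfl fun i _ => Finset.sum_congr rfl fun j _ => ?_
    simp only [RCLike.inner_apply, conj_trivial]
    ring
  rw [torusForm, torusForm, hc, e1, inner_smul_left, RCLike.conj_to_real]
  rcases hε with rfl | rfl
  · simp
  · obtain ⟨i, j, hij⟩ := h.exists_sff_ne_zero hy h0
    have := hr' i j
    rw [e3, e3, e2, inner_smul_left, inner_smul_right, hr i j] at this
    simp only [RCLike.conj_to_real] at this
    have hα : α * sff f ν i j y = 0 := by linarith
    rw [(mul_eq_zero.1 hα).resolve_right hij]
    ring

end IsLocalHypersurface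

end Local

/-! ### The equality case on the manifold -/

section EqualityCase

variable {n : ℕ} {M : Type*} [TopologicalSpace M] [ChartedSpace (E n) M]
  {x : M → E (n + 2)} {α β : ℝ}

/-- A local hypersurface in the chart at `p`, near `p`, whose shape operator satisfies
`A² = α A + β`. -/
structure IsQuadraticAt (x : M → E (n + 2)) (α β : ℝ) (p : M) (ν : E n → E (n + 2))
    (U : Set (E n)) : Prop extends IsLocalHypersurface (param x p) ν U where
  coord_mem : coord p ∈ U
  subset_target : U ⊆ (ch n p).target
  quadRel : ∀ y ∈ U, QuadRel (param x p) ν α β y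

lemma IsQuadraticAt.torusForm_self {p : M} {ν : E n → E (n + 2)} {U : Set (E n)}
    (h : IsQuadraticAt x α β p ν U) : torusForm (param x p) ν α (x p) (coord p) = 0 := by
  have e : param x p (coord p) = x p := congrArg x (ch_symm_coord (n := n) p)
  have h1 := h.inner_normal _ h.coord_mem
  have h2 := fun i => h.pd_inner_self h.coord_mem i
  rw [real_inner_comm, e] at h1
  rw [e] at h2
  have h3 : carre (param x p) (fun z => inner ℝ (ν z) (x p))
      (fun z => inner ℝ (param x p z) (x p)) (coord p) = 0 := by
    simp [carre, pd_inner_const (h.diff h.coord_mem), h2]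
  rw [torusForm, h3, h1]; ring

variable [IsManifold (𝓡 n) ∞ M]

/-- In the equality case, unit normals with quadratic shape operator exist locally. -/
lemma exists_isQuadraticAt (hn : 2 ≤ n) (hx : IsSphericalImmersion (n := n) x)
    (hmin : IsMinimal (n := n) x) {κ : ℝ} (hκ : 0 < κ)
    (hs : ∀ q, sqNormSFF (n := n) x q = n * κ ^ 2 / (n - 1)) {a : E (n + 2)} (ha : ‖a‖ = 1)
    (heq : ∀ q, n * normalEnergy n x a q
      = (n - 1) * (n * κ ^ 2 / (n - 1)) * Gam (n := n) x (height x a) (height x a) q) (p : M) :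
    ∃ ν U, IsQuadraticAt x (κ * (n - 2) / (n - 1)) (κ ^ 2 / (n - 1)) p ν U := by
  obtain ⟨ν, U, hy, hU, h⟩ := exists_local hx hmin p (coord_mem_target p)
  have hS : ∀ z ∈ U, carre (param x p) ν ν z = n * κ ^ 2 / (n - 1) := fun z hz => by
    rw [← h.sqNormSFF_eq hU hz, hs]
  rcases hn.lt_or_eq with hn3 | rfl
  · obtain ⟨ν', V, hyV, hVU, hL, hq⟩ := h.exists_quadRel_normal hn3 hκ hS ha (fun z hz => by
      have := heq ((ch n p).symm z)
      rw [h.normalEnergy_eq (by omega) hx hU hz, IsLocalHypersurface.Gam_height_eq hx hU hz] at this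
      rw [hS z hz]; exact this) hy
    exact ⟨ν', V, hL, hyV, hVU.trans hU, hq⟩
  · refine ⟨ν, U, h, hy, hU, fun y hy => ?_⟩
    have := h.quadRel_surface hy
    rw [hS y hy] at this
    convert this using 1
    · norm_num
    · push_cast; ring

namespace IsQuadraticAt

variable {p : M} {ν : E n → E (n + 2)} {U : Set (E n)}

lemma quadRel_transfer (h : IsQuadraticAt x α β p ν U) (q : M) {z : E n}
    (hz : z ∈ pullDom q p U) : QuadRel (param x q) (ν ∘ trans n q p) α β z := by
  have hN := (isOpen_transDom (n := n) q p).mem_nhds hz.1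
  have d := differentiableAt_of_contDiffOn (contDiffOn_trans q p) (isOpen_transDom q p) hz.1
  have := (quadRel_comp (h.diff hz.2) (h.diff_normal hz.2) d (isUnit_jacobian_trans hz.1)).2
    (h.quadRel _ hz.2)
  have e : ∀ i, pd i (param x q) z = pd i (param x p ∘ trans n q p) z :=
    pd_congr ((comp_trans_eqOn x q p).eventuallyEq_of_mem hN)
  intro i j
  have hij := this i j
  simp only [sff, gram, Matrix.of_apply, e] at hij ⊢
  exact hij

lemma torusForm_transfer (h : IsQuadraticAt x α β p ν U) (q : M) {z : E n}
    (hz : z ∈ pullDom q p U) (b : E (n + 2)) :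
    torusForm (param x q) (ν ∘ trans n q p) α b z = torusForm (param x p) ν α b (trans n q p z) := by
  have hN := (isOpen_transDom (n := n) q p).mem_nhds hz.1
  have hc := carre_transfer h.toIsFramed hz
    (differentiableAt_of_contDiffOn (contDiffOn_inner_const h.smooth_normal b) h.isOpen hz.2)
    (differentiableAt_of_contDiffOn (contDiffOn_inner_const h.smooth b) h.isOpen hz.2)
  have hx : (fun w => inner ℝ (param x q w) b)
      =ᶠ[nhds z] (fun w => inner ℝ (param x p w) b) ∘ trans n q p :=
    (comp_trans_eqOn (fun r => inner ℝ (x r) b) q p).eventuallyEq_of_mem hN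
  have hc' : carre (param x q) (fun w => inner ℝ ((ν ∘ trans n q p) w) b)
      (fun w => inner ℝ (param x q w) b) z
      = carre (param x p) (fun w => inner ℝ (ν w) b) (fun w => inner ℝ (param x p w) b)
        (trans n q p z) := by
    rw [← hc]
    exact carre_congr Filter.EventuallyEq.rfl Filter.EventuallyEq.rfl hx
  have hz' : param x q z = param x p (trans n q p z) := comp_trans_eqOn x q p hz.1
  rw [torusForm, torusForm, hc', hz']
  rfl

/-- The torus forms of two points connected by a chart agree up to sign. -/
lemma torusForm_sq_eq (h : IsQuadraticAt x α β p ν U)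
    {y : E n} (hy : y ∈ U) (hS : carre (param x p) ν ν y ≠ 0)
    {ν' : E n → E (n + 2)} {U' : Set (E n)} (h' : IsQuadraticAt x α β ((ch n p).symm y) ν' U')
    (b : E (n + 2)) :
    torusForm (param x ((ch n p).symm y)) ν' α b (coord ((ch n p).symm y)) ^ 2
      = torusForm (param x p) ν α b y ^ 2 := by
  have hz := coord_mem_pullDom h.subset_target hy
  have hc := carre_transfer h.toIsFramed hz (h.diff_normal hz.2) (h.diff_normal hz.2)
  have e := h.torusForm_transfer _ hz b
  rw [trans_coord (h.subset_target hy)] at hc e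
  rw [← e]
  exact (h.toIsLocalHypersurface.transfer _).torusForm_sq_unique h'.toIsLocalHypersurface hz
    h'.coord_mem (h.quadRel_transfer _ hz) (h'.quadRel _ h'.coord_mem) (by rw [hc]; exact hS) b

end IsQuadraticAt

/-- The torus form takes the same value, up to sign, at any two points of `M`. -/
lemma torusForm_sq_const [PreconnectedSpace M] (hn : 1 ≤ n)
    (hS : ∀ q, sqNormSFF (n := n) x q ≠ 0) (hβ : 0 < β)
    (hq : ∀ p, ∃ ν U, IsQuadraticAt x α β p ν U) {p q : M} {ν ν' : E n → E (n + 2)}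
    {U U' : Set (E n)} (h : IsQuadraticAt x α β p ν U) (h' : IsQuadraticAt x α β q ν' U')
    (b : E (n + 2)) :
    torusForm (param x p) ν α b (coord p) ^ 2 = torusForm (param x q) ν' α b (coord q) ^ 2 := by
  choose N W hNW using hq
  set Θ : M → ℝ := fun p => torusForm (param x p) (N p) α b (coord p) ^ 2 with hΘ
  have key : ∀ (p : M) (ν : E n → E (n + 2)) (U : Set (E n)), IsQuadraticAt x α β p ν U →
      ∀ y ∈ U, Θ ((ch n p).symm y) = torusForm (param x p) ν α b y ^ 2 := by
    intro p ν U h y hy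
    refine h.torusForm_sq_eq hy ?_ (hNW _) b
    rw [← h.toIsLocalHypersurface.sqNormSFF_eq h.subset_target hy]
    exact hS _
  have e1 := key p ν U h _ h.coord_mem
  have e2 := key q ν' U' h' _ h'.coord_mem
  rw [ch_symm_coord] at e1 e2
  rw [← e1, ← e2]
  refine eq_of_pd_eq_zero (n := n) (fun p => ⟨W p, (hNW p).isOpen, (hNW p).coord_mem, ?_⟩) p q
  intro z hz
  have hL := (hNW p).toIsLocalHypersurface
  have d := differentiableAt_of_contDiffOn (hL.contDiffOn_torusForm α b) hL.isOpen hz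
  have he : Set.EqOn (Θ ∘ (ch n p).symm)
      (fun y => torusForm (param x p) (N p) α b y * torusForm (param x p) (N p) α b y) (W p) :=
    fun y hy => (key p _ _ (hNW p) y hy).trans (sq _)
  refine ⟨(d.fun_mul d).congr_of_eventuallyEq (he.eventuallyEq_of_mem (hL.isOpen.mem_nhds hz)),
    fun k => ?_⟩
  rw [pd_congr_of_isOpen hL.isOpen hz he, pd_mul d d,
    hL.pd_torusForm_eq_zero hn (hNW p).quadRel hβ hz]
  ring

/-- In the equality case the torus form of any point vanishes on the image of the immersion. -/
lemma torusForm_eq_zero [PreconnectedSpace M] (hn : 1 ≤ n)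
    (hS : ∀ q, sqNormSFF (n := n) x q ≠ 0) (hβ : 0 < β)
    (hq : ∀ p, ∃ ν U, IsQuadraticAt x α β p ν U) {p : M} {ν : E n → E (n + 2)}
    {U : Set (E n)} (h : IsQuadraticAt x α β p ν U) (q : M) :
    torusForm (param x p) ν α (x q) (coord p) = 0 := by
  obtain ⟨ν', U', h'⟩ := hq q
  have := torusForm_sq_const hn hS hβ hq h h' (x q)
  rw [h'.torusForm_self] at this
  exact pow_eq_zero_iff two_ne_zero |>.1 (this.trans (by ring))

end EqualityCase

/-! ### The plane of the circle factor -/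

/-- An orthogonal projection of trace one has rank one. -/
lemma exists_vec_of_idempotent {n : ℕ} {P : Matrix (Fin n) (Fin n) ℝ}
    (hs : ∀ i j, P i j = P j i) (hi : ∀ i j, ∑ k, P i k * P k j = P i j) (ht : ∑ i, P i i = 1) :
    ∃ w : Fin n → ℝ, ∑ i, w i ^ 2 = 1 ∧ ∀ i j, P i j = w i * w j := by
  obtain ⟨m, -, hm⟩ : ∃ m ∈ Finset.univ, P m m ≠ 0 :=
    Finset.exists_ne_zero_of_sum_ne_zero (by rw [ht]; exact one_ne_zero)
  have hmm : ∑ k, P k m ^ 2 = P m m := by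
    rw [← hi m m]
    exact Finset.sum_congr rfl fun k _ => by rw [hs m k, sq]
  have hpos : 0 < P m m :=
    lt_of_le_of_ne (hmm ▸ Finset.sum_nonneg fun k _ => sq_nonneg _) (Ne.symm hm)
  have hq := Real.sq_sqrt hpos.le
  have hq0 := (Real.sqrt_pos.2 hpos).ne'
  set c := Real.sqrt (P m m)
  set w : Fin n → ℝ := fun i => P i m / c with hw
  have hw1 : ∑ i, w i ^ 2 = 1 := by
    simp only [hw, div_pow, ← Finset.sum_div, hmm, hq]
    exact div_self hm
  have hPw : ∀ i, ∑ k, P i k * w k = w i := by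
    intro i
    simp only [hw, mul_div_assoc', ← Finset.sum_div, hi]
  refine ⟨w, hw1, fun i j => sub_eq_zero.1 ?_⟩
  -- the difference of the two projections is a projection of trace zero
  have hsum : ∑ i, ∑ j, (P i j - w i * w j) ^ 2 = 0 := by
    have e : ∀ i, ∑ j, (P i j - w i * w j) ^ 2 = P i i - w i ^ 2 := by
      intro i
      have e1 : ∀ j, (P i j - w i * w j) ^ 2
          = P i j * P j i - 2 * w i * (P i j * w j) + w i ^ 2 * w j ^ 2 := fun j => by
        rw [← hs i j]; ring
      simp only [e1, Finset.sum_add_distrib, Finset.sum_sub_distrib, ← Finset.mul_sum, hi, hPw, hw1]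
      ring
    simp only [e, Finset.sum_sub_distrib, ht, hw1, sub_self]
  have h1 := (Finset.sum_eq_zero_iff_of_nonneg fun i _ => Finset.sum_nonneg fun j _ =>
    sq_nonneg _).1 hsum i (Finset.mem_univ _)
  have h2 := (Finset.sum_eq_zero_iff_of_nonneg fun j _ => sq_nonneg _).1 h1 j (Finset.mem_univ _)
  exact pow_eq_zero_iff two_ne_zero |>.1 h2

/-- For the shape operator of the Clifford torus, the torus form is, up to a factor,
`n |Π b|² - |b|²` for the orthogonal projection `Π` to a plane. -/
lemma IsLocalHypersurface.exists_plane {n : ℕ} {f ν : E n → E (n + 2)} {U : Set (E n)} {y : E n}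
    (h : IsLocalHypersurface f ν U) (hn : 2 ≤ n) (hy : y ∈ U) {κ : ℝ} (hκ2 : κ ^ 2 = n - 1)
    (hr : QuadRel f ν (κ * (n - 2) / (n - 1)) 1 y) :
    ∃ v e : E (n + 2), ‖v‖ = 1 ∧ ‖e‖ = 1 ∧ inner ℝ v e = (0 : ℝ) ∧
      ∀ b, κ * torusForm f ν (κ * (n - 2) / (n - 1)) b y
        = n * (inner ℝ v b ^ 2 + inner ℝ e b ^ 2) - ‖b‖ ^ 2 := by
  have hn2 : (2 : ℝ) ≤ n := by exact_mod_cast hn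
  have hn0 : (0 : ℝ) < n := by linarith
  have hn1 : (n : ℝ) - 1 ≠ 0 := by linarith
  set α := κ * (n - 2) / (n - 1) with hα
  have hκα : κ * α = n - 2 := by
    rw [hα, mul_div_assoc', ← mul_assoc, ← sq, hκ2]; field_simp
  obtain ⟨τ, V, rfl, hτ, hm, hJ, had⟩ := h.exists_isAdapted hy
  have hr0 : QuadRel (f ∘ τ) (ν ∘ τ) α 1 0 :=
    (quadRel_comp (h.diff (hm had.mem)) (h.diff_normal (hm had.mem))
      (hτ.differentiable (by simp) 0) (hJ 0 had.mem)).2 hr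
  have htf : ∀ b, torusForm f ν α b (τ 0) = torusForm (f ∘ τ) (ν ∘ τ) α b 0 := fun b =>
    (h.torusForm_comp hτ (hm had.mem) (hJ 0 had.mem) α b).symm
  simp only [htf]
  generalize f ∘ τ = F at had hr0 ⊢
  generalize ν ∘ τ = N at had hr0 ⊢
  set H : Fin n → Fin n → ℝ := fun i j => sff F N i j 0 with hH
  have hHs : ∀ i j, H i j = H j i := had.sff_symm had.mem
  have hHt : ∑ i, H i i = 0 := had.trace_sff
  have hH2 : ∀ i j, ∑ k, H i k * H k j = α * H i j + if i = j then 1 else 0 := by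
    intro i j
    have := hr0 i j
    rw [had.inner_pd_normal_pd_normal had.mem, had.gram_zero, Matrix.one_apply] at this
    simp only [inv_one, Matrix.one_apply, ite_mul, one_mul, zero_mul, Finset.sum_ite_eq,
      Finset.mem_univ, if_true] at this
    rw [← this]
    exact Finset.sum_congr rfl fun k _ => by rw [hHs k j]
  -- `(κ A + 1) / n` is the projection to the eigenline of the simple eigenvalue `κ`, the other
  -- eigenvalue being `-1 / κ`; this line and the direction of `x - κ ν` span the plane
  obtain ⟨w, hw1, hw⟩ := exists_vec_of_idempotent
    (P := Matrix.of fun i j => (κ * H i j + if i = j then 1 else 0) / n) (by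
      intro i j
      simp only [Matrix.of_apply, hHs i j, eq_comm]) (by
      intro i j
      simp only [Matrix.of_apply]
      have e : ∀ k, (κ * H i k + if i = k then 1 else 0) / n * ((κ * H k j + if k = j then 1 else 0) / n)
          = (κ ^ 2 * (H i k * H k j) + κ * (H i k * if k = j then 1 else 0)
            + (if i = k then 1 else 0) * (κ * H k j)
            + (if i = k then 1 else 0) * if k = j then 1 else 0) / n ^ 2 := fun k => by
        field_simp; ring
      simp only [e, ← Finset.sum_div, Finset.sum_add_distrib, ← Finset.mul_sum, hH2]
      simp only [mul_ite, mul_one, mul_zero, ite_mul, one_mul, zero_mul, Finset.sum_ite_eq,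
        Finset.sum_ite_eq', Finset.mem_univ, if_true]
      have e2 : κ ^ 2 * α = κ * (n - 2) := by rw [sq, mul_assoc, hκα]
      rw [mul_add, ← mul_assoc, e2, hκ2]
      split_ifs <;> field_simp <;> ring) (by
      simp only [Matrix.of_apply, if_true, ← Finset.sum_div, Finset.sum_add_distrib,
        ← Finset.mul_sum, hHt]
      simpa using hn0.ne')
  simp only [Matrix.of_apply] at hw
  have hff := had.inner_self 0 had.mem
  have hNN := had.normal_self 0 had.mem
  have hfN := had.inner_normal 0 had.mem
  have hpN := had.pd_normal 0 had.mem
  have hpf := fun i => had.pd_inner_self had.mem i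
  have hg : ∀ i j, inner ℝ (pd i F 0) (pd j F 0) = if i = j then (1 : ℝ) else 0 := fun i j => by
    have := congrFun (congrFun had.gram_zero i) j
    rwa [gram, Matrix.of_apply, Matrix.one_apply] at this
  have hsn : Real.sqrt n ^ 2 = n := Real.sq_sqrt hn0.le
  have hsn0 : Real.sqrt n ≠ 0 := (Real.sqrt_pos.2 hn0).ne'
  refine ⟨(Real.sqrt n)⁻¹ • (F 0 - κ • N 0), ∑ i, w i • pd i F 0, ?_, ?_, ?_, fun b => ?_⟩
  · rw [← pow_eq_one_iff_of_nonneg (norm_nonneg _) two_ne_zero, ← real_inner_self_eq_norm_sq]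
    simp only [inner_smul_left, inner_smul_right, inner_sub_left, inner_sub_right, hff, hNN, hfN,
      real_inner_comm (F 0) (N 0), RCLike.conj_to_real]
    field_simp
    rw [hsn]; linarith
  · rw [← pow_eq_one_iff_of_nonneg (norm_nonneg _) two_ne_zero, ← real_inner_self_eq_norm_sq, ← hw1]
    simp only [sum_inner, inner_sum, inner_smul_left, inner_smul_right, hg, RCLike.conj_to_real]
    simp [sq]
  · rw [inner_sum]
    refine Finset.sum_eq_zero fun i _ => ?_
    rw [inner_smul_right, inner_smul_left, inner_sub_left, inner_smul_left,
      real_inner_comm (pd i F 0) (F 0), real_inner_comm (pd i F 0) (N 0), hpf, hpN]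
    ring
  · have hpar := had.parseval had.mem b b
    rw [real_inner_self_eq_norm_sq, had.gram_zero] at hpar
    simp only [inv_one, Matrix.one_apply, ite_mul, one_mul, zero_mul, Finset.sum_ite_eq,
      Finset.mem_univ, if_true] at hpar
    have hT : torusForm F N α b 0 = ∑ i, ∑ j, H i j * (inner ℝ (pd i F 0) b * inner ℝ (pd j F 0) b)
        - 2 * (inner ℝ (F 0) b * inner ℝ (N 0) b) + α * (inner ℝ (N 0) b * inner ℝ (N 0) b) := by
      rw [torusForm, had.carre_zero]
      congr 2
      rw [← Finset.sum_neg_distrib]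
      refine Finset.sum_congr rfl fun i _ => ?_
      rw [had.pd_normal_inner_zero, pd_inner_const (had.diff had.mem)]
      simp only [RCLike.inner_apply, conj_trivial, mul_neg, neg_neg, Finset.mul_sum]
      exact Finset.sum_congr rfl fun j _ => by ring
    have he : inner ℝ (∑ i, w i • pd i F 0) b ^ 2
        = (κ * ∑ i, ∑ j, H i j * (inner ℝ (pd i F 0) b * inner ℝ (pd j F 0) b)
          + ∑ i, inner ℝ (pd i F 0) b * inner ℝ (pd i F 0) b) / n := by
      have : inner ℝ (∑ i, w i • pd i F 0) b ^ 2
          = ∑ i, ∑ j, (w i * w j) * (inner ℝ (pd i F 0) b * inner ℝ (pd j F 0) b) := by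
        simp only [sum_inner, inner_smul_left, RCLike.conj_to_real, sq, Finset.sum_mul_sum]
        exact Finset.sum_congr rfl fun i _ => Finset.sum_congr rfl fun j _ => by ring
      rw [this]
      simp only [← hw]
      simp only [add_div, add_mul, Finset.sum_add_distrib, Finset.mul_sum, Finset.sum_div]
      congr 1
      · exact Finset.sum_congr rfl fun i _ => Finset.sum_congr rfl fun j _ => by ring
      · refine Finset.sum_congr rfl fun i _ => ?_
        simp only [ite_div, zero_div, ite_mul, zero_mul, Finset.sum_ite_eq, Finset.mem_univ,
          if_true]
        ring
    rw [hT, he, hpar]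
    simp only [inner_smul_left, inner_sub_left, RCLike.conj_to_real]
    have e3 : n * (((Real.sqrt n)⁻¹ * (inner ℝ (F 0) b - κ * inner ℝ (N 0) b)) ^ 2)
        = (inner ℝ (F 0) b - κ * inner ℝ (N 0) b) ^ 2 := by
      rw [mul_pow, inv_pow, hsn]; field_simp
    rw [mul_add (n : ℝ), e3, mul_div_cancel₀ _ hn0.ne']
    linear_combination (inner ℝ (N 0) b) ^ 2 * (hκα - hκ2)

/-! ### The Clifford torus -/

/-- For `n ≥ 2` the torus is the image of a product of two connected unit spheres. -/
lemma isPreconnected_cliffordTorus {n : ℕ} (hn : 2 ≤ n) : IsPreconnected (cliffordTorus n) := by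
  have hn0 : (0 : ℝ) < n := by positivity
  have hn1 : (0 : ℝ) < n - 1 := by
    have : (2 : ℝ) ≤ n := by exact_mod_cast hn
    linarith
  set c := Real.sqrt (1 / n) with hc
  set d := Real.sqrt ((n - 1) / n) with hd
  have hc2 : c ^ 2 = 1 / n := Real.sq_sqrt (by positivity)
  have hd2 : d ^ 2 = (n - 1) / n := Real.sq_sqrt (by positivity)
  have hc0 : c ≠ 0 := (Real.sqrt_pos.2 (by positivity)).ne'
  have hd0 : d ≠ 0 := (Real.sqrt_pos.2 (by positivity)).ne'
  set F : E 2 × E n → E (n + 2) := fun z =>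
    WithLp.toLp 2 (Fin.cons (c * z.1 0) (Fin.cons (c * z.1 1) fun i => d * z.2 i)) with hF
  have hF0 : ∀ z, F z 0 = c * z.1 0 := fun z => rfl
  have hF1 : ∀ z, F z 1 = c * z.1 1 := fun z => rfl
  have hF2 : ∀ z i, F z (Fin.succ (Fin.succ i)) = d * z.2 i := fun z i => rfl
  have hFc : Continuous F := by
    refine (PiLp.continuous_toLp 2 _).comp (continuous_pi fun i => ?_)
    refine Fin.cases ?_ (fun i => Fin.cases ?_ (fun i => ?_) i) i
    · change Continuous fun z : E 2 × E n => c * z.1 0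
      fun_prop
    · change Continuous fun z : E 2 × E n => c * z.1 1
      fun_prop
    · change Continuous fun z : E 2 × E n => d * z.2 i
      fun_prop
  have himg : cliffordTorus n
      = F '' (Metric.sphere (0 : E 2) 1 ×ˢ Metric.sphere (0 : E n) 1) := by
    ext z
    constructor
    · rintro ⟨h1, h2⟩
      refine ⟨(WithLp.toLp 2 ![z 0 / c, z 1 / c], WithLp.toLp 2 fun i => z i.succ.succ / d),
        ⟨?_, ?_⟩, ?_⟩
      · rw [mem_sphere_zero_iff_norm, ← pow_eq_one_iff_of_nonneg (norm_nonneg _) two_ne_zero,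
          EuclideanSpace.real_norm_sq_eq, Fin.sum_univ_two]
        change (z 0 / c) ^ 2 + (z 1 / c) ^ 2 = 1
        rw [div_pow, div_pow, ← add_div, h1, hc2]
        field_simp
      · rw [mem_sphere_zero_iff_norm, ← pow_eq_one_iff_of_nonneg (norm_nonneg _) two_ne_zero,
          EuclideanSpace.real_norm_sq_eq]
        change ∑ i : Fin n, (z i.succ.succ / d) ^ 2 = 1
        simp only [div_pow, ← Finset.sum_div]
        rw [h2, hd2]
        field_simp
      · ext i
        refine Fin.cases ?_ (fun i => Fin.cases ?_ (fun i => ?_) i) i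
        · rw [hF0]; exact mul_div_cancel₀ _ hc0
        · exact (hF1 _).trans (mul_div_cancel₀ _ hc0)
        · rw [hF2]; exact mul_div_cancel₀ _ hd0
    · rintro ⟨⟨u, w⟩, ⟨hu, hw⟩, rfl⟩
      rw [mem_sphere_zero_iff_norm, ← pow_eq_one_iff_of_nonneg (norm_nonneg _) two_ne_zero,
        EuclideanSpace.real_norm_sq_eq] at hu hw
      rw [Fin.sum_univ_two] at hu
      refine ⟨?_, ?_⟩
      · rw [hF0, hF1, mul_pow, mul_pow, ← mul_add, hu, hc2, mul_one]
      · simp only [hF2, mul_pow, ← Finset.mul_sum]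
        rw [hw, hd2, mul_one]
  rw [himg]
  refine IsPreconnected.image (IsPreconnected.prod ?_ ?_) F hFc.continuousOn
  · exact isPreconnected_sphere (by simp [← Module.finrank_eq_rank]) _ _
  · refine isPreconnected_sphere ?_ _ _
    rw [← Module.finrank_eq_rank, finrank_euclideanSpace_fin]
    exact_mod_cast hn

/-- The Clifford torus over the plane spanned by `v` and `e`. -/
def torusOver (n : ℕ) (v e : E (n + 2)) : Set (E (n + 2)) :=
  {z | inner ℝ v z ^ 2 + inner ℝ e z ^ 2 = 1 / (n : ℝ) ∧ ‖z‖ = 1}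

lemma exists_isometry_torusOver {n : ℕ} (hn : 1 ≤ n) {v e : E (n + 2)} (hv : ‖v‖ = 1)
    (he : ‖e‖ = 1) (hve : inner ℝ v e = (0 : ℝ)) :
    ∃ Φ : E (n + 2) ≃ₗᵢ[ℝ] E (n + 2), Φ '' cliffordTorus n = torusOver n v e := by
  have ho : Orthonormal ℝ (Set.domRestrict ({0, 1} : Set (Fin (n + 2)))
      fun i => if i = 0 then v else e) := by
    refine ⟨fun i => ?_, fun i j hij => ?_⟩
    · rcases i with ⟨i, rfl | rfl⟩
      · simpa [Set.domRestrict] using hv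
      · simpa [Set.domRestrict] using he
    · rcases i with ⟨i, rfl | rfl⟩ <;> rcases j with ⟨j, rfl | rfl⟩
      · exact absurd rfl hij
      · simpa [Set.domRestrict] using hve
      · simpa [Set.domRestrict, real_inner_comm] using hve
      · exact absurd rfl hij
  obtain ⟨b, hb⟩ := ho.exists_orthonormalBasis_extension_of_card_eq (by simp)
  have hb0 : b 0 = v := by simpa using hb 0 (by simp)
  have hb1 : b 1 = e := by simpa using hb 1 (by simp)
  have hn0 : (n : ℝ) ≠ 0 := by positivity
  refine ⟨b.repr.symm, ?_⟩
  ext z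
  rw [show b.repr.symm '' cliffordTorus n = b.repr ⁻¹' cliffordTorus n from
    b.repr.symm.toEquiv.image_eq_preimage_symm _]
  change b.repr z ∈ cliffordTorus n ↔ _
  have hsum : ‖z‖ ^ 2 = inner ℝ v z ^ 2 + inner ℝ e z ^ 2
      + ∑ i : Fin n, inner ℝ (b i.succ.succ) z ^ 2 := by
    rw [← b.sum_sq_inner_right z, Fin.sum_univ_succ, Fin.sum_univ_succ, hb0, ← add_assoc]
    congr 2
    rw [← hb1]; rfl
  simp only [cliffordTorus, torusOver, Set.mem_ofPred_eq, b.repr_apply_apply, hb0, hb1]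
  refine and_congr_right fun h => ?_
  rw [← pow_eq_one_iff_of_nonneg (norm_nonneg _) two_ne_zero, hsum, h]
  constructor
  · intro h2
    rw [h2]; field_simp; ring
  · intro h2
    field_simp at h2 ⊢
    linarith

/-- An immersion of an `n`-manifold into the Clifford torus is open onto it: independent rescalings
of the two components of the position vector extend it to a local diffeomorphism of the ambient
space, which meets the torus only where both factors are `1`. -/
lemma exists_nhds_inter_torusOver {n : ℕ} (hn : 2 ≤ n) {f : E n → E (n + 2)} {y : E n}
    (hfs : ContDiffAt ℝ ∞ f y) (hfi : Function.Injective (fderiv ℝ f y))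
    {v e : E (n + 2)} (hv : ‖v‖ = 1) (he : ‖e‖ = 1) (hve : inner ℝ v e = (0 : ℝ))
    (hT : ∀ z, f z ∈ torusOver n v e) :
    ∃ O ∈ nhds (f y), O ∩ torusOver n v e ⊆ Set.range f := by
  have hn2 : (2 : ℝ) ≤ n := by exact_mod_cast hn
  have hn0 : (0 : ℝ) < n := by linarith
  have hfT : ∀ z, inner ℝ v (f z) ^ 2 + inner ℝ e (f z) ^ 2 = 1 / (n : ℝ) := fun z => (hT z).1
  have hf1 : ∀ z, inner ℝ (f z) (f z) = (1 : ℝ) := fun z => by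
    rw [real_inner_self_eq_norm_sq, (hT z).2, one_pow]
  have hvv : inner ℝ v v = (1 : ℝ) := by rw [real_inner_self_eq_norm_sq, hv, one_pow]
  have hee : inner ℝ e e = (1 : ℝ) := by rw [real_inner_self_eq_norm_sq, he, one_pow]
  have hev : inner ℝ e v = (0 : ℝ) := by rw [real_inner_comm]; exact hve
  have hfd := (hfs.differentiableAt (by simp)).hasFDerivAt
  set f' := fderiv ℝ f y
  set P : E (n + 2) →L[ℝ] E (n + 2) :=
    (innerSL ℝ v).smulRight v + (innerSL ℝ e).smulRight e with hP
  have hPb : ∀ b, P b = inner ℝ v b • v + inner ℝ e b • e := fun b => by simp [hP]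
  -- the tangent space is orthogonal to both components of the position vector
  have ht1 : ∀ u, inner ℝ (f' u) (P (f y)) = (0 : ℝ) := by
    intro u
    have hc : HasFDerivAt (fun z => inner ℝ v (f z) * inner ℝ v (f z)
        + inner ℝ e (f z) * inner ℝ e (f z)) (0 : E n →L[ℝ] ℝ) y := by
      simp only [← sq, hfT]; exact hasFDerivAt_const _ _
    have h1 : HasFDerivAt (fun z => inner ℝ v (f z)) ((innerSL ℝ v).comp f') y :=
      (innerSL ℝ v).hasFDerivAt.comp y hfd
    have h2 : HasFDerivAt (fun z => inner ℝ e (f z)) ((innerSL ℝ e).comp f') y :=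
      (innerSL ℝ e).hasFDerivAt.comp y hfd
    have h3 := congrArg (fun L : E n →L[ℝ] ℝ => L u)
      (((h1.fun_mul h1).fun_add (h2.fun_mul h2)).unique hc)
    simp at h3
    rw [hPb, inner_add_right, inner_smul_right, inner_smul_right, real_inner_comm v,
      real_inner_comm e]
    linarith
  have ht2 : ∀ u, inner ℝ (f' u) (f y) = (0 : ℝ) := by
    intro u
    have hc : HasFDerivAt (fun z => inner ℝ (f z) (f z)) (0 : E n →L[ℝ] ℝ) y := by
      simp only [hf1]; exact hasFDerivAt_const _ _
    have h3 := congrArg (fun L : E n →L[ℝ] ℝ => L u) ((hfd.inner ℝ hfd).unique hc)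
    simp [fderivInnerCLM_apply] at h3
    rw [real_inner_comm (f' u)] at h3
    linarith
  have hPP : ∀ z, inner ℝ (P (f z)) (P (f z)) = 1 / (n : ℝ) := by
    intro z
    rw [← hfT z, hPb]
    simp only [inner_add_left, inner_add_right, inner_smul_left, inner_smul_right, hvv, hee, hve,
      hev, RCLike.conj_to_real]
    ring
  have hPf : ∀ z, inner ℝ (f z) (P (f z)) = 1 / (n : ℝ) := by
    intro z
    rw [← hfT z, hPb]
    simp only [inner_add_right, inner_smul_right, real_inner_comm v, real_inner_comm e]
    ring
  -- the extension by rescaling both components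
  set F : E n × ℝ × ℝ → E (n + 2) := fun z =>
    z.2.1 • P (f z.1) + z.2.2 • (f z.1 - P (f z.1)) with hF
  have hFs : ContDiffAt ℝ ∞ F (y, 1, 1) := by
    have h1 : ContDiffAt ℝ ∞ (fun z : E n × ℝ × ℝ => f z.1) (y, 1, 1) :=
      ContDiffAt.comp (y, (1 : ℝ), (1 : ℝ)) hfs contDiffAt_fst
    have h2 : ContDiffAt ℝ ∞ (fun z : E n × ℝ × ℝ => P (f z.1)) (y, 1, 1) :=
      P.contDiff.contDiffAt.comp _ h1
    exact ((contDiff_fst.comp contDiff_snd).contDiffAt.smul h2).add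
      ((contDiff_snd.comp contDiff_snd).contDiffAt.smul (h1.sub h2))
  have hFd : HasFDerivAt F (fderiv ℝ F (y, 1, 1)) (y, 1, 1) :=
    (hFs.differentiableAt (by simp)).hasFDerivAt
  have hval : ∀ u σ τ, fderiv ℝ F (y, 1, 1) (u, σ, τ)
      = f' u + σ • P (f y) + τ • (f y - P (f y)) := by
    intro u σ τ
    have h1 : HasFDerivAt (fun z : E n × ℝ × ℝ => f z.1)
        (f'.comp (ContinuousLinearMap.fst ℝ (E n) (ℝ × ℝ))) (y, 1, 1) :=
      HasFDerivAt.comp (y, (1 : ℝ), (1 : ℝ)) hfd hasFDerivAt_fst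
    have h2 : HasFDerivAt (fun z : E n × ℝ × ℝ => P (f z.1))
        (P.comp (f'.comp (ContinuousLinearMap.fst ℝ (E n) (ℝ × ℝ)))) (y, 1, 1) :=
      P.hasFDerivAt.comp _ h1
    have h3 : HasFDerivAt (fun z : E n × ℝ × ℝ => z.2.1)
        ((ContinuousLinearMap.fst ℝ ℝ ℝ).comp (ContinuousLinearMap.snd ℝ (E n) (ℝ × ℝ)))
        (y, 1, 1) := hasFDerivAt_fst.comp _ hasFDerivAt_snd
    have h4 : HasFDerivAt (fun z : E n × ℝ × ℝ => z.2.2)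
        ((ContinuousLinearMap.snd ℝ ℝ ℝ).comp (ContinuousLinearMap.snd ℝ (E n) (ℝ × ℝ)))
        (y, 1, 1) := hasFDerivAt_snd.comp _ hasFDerivAt_snd
    have h5 := ((h3.smul h2).add (h4.smul (h1.sub h2))).fderiv
    change fderiv ℝ F (y, 1, 1) = _ at h5
    rw [h5]
    simp
    abel
  have hinj : Function.Injective (fderiv ℝ F (y, 1, 1)) := by
    rw [injective_iff_map_eq_zero]
    rintro ⟨u, σ, τ⟩ h0
    rw [hval] at h0
    have i1 := congrArg (fun w => inner ℝ w (P (f y))) h0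
    simp only [inner_add_left, inner_smul_left, inner_sub_left, ht1, hPP, hPf, inner_zero_left,
      RCLike.conj_to_real, sub_self, mul_zero, add_zero, zero_add] at i1
    have hσ : σ = 0 := (mul_eq_zero.1 i1).resolve_right (by positivity)
    subst hσ
    have i2 := congrArg (fun w => inner ℝ w (f y)) h0
    simp only [inner_add_left, inner_smul_left, inner_sub_left, ht2, hf1,
      real_inner_comm (f y) (P (f y)), hPf, inner_zero_left, RCLike.conj_to_real, zero_mul,
      zero_add] at i2
    have hτ : τ = 0 := (mul_eq_zero.1 i2).resolve_right (by
      have : 1 / (n : ℝ) ≤ 1 / 2 := one_div_le_one_div_of_le two_pos hn2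
      linarith)
    subst hτ
    have i3 : f' u = 0 := by simpa using h0
    have hu : u = 0 := hfi (i3.trans (map_zero _).symm)
    rw [hu]; rfl
  have hsurj : (fderiv ℝ F (y, 1, 1)).range = ⊤ := by
    rw [LinearMap.range_eq_top]
    refine (LinearMap.injective_iff_surjective_of_finrank_eq_finrank ?_).1 hinj
    simp [Module.finrank_prod]
  have hmap := (hFs.hasStrictFDerivAt (by simp)).map_nhds_eq_of_surj hsurj
  have hFp : F (y, 1, 1) = f y := by
    simp only [hF, one_smul, add_sub_cancel]
  rw [hFp] at hmap
  -- positive factors are determined by the squared norms of the components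
  set W : Set (E n × ℝ × ℝ) := {z | 0 < z.2.1 ∧ 0 < z.2.2} with hW
  have hWo : IsOpen W := by
    have h1 : Continuous fun z : E n × ℝ × ℝ => z.2.1 := by fun_prop
    have h2 : Continuous fun z : E n × ℝ × ℝ => z.2.2 := by fun_prop
    exact (isOpen_lt continuous_const h1).inter (isOpen_lt continuous_const h2)
  refine ⟨F '' W, ?_, ?_⟩
  · rw [← hmap]
    exact Filter.image_mem_map (hWo.mem_nhds ⟨one_pos, one_pos⟩)
  · rintro _ ⟨⟨⟨z, s, t⟩, ⟨hs, ht⟩, rfl⟩, hz1, hz2⟩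
    simp only at hs ht
    have e1 : inner ℝ v (P (f z)) = inner ℝ v (f z) := by
      rw [hPb, inner_add_right, inner_smul_right, inner_smul_right, hvv, hve]; ring
    have e2 : inner ℝ e (P (f z)) = inner ℝ e (f z) := by
      rw [hPb, inner_add_right, inner_smul_right, inner_smul_right, hee, hev]; ring
    have hs1 : s = 1 := by
      simp only [hF, inner_add_right, inner_smul_right, inner_sub_right, e1, e2, sub_self,
        mul_zero, add_zero, mul_pow, ← mul_add, hfT] at hz1
      have : s ^ 2 = 1 := by field_simp at hz1; exact hz1
      exact (pow_eq_one_iff_of_nonneg hs.le two_ne_zero).1 this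
    subst hs1
    have ht1 : t = 1 := by
      rw [← pow_eq_one_iff_of_nonneg (norm_nonneg _) two_ne_zero,
        ← real_inner_self_eq_norm_sq] at hz2
      simp only [hF, inner_add_left, inner_add_right, inner_smul_left, inner_smul_right,
        inner_sub_left, inner_sub_right, hPP, hPf, hf1, real_inner_comm (f z) (P (f z)),
        RCLike.conj_to_real, one_mul, sub_self, mul_zero, add_zero] at hz2
      have : t ^ 2 = 1 := by
        have h : (t ^ 2 - 1) * (n - 1) = 0 := by
          field_simp at hz2
          linarith
        have := (mul_eq_zero.1 h).resolve_right (by linarith)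
        linarith
      exact (pow_eq_one_iff_of_nonneg ht.le two_ne_zero).1 this
    subst ht1
    exact ⟨z, by simp only [hF, one_smul, add_sub_cancel]⟩

section

variable {n : ℕ} {M : Type*} [TopologicalSpace M] [ChartedSpace (E n) M]
  [IsManifold (𝓡 n) ∞ M] {x : M → E (n + 2)}

/-- A compact hypersurface immersed in a Clifford torus covers it. -/
lemma range_eq_torusOver [CompactSpace M] [Nonempty M] (hn : 2 ≤ n)
    (hx : IsSphericalImmersion (n := n) x)
    {v e : E (n + 2)} (hv : ‖v‖ = 1) (he : ‖e‖ = 1) (hve : inner ℝ v e = (0 : ℝ))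
    (hT : ∀ q, x q ∈ torusOver n v e) : Set.range x = torusOver n v e := by
  obtain ⟨Φ, hΦ⟩ := exists_isometry_torusOver (by omega : 1 ≤ n) hv he hve
  have hpre : IsPreconnected (torusOver n v e) := by
    rw [← hΦ]
    exact (isPreconnected_cliffordTorus hn).image _ Φ.continuous.continuousOn
  have hcl : IsClosed (Set.range x) := (isCompact_range hx.smooth.continuous).isClosed
  refine Set.Subset.antisymm (by rintro _ ⟨q, rfl⟩; exact hT q) ?_
  by_contra hne
  obtain ⟨z, hzT, hzR⟩ := Set.not_subset.1 hne
  have hloc : ∀ p, ∃ O ∈ nhds (x p), O ∩ torusOver n v e ⊆ Set.range x := by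
    intro p
    obtain ⟨O, hO, hOT⟩ := exists_nhds_inter_torusOver hn
      ((hx.contDiffOn p).contDiffAt ((ch n p).open_target.mem_nhds (coord_mem_target p)))
      (hx.injective_fderiv p (coord_mem_target p)) hv he hve fun z => hT _
    have e : param x p (coord p) = x p := congrArg x (ch_symm_coord (n := n) p)
    rw [e] at hO
    exact ⟨O, hO, hOT.trans (Set.range_comp_subset_range _ _)⟩
  choose O hO hOT using hloc
  obtain ⟨p⟩ := (inferInstance : Nonempty M)
  obtain ⟨w, hwT, hw1, hw2⟩ := hpre (⋃ q, interior (O q)) (Set.range x)ᶜ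
    (isOpen_iUnion fun q => isOpen_interior) hcl.isOpen_compl (by
      intro w hw
      by_cases h : w ∈ Set.range x
      · obtain ⟨q, rfl⟩ := h
        exact Or.inl (Set.mem_iUnion.2 ⟨q, mem_interior_iff_mem_nhds.2 (hO q)⟩)
      · exact Or.inr h)
    ⟨x p, hT p, Set.mem_iUnion.2 ⟨p, mem_interior_iff_mem_nhds.2 (hO p)⟩⟩ ⟨z, hzT, hzR⟩
  obtain ⟨q, hq⟩ := Set.mem_iUnion.1 hw1
  exact hw2 (hOT q ⟨interior_subset hq, hwT⟩)

end

/-! ### The lower bound for constant scalar curvature -/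

section Clifford

variable {n : ℕ} {M : Type*} [TopologicalSpace M] [ChartedSpace (E n) M]
  [IsManifold (𝓡 n) ∞ M] {x : M → E (n + 2)}
  [T2Space M] [CompactSpace M] [ConnectedSpace M] [MeasurableSpace M] [BorelSpace M]

/-- Constant `S > 0` is impossible for curves: the lower bound `1 / (2 n)` would exceed the average
`1 / (n + 2)` of the form. -/
lemma two_le_of_const (hn : 1 ≤ n) (hx : IsSphericalImmersion (n := n) x)
    (hmin : IsMinimal (n := n) x) {s : ℝ} (hs : ∀ q, sqNormSFF (n := n) x q = s) (hs0 : 0 < s) :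
    2 ≤ n := by
  have hn' : (0 : ℝ) < n := by exact_mod_cast hn
  obtain ⟨a, ha, h⟩ := exists_heightMean_le hx
  have h1 := (le_heightMean hn hx hmin hs hs0 ha).trans h
  rw [div_le_div_iff₀ (by positivity) (by positivity)] at h1
  have : (2 : ℝ) ≤ n := by linarith
  exact_mod_cast this

/-- If the lower bound is attained, the torus form of one point cuts out a Clifford torus that
contains the hypersurface. -/
lemma isClifford_of_heightMean_eq (hn : 1 ≤ n) (hx : IsSphericalImmersion (n := n) x)
    (hmin : IsMinimal (n := n) x) {s : ℝ} (hs : ∀ q, sqNormSFF (n := n) x q = s) (hs0 : 0 < s)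
    {a : E (n + 2)} (ha : ‖a‖ = 1) (he : heightMean (n := n) x a = 1 / (2 * (n : ℝ))) :
    IsClifford x := by
  have hn2 := two_le_of_const hn hx hmin hs hs0
  have hn' : (2 : ℝ) ≤ n := by exact_mod_cast hn2
  have hn1 : (0 : ℝ) < n - 1 := by linarith
  -- `κ` is the simple principal curvature if equality holds
  set κ := Real.sqrt ((n - 1) * s / n) with hκ
  have hκ0 : 0 < κ := Real.sqrt_pos.2 (by positivity)
  have hκ2 : κ ^ 2 = (n - 1) * s / n := Real.sq_sqrt (by positivity)
  have hsκ : s = n * κ ^ 2 / (n - 1) := by rw [hκ2]; field_simp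
  have hE := normalEnergy_eq_of_heightMean_eq hn hx hmin hs ha he
  have hβ : 0 < κ ^ 2 / (n - 1) := by positivity
  have hq : ∀ p : M, ∃ ν U, IsQuadraticAt x (κ * (n - 2) / (n - 1)) (κ ^ 2 / (n - 1)) p ν U :=
    fun p => exists_isQuadraticAt hn2 hx hmin hκ0 (fun q => (hs q).trans hsκ) ha
      (fun q => by rw [← hsκ]; exact hE q) p
  obtain ⟨p⟩ := (inferInstance : Nonempty M)
  obtain ⟨ν, U, h⟩ := hq p
  have h1 := h.beta_eq_one hn h.quadRel hβ h.coord_mem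
  have hκn : κ ^ 2 = n - 1 := by rwa [div_eq_one_iff_eq hn1.ne'] at h1
  have hr := h.quadRel _ h.coord_mem
  rw [h1] at hr
  obtain ⟨v, e, hv, hev, hve, hT⟩ := h.exists_plane hn2 h.coord_mem hκn hr
  have hx1 : ∀ q, x q ∈ torusOver n v e := by
    intro q
    have h2 := hT (x q)
    rw [torusForm_eq_zero hn (fun q => by rw [hs]; exact hs0.ne') hβ hq h q, mul_zero,
      hx.norm_eq_one q] at h2
    refine ⟨?_, hx.norm_eq_one q⟩
    field_simp
    linarith
  obtain ⟨Φ, hΦ⟩ := exists_isometry_torusOver hn hv hev hve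
  exact ⟨Φ, (range_eq_torusOver hn2 hx hv hev hve hx1).trans hΦ.symm⟩

/-- On the Clifford torus the means of the squared heights in the two directions of the plane of
the circle factor have the sum `1 / n`; one of them is therefore at most `1 / (2 n)`. -/
lemma IsClifford.exists_heightMean_le (h : IsClifford x) (hx : IsSphericalImmersion (n := n) x) :
    ∃ a : E (n + 2), ‖a‖ = 1 ∧ heightMean (n := n) x a ≤ 1 / (2 * (n : ℝ)) := by
  obtain ⟨Φ, hΦ⟩ := h
  set b : Fin (n + 2) → E (n + 2) := fun i => Φ (EuclideanSpace.single i 1) with hb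
  have hb1 : ∀ i, ‖b i‖ = 1 := fun i => by simp [hb]
  have hp : ∀ q, height x (b 0) q ^ 2 + height x (b 1) q ^ 2 = 1 / n := by
    intro q
    obtain ⟨z, hz, e⟩ : x q ∈ Φ '' cliffordTorus n := hΦ ▸ Set.mem_range_self q
    have : ∀ i, height x (b i) q = z i := by
      intro i
      rw [height, ← e, hb, Φ.inner_map_map, EuclideanSpace.inner_single_right]
      simp
    rw [this, this]
    exact hz.1
  have := isFiniteMeasure_vol hx
  have hV := vol_real_pos hx
  have hsum : heightMean (n := n) x (b 0) + heightMean (n := n) x (b 1) = 1 / n := by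
    rw [heightMean_eq, heightMean_eq, ← add_div,
      ← integral_add (integrable_height_sq hx _) (integrable_height_sq hx _)]
    simp only [hp, integral_const, smul_eq_mul]
    exact mul_div_cancel_left₀ _ hV.ne'
  have e : (1 : ℝ) / n = 1 / (2 * n) + 1 / (2 * n) := by
    rw [← add_div, one_add_one_eq_two, div_mul_eq_div_div, div_self two_ne_zero]
  by_contra! hc
  linarith [hc _ (hb1 0), hc _ (hb1 1)]

end Clifford

end MinimalHypersurface

end


open MinimalHypersurface in
theorem theorem2p3 (n : ℕ) (hn : 1 ≤ n) {M : Type*} [TopologicalSpace M]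
    [ChartedSpace (EuclideanSpace ℝ (Fin n)) M] [IsManifold (𝓡 n) ∞ M] [T2Space M]
    [CompactSpace M] [ConnectedSpace M] [MeasurableSpace M] [BorelSpace M]
    (x : M → EuclideanSpace ℝ (Fin (n + 2))) (hx : IsSphericalImmersion (n := n) x)
    (hmin : IsMinimal (n := n) x) :
    (0 ≤ ⨅ a : Metric.sphere (0 : EuclideanSpace ℝ (Fin (n + 2))) 1, heightMean (n := n) x a) ∧
    (⨅ a : Metric.sphere (0 : EuclideanSpace ℝ (Fin (n + 2))) 1, heightMean (n := n) x a)
      ≤ 1 / ((n : ℝ) + 2) ∧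
    1 / ((n : ℝ) + 2)
      ≤ (⨆ a : Metric.sphere (0 : EuclideanSpace ℝ (Fin (n + 2))) 1, heightMean (n := n) x a) ∧
    (⨆ a : Metric.sphere (0 : EuclideanSpace ℝ (Fin (n + 2))) 1, heightMean (n := n) x a)
      ≤ 1 / ((n : ℝ) + 1) ∧
    ((⨅ a : Metric.sphere (0 : EuclideanSpace ℝ (Fin (n + 2))) 1, heightMean (n := n) x a) = 0
      ↔ IsTotallyGeodesic (n := n) x) ∧
    ((⨆ a : Metric.sphere (0 : EuclideanSpace ℝ (Fin (n + 2))) 1, heightMean (n := n) x a)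
      = 1 / ((n : ℝ) + 1) ↔ IsTotallyGeodesic (n := n) x) ∧
    (IsCSC (n := n) x →
      ((⨅ a : Metric.sphere (0 : EuclideanSpace ℝ (Fin (n + 2))) 1, heightMean (n := n) x a)
        = 1 / ((n : ℝ) + 2) ↔ IsIntegralEinstein (n := n) x ∧ ¬ IsTotallyGeodesic (n := n) x) ∧
      ((⨆ a : Metric.sphere (0 : EuclideanSpace ℝ (Fin (n + 2))) 1, heightMean (n := n) x a)
        = 1 / ((n : ℝ) + 2) ↔ IsIntegralEinstein (n := n) x ∧ ¬ IsTotallyGeodesic (n := n) x) ∧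
      ((∀ p, 0 < sqNormSFF (n := n) x p) ↔ ¬ IsTotallyGeodesic (n := n) x) ∧
      ((∀ p, 0 < sqNormSFF (n := n) x p) →
        1 / (2 * (n : ℝ)) ≤ (⨅ a : Metric.sphere (0 : EuclideanSpace ℝ (Fin (n + 2))) 1,
          heightMean (n := n) x a) ∧
        ((⨅ a : Metric.sphere (0 : EuclideanSpace ℝ (Fin (n + 2))) 1, heightMean (n := n) x a)
          = 1 / (2 * (n : ℝ)) ↔ IsClifford x))) := by
  obtain ⟨a, ha, hinf⟩ := exists_heightMean_eq_iInf hx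
  obtain ⟨c, hc, hsup, hmax⟩ := exists_heightMean_eq_iSup hx
  refine ⟨?_, ?_, ?_, ?_, iInf_eq_zero_iff hn hx hmin, iSup_eq_iff hx hmin, fun hcsc => ?_⟩
  · exact hinf ▸ heightMean_nonneg a
  · obtain ⟨d, hd, h⟩ := exists_heightMean_le hx
    exact (iInf_heightMean_le d hd).trans h
  · obtain ⟨d, hd, h⟩ := exists_le_heightMean hx
    exact h.trans (hsup ▸ hmax d hd)
  · exact hsup ▸ heightMean_le hx hmin hc
  obtain ⟨s, hs⟩ := hcsc.exists_sqNormSFF_eq hx hmin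
  obtain ⟨p⟩ := (inferInstance : Nonempty M)
  refine ⟨iInf_eq_average_iff hn hx hmin hs, iSup_eq_average_iff hn hx hmin hs, ?_, fun hpos => ?_⟩
  · rw [isTotallyGeodesic_iff_const hx hmin hs]
    simp only [hs]
    have h0 : 0 ≤ s := hs p ▸ sqNormSFF_nonneg hx hmin p
    exact ⟨fun h => (h p).ne', fun h _ => lt_of_le_of_ne h0 (Ne.symm h)⟩
  · have hs0 : 0 < s := hs p ▸ hpos p
    have hle : 1 / (2 * (n : ℝ)) ≤ ⨅ a : Metric.sphere (0 : EuclideanSpace ℝ (Fin (n + 2))) 1,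
        heightMean (n := n) x a := hinf ▸ le_heightMean hn hx hmin hs hs0 ha
    refine ⟨hle, fun h => ?_, fun h => le_antisymm ?_ hle⟩
    · exact isClifford_of_heightMean_eq hn hx hmin hs hs0 ha (hinf.symm.trans h)
    · obtain ⟨d, hd, h⟩ := h.exists_heightMean_le hx
      exact (iInf_heightMean_le d hd).trans h
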